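/- Let $k\ge 2$ and $N\ge 1$ be integers and $\chi$ a Dirichlet character modulo $N$. Let $M_k(N,\chi)$ be the space of modular forms of weight $k$ and character $\chi$ on $\Gamma_0(N)$, and let $E_k(N,\chi)\subseteq M_k(N,\chi)$ be the subspace of Eisenstein series, i.e. of those forms that are linear combinations of the Eisenstein series $G_{a,b}(z)=\sum_{c\equiv a\,(N)}\sum_{d\equiv b\,(N)}(cz+d)^{-k}$, where $(c,d)\ne(0,0)$ and the sum is taken first over $d$, then over $c$. For Dirichlet characters $\chi_1,\chi_2$ modulo $N_1,N_2$ put, with $q=e^{2\pi i z}$, $$E(\chi_1,\chi_2,k)(z)=\frac{\delta(\chi_1)}{2}L(1-k,\chi_2)+\sum_{n\ge1}\Big(\sum_{d\mid n}\chi_1(n/d)\chi_2(d)d^{k-1}\Big)q^n,$$ where $\delta(\chi_1)=1$ if $\chi_1$ is principal and $\delta(\chi_1)=0$ otherwise. An Eisenstein newform of weight $k$, level $M$ and character $\psi$ modulo $M$ is an element of $E_k(M,\psi)$ of the form $E(\chi_1,\chi_2,k)$ with $\chi_1,\chi_2$ primitive modulo $N_1,N_2$, $N_1N_2=M$ and $\chi_1\chi_2=\psi$;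 by convention the quasi-modular function $E(\mathbf 1,\mathbf 1,2)$ ($\mathbf 1$ the character modulo $1$) also counts as a newform of weight $2$ and level $1$. A newform for $(N,\chi)$ is a newform of weight $k$ and some level $M\mid N$ whose character induces $\chi$; its shifts are the functions $(f\mid B_d)(z)=f(dz)$ with $Md\mid N$. For a newform $f=\sum_{n\ge0} a_f(n)q^n$ let $\mathbf Q(f)$ be the field generated over $\mathbf Q$ by all $a_f(n)$ (a finite Galois extension of $\mathbf Q$). For $\sigma\in\mathrm{Gal}(\mathbf Q(f)/\mathbf Q)$ let $f^\sigma=\sum_{n\ge0}\sigma(a_f(n))q^n$, and for $\alpha\in\mathbf Q(f)$ let $\mathrm{Tr}(\alpha f)=\sum_{\sigma\in \mathrm{Gal}(\mathbf Q(f)/\mathbf Q)}\sigma(\alpha)f^\sigma$. **Theorem.** Let $E\in E_k(N,\chi)$ be nonzero with rational Fourier coefficients. Then $\chi$ is trivial (principal) or quadratic (of order $2$). Moreover, $E$ is uniquely a sum of shifts of traces of newforms and of rational multiples of newforms with real-valued characters, in the following sense. Let $R$ be any set containing exactly one element of each Galois conjugacy class $\{f^\sigma\}$ of newforms for $(N,\chi)$.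 Then there are unique $\alpha_{d,f}\in\mathbf Q(f)$ and $r_{d,g}\in\mathbf Q$ such that $$E=\sum_{(d,f)}\mathrm{Tr}(\alpha_{d,f}f)\mid B_d+\sum_{(d,g)}(r_{d,g}\,g)\mid B_d ,$$ where $(d,f)$ runs over all pairs with $f=E(\chi_1,\chi_2,k)\in R$ a newform of some level $M$ such that $\chi_1,\chi_2$ are primitive and not both real-valued and $d\ge 1$, $Md\mid N$, and $(d,g)$ runs over all pairs with $g=E(\chi_1,\chi_2,k)$ a newform for $(N,\chi)$ of some level $M$ such that $\chi_1,\chi_2$ are primitive and real-valued and $d\ge1$, $Md\mid N$. (Both sums are finite.) -/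

import Mathlib

open scoped MatrixGroups ModularForm UpperHalfPlane CongruenceSubgroup

noncomputable section

namespace EisDecomp

/-- `M_k(N, χ)`: the modular forms `f` of weight `k` on `Γ₁(N)` such that
`f ∣[k] γ = χ(d) f` for all `γ = (a, b; c, d) ∈ Γ₀(N)`. -/
def modularFormsWithCharacter (k : ℕ) {N : ℕ} (χ : DirichletCharacter ℂ N) :
    Submodule ℂ (ModularForm ((CongruenceSubgroup.Gamma1 N).map (Matrix.SpecialLinearGroup.mapGL ℝ)) k) where
  carrier := {f | ∀ γ : SL(2, ℤ), γ ∈ CongruenceSubgroup.Gamma0 N →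
    (⇑f) ∣[(k : ℤ)] γ = χ ((γ 1 1 : ℤ) : ZMod N) • ⇑f}
  zero_mem' := by
    intro γ _
    simp
  add_mem' := by
    intro f g hf hg γ hγ
    rw [FunLike.coe_add, SlashAction.add_slash, hf γ hγ, hg γ hγ, smul_add]
  smul_mem' := by
    intro c f hf γ hγ
    rw [FunLike.coe_smul, ModularForm.SL_smul_slash, hf γ hγ, smul_comm]

/-- The Eisenstein series of weight `k` and level `N` attached to the residue classes of
`a, b` modulo `N`: the sum of `(c z + d)⁻ᵏ` over all `(c, d) ≠ (0, 0)` with `c ≡ a` and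
`d ≡ b` modulo `N`, first over `d`, then over `c` (the order matters only for `k = 2`).
A term with `(c, d) = (0, 0)` is `1 / 0 = 0`, so it does not contribute. -/
def eisensteinG (k N : ℕ) (a b : ℤ) (z : ℍ) : ℂ :=
  ∑' m : ℤ, ∑' n : ℤ, 1 / (((a + N * m : ℤ) : ℂ) * (z : ℂ) + ((b + N * n : ℤ) : ℂ)) ^ k

/-- `E_k(N, χ)`: the forms in `M_k(N, χ)` that are linear combinations of the Eisenstein series
of weight `k` and level `N`. For `k = 2` an individual `eisensteinG` fails to be modular
(by the same multiple of `c / (c z + d)` for all residue classes); the modular combinations are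
the Eisenstein series of weight `2`. -/
def eisensteinSubspace (k : ℕ) {N : ℕ} (χ : DirichletCharacter ℂ N) :
    Submodule ℂ (ModularForm ((CongruenceSubgroup.Gamma1 N).map (Matrix.SpecialLinearGroup.mapGL ℝ)) k) where
  carrier := {f | f ∈ modularFormsWithCharacter k χ ∧
    ⇑f ∈ Submodule.span ℂ (Set.range fun ab : ℤ × ℤ => eisensteinG k N ab.1 ab.2)}
  zero_mem' := ⟨Submodule.zero_mem _, by
    rw [FunLike.coe_zero]; exact Submodule.zero_mem _⟩
  add_mem' := fun {f g} hf hg => ⟨Submodule.add_mem _ hf.1 hg.1, by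
    rw [FunLike.coe_add]; exact Submodule.add_mem _ hf.2 hg.2⟩
  smul_mem' := fun c {f} hf => ⟨Submodule.smul_mem _ c hf.1, by
    rw [FunLike.coe_smul]; exact Submodule.smul_mem _ c hf.2⟩

/-- `σ_{χ₁,χ₂}^{k-1}(n) = ∑_{d ∣ n} χ₁(n/d) χ₂(d) d^{k-1}`. -/
def sigmaChar {N₁ N₂ : ℕ} (χ₁ : DirichletCharacter ℂ N₁) (χ₂ : DirichletCharacter ℂ N₂)
    (k n : ℕ) : ℂ :=
  ∑ d ∈ n.divisors, χ₁ ((n / d : ℕ) : ZMod N₁) * χ₂ (d : ZMod N₂) * (d : ℂ) ^ (k - 1)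

open Classical in
/-- `E(χ₁, χ₂, k)(z) = (δ(χ₁)/2) L(1 - k, χ₂) + ∑_{n ≥ 1} σ_{χ₁,χ₂}^{k-1}(n) qⁿ`, where
`q = exp(2πiz)` and `δ(χ₁)` is `1` if `χ₁` is principal and `0` otherwise. -/
def eisensteinE {N₁ N₂ : ℕ} [NeZero N₂] (χ₁ : DirichletCharacter ℂ N₁)
    (χ₂ : DirichletCharacter ℂ N₂) (k : ℕ) (z : ℍ) : ℂ :=
  (if χ₁ = 1 then 1 else 0) / 2 * DirichletCharacter.LFunction χ₂ (1 - (k : ℂ)) +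
    ∑' n : ℕ+, sigmaChar χ₁ χ₂ k n * Complex.exp (2 * Real.pi * Complex.I * (n : ℕ) * (z : ℂ))

/-- `f` is an Eisenstein newform of weight `k`, level `M` and character `ψ`: an element of
`E_k(M, ψ)` of the form `E(χ₁, χ₂, k)` with `χ₁, χ₂` primitive modulo `N₁, N₂`, `N₁ N₂ = M` and
`χ₁ χ₂ = ψ`. By convention the quasi-modular function `E(1, 1, 2)` (the only `E(χ₁, χ₂, k)` with
primitive characters and the right parity that is not a modular form) counts as a newform of
weight `2` and level `1`. -/
def IsEisensteinNewform (k : ℕ) {M : ℕ} (ψ : DirichletCharacter ℂ M) (f : ℍ → ℂ) : Prop :=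
  (∃ (N₁ N₂ : ℕ) (_ : NeZero N₂) (h₁ : N₁ ∣ M) (h₂ : N₂ ∣ M)
    (χ₁ : DirichletCharacter ℂ N₁) (χ₂ : DirichletCharacter ℂ N₂),
    N₁ * N₂ = M ∧ χ₁.IsPrimitive ∧ χ₂.IsPrimitive ∧
    DirichletCharacter.changeLevel h₁ χ₁ * DirichletCharacter.changeLevel h₂ χ₂ = ψ ∧
    f = eisensteinE χ₁ χ₂ k) ∧
  ((∃ F ∈ eisensteinSubspace k ψ, ⇑F = f) ∨ (k = 2 ∧ M = 1))

/-- `f` is an Eisenstein newform of weight `k` and of a level `M` dividing `N`, with a character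
modulo `M` that induces `χ` modulo `N`. -/
def IsNewformOfLevel (k : ℕ) {N : ℕ} (χ : DirichletCharacter ℂ N) (M : ℕ) (f : ℍ → ℂ) : Prop :=
  ∃ (h : M ∣ N) (ψ : DirichletCharacter ℂ M),
    DirichletCharacter.changeLevel h ψ = χ ∧ IsEisensteinNewform k ψ f

/-- `f = E(χ₁, χ₂, k)` for primitive real-valued Dirichlet characters `χ₁, χ₂`. -/
def HasRealCharacters (k : ℕ) (f : ℍ → ℂ) : Prop :=
  ∃ (N₁ N₂ : ℕ) (_ : NeZero N₁) (_ : NeZero N₂)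
    (χ₁ : DirichletCharacter ℂ N₁) (χ₂ : DirichletCharacter ℂ N₂),
    χ₁.IsPrimitive ∧ χ₂.IsPrimitive ∧ (∀ a, (χ₁ a).im = 0) ∧ (∀ a, (χ₂ a).im = 0) ∧
    f = eisensteinE χ₁ χ₂ k

/-- The shift `f ∣ B_d`, i.e. `z ↦ f(dz)` (for `d ≥ 1`). -/
def shift (d : ℕ) (f : ℍ → ℂ) (z : ℍ) : ℂ :=
  f (UpperHalfPlane.ofComplex ((d : ℂ) * (z : ℂ)))

/-- The `n`-th Fourier coefficient of `f`, i.e. the coefficient of `exp(2πinz)`. -/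
def fourierCoeff (f : ℍ → ℂ) (n : ℕ) : ℂ :=
  (UpperHalfPlane.qExpansion 1 f).coeff n

/-- `ℚ(f)`: the field generated over `ℚ` by the Fourier coefficients of `f`. -/
def fourierField (f : ℍ → ℂ) : IntermediateField ℚ ℂ :=
  IntermediateField.adjoin ℚ (Set.range (fourierCoeff f))

/-- The Fourier coefficients of `f` as elements of `ℚ(f)`. -/
def fourierCoeff' (f : ℍ → ℂ) (n : ℕ) : fourierField f :=
  ⟨fourierCoeff f n, IntermediateField.subset_adjoin ℚ _ ⟨n, rfl⟩⟩

/-- `f^σ = ∑_n σ(a_f(n)) qⁿ`, for an automorphism `σ` of `ℚ(f)`. -/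
def galoisConj (f : ℍ → ℂ) (σ : fourierField f ≃ₐ[ℚ] fourierField f) (z : ℍ) : ℂ :=
  ∑' n : ℕ, (σ (fourierCoeff' f n) : ℂ) *
    Complex.exp (2 * Real.pi * Complex.I * n * (z : ℂ))

/-- The trace `Tr(α f) = ∑_σ σ(α) f^σ`, where `α ∈ ℚ(f)` and `σ` runs through
`Gal(ℚ(f)/ℚ)` (a finite group for a newform `f`). -/
def galoisTrace (f : ℍ → ℂ) (α : fourierField f) : ℍ → ℂ :=
  ∑ᶠ σ : fourierField f ≃ₐ[ℚ] fourierField f, (σ α : ℂ) • galoisConj f σ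

/-- `R` contains exactly one element of each Galois conjugacy class of newforms
of level dividing `N` and character (inducing) `χ`. -/
structure IsSystemOfRepresentatives (k : ℕ) {N : ℕ} (χ : DirichletCharacter ℂ N)
    (R : Set (ℍ → ℂ)) : Prop where
  isNewform : ∀ f ∈ R, ∃ M, IsNewformOfLevel k χ M f
  existsUnique : ∀ M f, IsNewformOfLevel k χ M f →
    ∃! g, g ∈ R ∧ ∃ σ : fourierField g ≃ₐ[ℚ] fourierField g, galoisConj g σ = f

/-- The pairs `(d, f)` with `f` a newform of some level `M ∣ N` and character `χ`, and `d` a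
divisor of `N / M`. -/
def IsShiftedNewform (k : ℕ) {N : ℕ} (χ : DirichletCharacter ℂ N) (x : ℕ × (ℍ → ℂ)) : Prop :=
  ∃ M, IsNewformOfLevel k χ M x.2 ∧ M * x.1 ∣ N

/-- The pairs `(d, f)` where the newform `f ∈ R` does not have real-valued characters. -/
def TraceIndex (k : ℕ) {N : ℕ} (χ : DirichletCharacter ℂ N) (R : Set (ℍ → ℂ)) :
    Set (ℕ × (ℍ → ℂ)) :=
  {x | IsShiftedNewform k χ x ∧ x.2 ∈ R ∧ ¬ HasRealCharacters k x.2}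

/-- The pairs `(d, f)` where the newform `f` has real-valued characters. -/
def RealIndex (k : ℕ) {N : ℕ} (χ : DirichletCharacter ℂ N) : Set (ℕ × (ℍ → ℂ)) :=
  {x | IsShiftedNewform k χ x ∧ HasRealCharacters k x.2}

/-- There are only finitely many pairs `(d, f)`, so that the sums over `TraceIndex` and
`RealIndex` below are finite sums. -/
theorem finite_isShiftedNewform (k : ℕ) {N : ℕ} [NeZero N] (χ : DirichletCharacter ℂ N) :
    {x | IsShiftedNewform k χ x}.Finite := by
  classical
  have hfin : ∀ n ∈ N.divisors, Finite (DirichletCharacter ℂ n) := by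
    intro n hn
    have : NeZero n := ⟨(Nat.pos_of_mem_divisors hn).ne'⟩
    infer_instance
  refine Set.Finite.subset (s := ⋃ d ∈ N.divisors, ⋃ N₁ ∈ N.divisors, ⋃ N₂ ∈ N.divisors,
    Set.range fun p : DirichletCharacter ℂ N₁ × DirichletCharacter ℂ N₂ =>
      (d, if _h : NeZero N₂ then eisensteinE p.1 p.2 k else 0)) ?_ ?_
  · refine Set.Finite.biUnion N.divisors.finite_toSet fun d _ => ?_
    refine Set.Finite.biUnion N.divisors.finite_toSet fun N₁ h₁ => ?_
    refine Set.Finite.biUnion N.divisors.finite_toSet fun N₂ h₂ => ?_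
    have := hfin N₁ h₁
    have := hfin N₂ h₂
    exact Set.finite_range _
  · rintro ⟨d, f⟩ ⟨M, ⟨hM, ψ, -, ⟨N₁, N₂, hN₂, h₁, h₂, χ₁, χ₂, -, -, -, -, hf⟩, -⟩, hd⟩
    have hN : N ≠ 0 := NeZero.ne N
    simp only [Set.mem_iUnion]
    refine ⟨d, Nat.mem_divisors.2 ⟨(Dvd.intro_left M rfl).trans hd, hN⟩,
      N₁, Nat.mem_divisors.2 ⟨h₁.trans hM, hN⟩,
      N₂, Nat.mem_divisors.2 ⟨h₂.trans hM, hN⟩, (χ₁, χ₂), ?_⟩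
    simp only [hN₂, dif_pos]
    exact congrArg (Prod.mk d) hf.symm

end EisDecomp

end

/-! The proof shows that shifted newforms form a basis, and then that the Galois group permutes this
basis.

Generation. Every Eisenstein combination of level N is a double sum `eisSum k φ` with a weight φ on
pairs of residue classes. Lipschitz' formula expands it in powers of exp(2πiz/N); the n-th
coefficient is, up to a constant, a sum over mr = n of a Fourier transform of φ times r^(k-1).
Expanding the weights in Dirichlet characters and replacing these by primitive ones (Möbius) gives
shifted divisor sums σ of primitive pairs, up to a constant term (`convSum_mem_coeffSpan`,
`exists_eisSum_eq`). One element of Γ₀(N) with bottom row (N, 1) then kills both the stray constant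
and the quasi-modular part coming from E(1,1,2) (`eq_zero_of_const_eq`).

Independence. Passing from n to pn, with p a large prime in the class u mod N, multiplies σ by χ₁(u)
+ χ₂(u)p^(k-1). Dirichlet's theorem supplies two such primes, so a linear relation can be twisted by
χ₁(u) and by χ₂(u) separately; orthogonality isolates a pair of characters, and the smallest shift
finishes (`eq_zero_of_sum_shiftCoeff_eq_zero`). Hence E = ∑ cᵢ Eᵢ with unique cᵢ, and the action of
Γ₀(N) forces χ₁χ₂ = χ on the support (`exists_eq_sum_shiftE`).

Galois action. The coefficients of newforms lie in a cyclotomic field, the constant term because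
L(1-k, χ₂) is a rational combination of character values. An automorphism τ acting on roots of unity
by x ↦ x^j sends E(χ₁, χ₂, k) to E(χ₁^j, χ₂^j, k). If E has rational coefficients, uniqueness gives
that cᵢ is cyclotomic and τ(cᵢ) is the coefficient at the conjugate index (`coeff_mem_graph`). So
χ^j = χ for all τ, whence χ has rational values and χ² = 1. On the orbit of a newform f the
coefficients are the conjugates of one α, which lies in ℚ(f) because the stabilizer of f fixes it;
the orbit sums to Tr(αf). A pair of real characters is its own orbit, so its coefficient is
rational. -/

namespace EisDecomp

/-! ### Functions on the upper half plane given by q-series. -/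

open Complex Filter Function
open UpperHalfPlane hiding I
open scoped Real Manifold

/-- `f` is given on the whole upper half plane by the convergent series
`f(z) = ∑ aₙ exp(2πinz/h)`. -/
def HasQSeries (h : ℝ) (f : ℍ → ℂ) (a : ℕ → ℂ) : Prop :=
  ∀ z : ℍ, HasSum (fun n ↦ a n * Periodic.qParam h z ^ n) (f z)

theorem qParam_one_pow (z : ℂ) (n : ℕ) :
    Periodic.qParam 1 z ^ n = cexp (2 * π * I * n * z) := by
  rw [Periodic.qParam, ← Complex.exp_nat_mul]
  congr 1
  push_cast
  ring

namespace HasQSeries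

variable {h : ℝ} {f g : ℍ → ℂ} {a b : ℕ → ℂ}

theorem add (hf : HasQSeries h f a) (hg : HasQSeries h g b) : HasQSeries h (f + g) (a + b) :=
  fun z ↦ by simpa [add_mul] using (hf z).add (hg z)

theorem smul (hf : HasQSeries h f a) (c : ℂ) : HasQSeries h (c • f) (c • a) :=
  fun z ↦ by simpa [mul_assoc] using (hf z).mul_left c

theorem zero : HasQSeries h 0 0 := fun z ↦ by simp

theorem const (c : ℂ) : HasQSeries h (fun _ ↦ c) (Pi.single 0 c) := fun z ↦ by
  convert! hasSum_single (f := fun n ↦ (Pi.single 0 c : ℕ → ℂ) n * Periodic.qParam h z ^ n) 0 ?_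
  · simp
  · intro n hn
    simp [hn]

theorem sum {ι : Type*} (s : Finset ι) {F : ι → ℍ → ℂ} {A : ι → ℕ → ℂ}
    (hF : ∀ i ∈ s, HasQSeries h (F i) (A i)) : HasQSeries h (∑ i ∈ s, F i) (∑ i ∈ s, A i) := by
  classical
  induction s using Finset.induction_on with
  | empty => simpa using zero
  | insert i s hi ih =>
    rw [Finset.sum_insert hi, Finset.sum_insert hi]
    exact (hF i (Finset.mem_insert_self i s)).add
      (ih fun j hj ↦ hF j (Finset.mem_insert_of_mem hj))

theorem ext (hf : HasQSeries h f a) (hg : HasQSeries h g a) : f = g :=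
  funext fun z ↦ (hf z).unique (hg z)

/-- Every q with 0 < |q| < 1 is the parameter of some point of ℍ, so convergence on ℍ is convergence
on the whole disc. This is what makes f holomorphic and its coefficients unique. -/
theorem summable (hh : 0 < h) (hf : HasQSeries h f a) {q : ℂ} (hq : ‖q‖ < 1) :
    Summable fun n ↦ a n * q ^ n := by
  rcases eq_or_ne q 0 with rfl | hq0
  · exact summable_of_ne_finset_zero (s := {0}) fun n hn ↦ by
      simp [zero_pow (by simpa using hn)]
  · have := (hf ⟨_, Periodic.im_invQParam_pos_of_norm_lt_one hh hq hq0⟩).summable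
    simpa [Periodic.qParam_right_inv hh.ne' hq0] using this

theorem hasFPowerSeriesOnBall (hh : 0 < h) (hf : HasQSeries h f a) :
    HasFPowerSeriesOnBall (fun q ↦ ∑' n, a n * q ^ n)
      (FormalMultilinearSeries.ofScalars ℂ a) 0 1 := by
  constructor
  · refine le_of_forall_lt_imp_le_of_dense fun r hr ↦ ?_
    lift r to NNReal using hr.ne_top
    apply FormalMultilinearSeries.le_radius_of_summable
    simpa [norm_mul] using (hf.summable hh (q := r) (by simpa using hr)).norm
  · simp
  · intro y hy
    rw [← ENNReal.coe_one, Metric.eball_coe, NNReal.coe_one, mem_ball_zero_iff] at hy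
    simpa [mul_comm] using (hf.summable hh hy).hasSum

theorem mdifferentiable (hh : 0 < h) (hf : HasQSeries h f a) : MDiff f := by
  rw [UpperHalfPlane.mdifferentiable_iff]
  have hd : DifferentiableOn ℂ (fun q : ℂ ↦ ∑' n, a n * q ^ n) (Metric.ball 0 1) := by
    have := (hf.hasFPowerSeriesOnBall hh).differentiableOn
    rwa [← ENNReal.coe_one, Metric.eball_coe, NNReal.coe_one] at this
  have hq : Differentiable ℂ (Periodic.qParam h) := by
    unfold Periodic.qParam
    fun_prop
  refine (hd.comp hq.differentiableOn (t := Metric.ball 0 1) (s := {z : ℂ | 0 < z.im})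
    fun z hz ↦ ?_).congr fun z hz ↦ ?_
  · simpa using Periodic.norm_qParam_lt_one hh hz
  · simp only [comp_apply, ofComplex_apply_of_im_pos hz]
    exact (hf ⟨z, hz⟩).tsum_eq.symm

theorem isBoundedAtImInfty (hh : 0 < h) (hf : HasQSeries h f a) : IsBoundedAtImInfty f :=
  isBoundedAtImInfty_of_hasSum_qExpansion hh hf

theorem vadd (hh : h ≠ 0) (hf : HasQSeries h f a) (z : ℍ) : f (h +ᵥ z) = f z := by
  refine (hf _).unique ?_
  convert! hf z using 4
  rw [coe_vadd, add_comm]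
  simp only [Periodic.qParam]
  rw [show 2 * (π : ℂ) * I * (z + (h : ℂ)) / h = 2 * π * I * z / h + 2 * π * I by
    have : (h : ℂ) ≠ 0 := by exact_mod_cast hh
    field_simp, Complex.exp_add, Complex.exp_two_pi_mul_I, mul_one]

theorem periodic (hf : HasQSeries 1 f a) : Periodic (f ∘ ofComplex) (1 : ℝ) := by
  intro w
  by_cases! hw : 0 < im w
  · have : 0 < im (w + (1 : ℝ)) := by simp [hw]
    simp only [comp_apply, ofComplex_apply_of_im_pos this, ofComplex_apply_of_im_pos hw]
    rw [← hf.vadd one_ne_zero ⟨w, hw⟩]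
    congr 1
    ext
    simp [add_comm]
  · have : im (w + (1 : ℝ)) ≤ 0 := by simpa using hw
    simp only [comp_apply, ofComplex_apply_of_im_nonpos this, ofComplex_apply_of_im_nonpos hw]

theorem fourierCoeff_eq (hf : HasQSeries 1 f a) (n : ℕ) : fourierCoeff f n = a n :=
  -- `qExpansion_coeff_unique` speaks of a type with a `FunLike` structure; plain functions get the
  -- tautological one.
  letI : FunLike (ℍ → ℂ) ℍ ℂ := ⟨id, injective_id⟩
  (qExpansion_coeff_unique (F := ℍ → ℂ) f one_pos (analyticAt_cuspFunction_zero one_pos hf.periodic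
    (hf.mdifferentiable one_pos) (hf.isBoundedAtImInfty one_pos)) hf n).symm

theorem unique (hf : HasQSeries 1 f a) (hg : HasQSeries 1 f b) : a = b :=
  funext fun n ↦ (hf.fourierCoeff_eq n).symm.trans (hg.fourierCoeff_eq n)

end HasQSeries

/-- The coefficients of `f ∣ B_d` in terms of those of `f`. -/
def shiftCoeff (d : ℕ) (a : ℕ → ℂ) (n : ℕ) : ℂ := if d ∣ n then a (n / d) else 0

theorem shiftCoeff_mul {d : ℕ} (hd : d ≠ 0) (a : ℕ → ℂ) (n : ℕ) :
    shiftCoeff d a (d * n) = a n := by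
  simp [shiftCoeff, Nat.mul_div_cancel_left _ (Nat.pos_of_ne_zero hd)]

theorem HasQSeries.shift {f : ℍ → ℂ} {a : ℕ → ℂ} (hf : HasQSeries 1 f a) {d : ℕ} (hd : d ≠ 0) :
    HasQSeries 1 (shift d f) (shiftCoeff d a) := by
  intro z
  have hd' : 0 < d := Nat.pos_of_ne_zero hd
  have him : 0 < ((d : ℂ) * (z : ℂ)).im := by
    simpa using mul_pos (Nat.cast_pos.2 hd') z.im_pos
  have h1 := hf ⟨_, him⟩
  rw [EisDecomp.shift, ofComplex_apply_of_im_pos him]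
  have hinj : Function.Injective fun n : ℕ ↦ d * n := fun m n hmn ↦ Nat.eq_of_mul_eq_mul_left hd' hmn
  rw [← hinj.hasSum_iff]
  · convert! h1 using 2 with n
    simp only [comp_apply, shiftCoeff_mul hd, qParam_one_pow]
    congr 2
    push_cast
    ring
  · intro n hn
    have : ¬ d ∣ n := fun ⟨m, hm⟩ ↦ hn ⟨m, hm.symm⟩
    simp [shiftCoeff, this]

/-- A `1`-periodic function with an expansion in powers of `exp(2πiz/N)` has an expansion in
powers of `exp(2πiz)`. -/
theorem HasQSeries.of_width {N : ℕ} (hN : N ≠ 0) {f : ℍ → ℂ} {a : ℕ → ℂ}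
    (hf : HasQSeries N f a) (hper : ∀ z : ℍ, f ((1 : ℝ) +ᵥ z) = f z) :
    HasQSeries 1 f (fun n ↦ a (N * n)) := by
  have hN' : (N : ℂ) ≠ 0 := Nat.cast_ne_zero.2 hN
  set ζ : ℂ := cexp (2 * π * I / N) with hζ
  have hprim : IsPrimitiveRoot ζ N := Complex.isPrimitiveRoot_exp N hN
  have hperj : ∀ (j : ℕ) (z : ℍ), f ((j : ℝ) +ᵥ z) = f z := by
    intro j z
    induction j with
    | zero => simp
    | succ j ih =>
      rw [← ih, ← hper ((j : ℝ) +ᵥ z), vadd_vadd]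
      congr 2
      push_cast
      ring
  intro z
  have hq : ∀ (j : ℕ), Periodic.qParam N (((j : ℝ) +ᵥ z : ℍ) : ℂ) =
      ζ ^ j * Periodic.qParam N z := by
    intro j
    rw [hζ, ← Complex.exp_nat_mul, Periodic.qParam, Periodic.qParam, ← Complex.exp_add, coe_vadd]
    congr 1
    push_cast
    field_simp
  -- Average the expansion over the translates z + j, 0 ≤ j < N, on which f is constant. The sum of
  -- ζ^(nj) over j removes every exponent not divisible by N.
  have h1 : HasSum (fun n ↦ (∑ j ∈ Finset.range N, (ζ ^ n) ^ j) * (a n * Periodic.qParam N z ^ n))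
      (∑ j ∈ Finset.range N, f z) := by
    have : ∀ j ∈ Finset.range N, HasSum (fun n ↦ (ζ ^ n) ^ j * (a n * Periodic.qParam N z ^ n))
        (f z) := by
      intro j _
      have := hf ((j : ℝ) +ᵥ z)
      rw [hperj, hq] at this
      convert! this using 2 with n
      rw [mul_pow, ← pow_mul, ← pow_mul, mul_comm n j]
      ring
    simpa [Finset.sum_mul] using hasSum_sum this
  have hgeom : ∀ n, ∑ j ∈ Finset.range N, (ζ ^ n) ^ j = if N ∣ n then (N : ℂ) else 0 := by
    intro n
    split_ifs with h
    · simp [(hprim.pow_eq_one_iff_dvd n).2 h]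
    · have hne : ζ ^ n ≠ 1 := fun h' ↦ h ((hprim.pow_eq_one_iff_dvd n).1 h')
      rw [geom_sum_eq hne, ← pow_mul, mul_comm, pow_mul, hprim.pow_eq_one]
      simp
  simp only [hgeom, Finset.sum_const, Finset.card_range, nsmul_eq_mul] at h1
  have h2 := h1.mul_left (N : ℂ)⁻¹
  rw [inv_mul_cancel_left₀ hN'] at h2
  have hinj : Function.Injective fun n : ℕ ↦ N * n :=
    fun m n hmn ↦ Nat.eq_of_mul_eq_mul_left (Nat.pos_of_ne_zero hN) hmn
  rw [← hinj.hasSum_iff] at h2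
  · convert! h2 using 2 with n
    simp only [comp_apply, dvd_mul_right, if_true, inv_mul_cancel_left₀ hN',
      Periodic.qParam, ← Complex.exp_nat_mul]
    congr 2
    push_cast
    field_simp
  · intro n hn
    have : ¬ N ∣ n := fun ⟨m, hm⟩ ↦ hn ⟨m, hm.symm⟩
    simp [this]

/-- A polynomially bounded sequence of coefficients defines a function on the upper half plane. -/
theorem hasQSeries_of_norm_le {h : ℝ} (hh : 0 < h) {a : ℕ → ℂ} {C : ℝ} {m : ℕ}
    (ha : ∀ n, ‖a n‖ ≤ C * (n : ℝ) ^ m) :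
    HasQSeries h (fun z ↦ ∑' n, a n * Periodic.qParam h z ^ n) a := by
  intro z
  refine Summable.hasSum (Summable.of_norm_bounded (g := fun n : ℕ ↦
    C * ((n : ℝ) ^ m * ‖Periodic.qParam h z‖ ^ n)) ?_ ?_)
  · refine Summable.mul_left _ (summable_pow_mul_geometric_of_norm_lt_one _ ?_)
    simpa using Periodic.norm_qParam_lt_one hh z.im_pos
  · intro n
    rw [norm_mul, norm_pow, ← mul_assoc]
    exact mul_le_mul_of_nonneg_right (ha n) (by positivity)

end EisDecomp

/-! ### Divisor sums twisted by characters, and linear independence of their shifts. -/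

namespace EisDecomp

/-- The sum `∑_{mr = n} w(m, r) r^{k-1}`. -/
def convSum (k : ℕ) (w : ℕ → ℕ → ℂ) (n : ℕ) : ℂ :=
  ∑ x ∈ n.divisorsAntidiagonal, w x.1 x.2 * (x.2 : ℂ) ^ (k - 1)

theorem sigmaChar_eq_convSum {N₁ N₂ : ℕ} (χ₁ : DirichletCharacter ℂ N₁)
    (χ₂ : DirichletCharacter ℂ N₂) (k : ℕ) :
    sigmaChar χ₁ χ₂ k = convSum k fun m r ↦ χ₁ m * χ₂ r := by
  ext n
  exact (Nat.sum_divisorsAntidiagonal' (n := n)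
    fun m r ↦ χ₁ (m : ZMod N₁) * χ₂ (r : ZMod N₂) * (r : ℂ) ^ (k - 1)).symm

theorem sigmaChar_one {N₁ N₂ : ℕ} (χ₁ : DirichletCharacter ℂ N₁)
    (χ₂ : DirichletCharacter ℂ N₂) (k : ℕ) : sigmaChar χ₁ χ₂ k 1 = 1 := by
  simp [sigmaChar]

/-- A function on `ℕ` as an arithmetic function, with the value at `0` set to `0`. -/
def toArithmeticFunction (u : ℕ → ℂ) : ArithmeticFunction ℂ :=
  ⟨fun n ↦ if n = 0 then 0 else u n, by simp⟩

theorem toArithmeticFunction_apply (u : ℕ → ℂ) {n : ℕ} (hn : n ≠ 0) :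
    toArithmeticFunction u n = u n := if_neg hn

theorem isMultiplicative_toArithmeticFunction {u : ℕ → ℂ} (h1 : u 1 = 1)
    (hmul : ∀ m n, u (m * n) = u m * u n) : (toArithmeticFunction u).IsMultiplicative := by
  rw [ArithmeticFunction.IsMultiplicative.iff_ne_zero]
  refine ⟨by simpa [toArithmeticFunction_apply _ one_ne_zero] using h1, fun hm hn _ ↦ ?_⟩
  rw [toArithmeticFunction_apply _ hm, toArithmeticFunction_apply _ hn,
    toArithmeticFunction_apply _ (mul_ne_zero hm hn), hmul]

/-- The sequence σ is a Dirichlet convolution of two multiplicative functions, hence multiplicative.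
The factor at p is the Hecke eigenvalue. -/
theorem sigmaChar_prime_mul {N₁ N₂ : ℕ} (χ₁ : DirichletCharacter ℂ N₁)
    (χ₂ : DirichletCharacter ℂ N₂) (k : ℕ) {p n : ℕ} (hp : p.Prime) (hpn : ¬ p ∣ n) :
    sigmaChar χ₁ χ₂ k (p * n) =
      (χ₁ (p : ZMod N₁) + χ₂ (p : ZMod N₂) * (p : ℂ) ^ (k - 1)) * sigmaChar χ₁ χ₂ k n := by
  set F := toArithmeticFunction fun m ↦ χ₁ (m : ZMod N₁)
  set G := toArithmeticFunction fun r ↦ χ₂ (r : ZMod N₂) * (r : ℂ) ^ (k - 1)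
  have hF : F.IsMultiplicative := isMultiplicative_toArithmeticFunction (by simp) (by simp)
  have hG : G.IsMultiplicative := isMultiplicative_toArithmeticFunction (by simp) fun m n ↦ by
    push_cast
    rw [map_mul]
    ring
  have key : ∀ n, sigmaChar χ₁ χ₂ k n = (F * G) n := fun n ↦ by
    rw [sigmaChar_eq_convSum, convSum, ArithmeticFunction.mul_apply]
    refine Finset.sum_congr rfl fun x hx ↦ ?_
    rw [toArithmeticFunction_apply _ (Nat.ne_zero_of_mem_divisorsAntidiagonal hx).1,
      toArithmeticFunction_apply _ (Nat.ne_zero_of_mem_divisorsAntidiagonal hx).2, mul_assoc]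
  rw [key, key, (hF.mul hG).map_mul_of_coprime ((Nat.Prime.coprime_iff_not_dvd hp).2 hpn)]
  congr 1
  rw [ArithmeticFunction.mul_apply, Nat.sum_divisorsAntidiagonal (fun m r ↦ F m * G r),
    Nat.Prime.sum_divisors hp, Nat.div_self hp.pos, Nat.div_one, hF.map_one, hG.map_one,
    toArithmeticFunction_apply _ hp.ne_zero, toArithmeticFunction_apply _ hp.ne_zero]
  ring

section LinearIndependence

variable {N : ℕ}

/-- `σ^{k-1}` for the primitive characters inducing two characters modulo `N`. -/
noncomputable def sigmaPrim (k : ℕ) (ψ : DirichletCharacter ℂ N × DirichletCharacter ℂ N) : ℕ → ℂ :=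
  sigmaChar ψ.1.primitiveCharacter ψ.2.primitiveCharacter k

/-- Away from N a character and its primitive companion agree, so the eigenvalue at p depends only
on p mod N and on p^(k-1). -/
theorem sigmaPrim_prime_mul (k : ℕ) (ψ : DirichletCharacter ℂ N × DirichletCharacter ℂ N)
    {p n : ℕ} (hp : p.Prime) (hpn : ¬ p ∣ n) (hpN : ¬ p ∣ N) :
    sigmaPrim k ψ (p * n) =
      (ψ.1 (p : ZMod N) + ψ.2 (p : ZMod N) * (p : ℂ) ^ (k - 1)) * sigmaPrim k ψ n := by
  have hc : IsCoprime (p : ℤ) N :=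
    Nat.isCoprime_iff_coprime.2 ((Nat.Prime.coprime_iff_not_dvd hp).2 hpN)
  have h (χ : DirichletCharacter ℂ N) : χ.primitiveCharacter (p : ZMod χ.conductor) = χ p := by
    simpa using χ.primitiveCharacter_apply_of_isCoprime hc
  rw [sigmaPrim, sigmaChar_prime_mul _ _ _ hp hpn, h, h]

theorem shiftCoeff_prime_mul {d p n : ℕ} (hp : p.Prime) (hpd : ¬ p ∣ d) (hd : d ≠ 0) {a : ℕ → ℂ}
    {c : ℂ} (ha : ∀ m, m ∣ n → a (p * m) = c * a m) :
    shiftCoeff d a (p * n) = c * shiftCoeff d a n := by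
  have hco : Nat.Coprime d p := ((Nat.Prime.coprime_iff_not_dvd hp).2 hpd).symm
  unfold shiftCoeff
  by_cases h : d ∣ n
  · obtain ⟨m, rfl⟩ := h
    rw [if_pos (Dvd.intro m rfl), if_pos ((Dvd.intro m rfl : d ∣ d * m).mul_left p),
      mul_left_comm, Nat.mul_div_cancel_left _ (Nat.pos_of_ne_zero hd),
      Nat.mul_div_cancel_left _ (Nat.pos_of_ne_zero hd), ha _ (Dvd.intro_left d rfl)]
  · rw [if_neg h, if_neg fun h' ↦ h (hco.dvd_of_dvd_mul_left h'), mul_zero]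

variable [NeZero N]

/-- A linear relation between the sequences survives twisting its coefficients by ψ₁(u) or by ψ₂(u).
Evaluating at pn, for a large prime p ≡ u, yields X + p^(k-1) Y = 0 with X, Y the two twisted sums;
two such primes give X = Y = 0, since k ≥ 2 makes the powers distinct. -/
theorem sum_char_mul_eq_zero {k : ℕ} (hk : 2 ≤ k)
    {S : Finset ((DirichletCharacter ℂ N × DirichletCharacter ℂ N) × ℕ)}
    (hS : ∀ i ∈ S, i.2 ≠ 0) {c : (DirichletCharacter ℂ N × DirichletCharacter ℂ N) × ℕ → ℂ}
    (hc : ∀ n, n ≠ 0 → ∑ i ∈ S, c i * shiftCoeff i.2 (sigmaPrim k i.1) n = 0)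
    (u : ZMod N) (n : ℕ) (hn : n ≠ 0) :
    ∑ i ∈ S, (c i * i.1.1 u) * shiftCoeff i.2 (sigmaPrim k i.1) n = 0 ∧
    ∑ i ∈ S, (c i * i.1.2 u) * shiftCoeff i.2 (sigmaPrim k i.1) n = 0 := by
  by_cases hu : IsUnit u
  swap
  · simp [MulChar.map_nonunit _ hu]
  set X := ∑ i ∈ S, (c i * i.1.1 u) * shiftCoeff i.2 (sigmaPrim k i.1) n
  set Y := ∑ i ∈ S, (c i * i.1.2 u) * shiftCoeff i.2 (sigmaPrim k i.1) n
  -- The lower bound on p ensures that p divides neither N nor n nor any of the shifts.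
  have key : ∀ p : ℕ, p.Prime → (p : ZMod N) = u → N + n + ∑ i ∈ S, i.2 < p →
      X + (p : ℂ) ^ (k - 1) * Y = 0 := by
    intro p hp hpu hlt
    have hle : ∀ i ∈ S, i.2 ≤ ∑ i ∈ S, i.2 := fun i hi ↦
      Finset.single_le_sum (f := fun i ↦ i.2) (fun _ _ ↦ Nat.zero_le _) hi
    have hnd : ∀ m, m ≠ 0 → m < p → ¬ p ∣ m := fun m hm hmp hd ↦
      absurd (Nat.le_of_dvd (Nat.pos_of_ne_zero hm) hd) (by omega)
    rw [← hc (p * n) (mul_ne_zero hp.ne_zero hn), Finset.mul_sum, ← Finset.sum_add_distrib]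
    refine Finset.sum_congr rfl fun i hi ↦ ?_
    have := hle i hi
    rw [shiftCoeff_prime_mul (c := i.1.1 u + i.1.2 u * (p : ℂ) ^ (k - 1)) hp
      (hnd _ (hS i hi) (by omega)) (hS i hi)]
    · ring
    · intro m hm
      rw [sigmaPrim_prime_mul k i.1 hp
        (fun h ↦ hnd n hn (by omega) (h.trans hm)) (hnd N (NeZero.ne N) (by omega)), hpu]
  obtain ⟨p, hpgt, hp, hpu⟩ := Nat.forall_exists_prime_gt_and_eq_mod hu (N + n + ∑ i ∈ S, i.2)
  obtain ⟨q, hqgt, hq, hqu⟩ := Nat.forall_exists_prime_gt_and_eq_mod hu p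
  have h1 := key p hp hpu hpgt
  have h2 := key q hq hqu (by omega)
  have hne : (q : ℂ) ^ (k - 1) - (p : ℂ) ^ (k - 1) ≠ 0 := by
    rw [sub_ne_zero]
    exact_mod_cast (Nat.pow_lt_pow_left hqgt (by omega : k - 1 ≠ 0)).ne'
  have hY : Y = 0 := by
    have : ((q : ℂ) ^ (k - 1) - (p : ℂ) ^ (k - 1)) * Y = 0 := by linear_combination h2 - h1
    exact (mul_eq_zero.1 this).resolve_left hne
  exact ⟨by simpa [hY] using h1, hY⟩

/-- The coefficient sequences of the shifts of all Eisenstein series attached to pairs of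
primitive characters are linearly independent. -/
theorem eq_zero_of_sum_shiftCoeff_eq_zero {k : ℕ} (hk : 2 ≤ k)
    {S : Finset ((DirichletCharacter ℂ N × DirichletCharacter ℂ N) × ℕ)}
    (hS : ∀ i ∈ S, i.2 ≠ 0) {c : (DirichletCharacter ℂ N × DirichletCharacter ℂ N) × ℕ → ℂ}
    (hc : ∀ n, n ≠ 0 → ∑ i ∈ S, c i * shiftCoeff i.2 (sigmaPrim k i.1) n = 0) :
    ∀ i ∈ S, c i = 0 := by
  classical
  have orth : ∀ (χ φ : DirichletCharacter ℂ N),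
      ∑ u : ZMod N, φ⁻¹ u * χ u = if χ = φ then (N.totient : ℂ) else 0 := by
    intro χ φ
    simp only [← MulChar.mul_apply]
    split_ifs with h
    · rw [h, inv_mul_cancel, MulChar.sum_one_eq_card_units, ZMod.card_units_eq_totient]
    · exact MulChar.sum_eq_zero_of_ne_one fun h' ↦ h (inv_mul_eq_one.1 h').symm
  have htot : (N.totient : ℂ) ≠ 0 := by
    exact_mod_cast (Nat.totient_pos.2 (Nat.pos_of_ne_zero (NeZero.ne N))).ne'
  have step : ∀ (φ : DirichletCharacter ℂ N × DirichletCharacter ℂ N) (n : ℕ), n ≠ 0 →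
      ∑ i ∈ S with i.1 = φ, c i * shiftCoeff i.2 (sigmaPrim k i.1) n = 0 := by
    intro φ n hn
    -- Twist twice, by ψ₁(u) and then by ψ₂(v), and sum against the inverse of φ; orthogonality
    -- leaves only the terms with pair φ.
    have h1 : ∑ u : ZMod N, ∑ v : ZMod N, φ.1⁻¹ u * φ.2⁻¹ v *
        ∑ i ∈ S, (c i * i.1.1 u * i.1.2 v) * shiftCoeff i.2 (sigmaPrim k i.1) n = 0 := by
      refine Finset.sum_eq_zero fun u _ ↦ Finset.sum_eq_zero fun v _ ↦ ?_
      rw [(sum_char_mul_eq_zero hk hS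
        (fun m hm ↦ (sum_char_mul_eq_zero hk hS hc u m hm).1) v n hn).2, mul_zero]
    have h2 : ∑ u : ZMod N, ∑ v : ZMod N, φ.1⁻¹ u * φ.2⁻¹ v *
        ∑ i ∈ S, (c i * i.1.1 u * i.1.2 v) * shiftCoeff i.2 (sigmaPrim k i.1) n =
        ∑ i ∈ S, c i * shiftCoeff i.2 (sigmaPrim k i.1) n *
          ((∑ u : ZMod N, φ.1⁻¹ u * i.1.1 u) * ∑ v : ZMod N, φ.2⁻¹ v * i.1.2 v) := by
      simp_rw [Finset.sum_mul_sum, Finset.mul_sum]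
      rw [Finset.sum_congr rfl fun u _ ↦ Finset.sum_comm, Finset.sum_comm]
      refine Finset.sum_congr rfl fun i _ ↦ Finset.sum_congr rfl fun u _ ↦
        Finset.sum_congr rfl fun v _ ↦ ?_
      ring
    rw [h2] at h1
    simp only [orth] at h1
    have h3 : (∑ i ∈ S with i.1 = φ, c i * shiftCoeff i.2 (sigmaPrim k i.1) n) *
        ((N.totient : ℂ) * N.totient) = 0 := by
      rw [← h1, Finset.sum_filter, Finset.sum_mul]
      refine Finset.sum_congr rfl fun i _ ↦ ?_
      by_cases h : i.1 = φ
      · simp [h]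
      · rw [if_neg h]
        by_cases h' : i.1.1 = φ.1
        · have : i.1.2 ≠ φ.2 := fun h'' ↦ h (Prod.ext h' h'')
          simp [this]
        · simp [h']
    exact (mul_eq_zero.1 h3).resolve_right (mul_ne_zero htot htot)
  rintro ⟨φ, d⟩ hi
  induction d using Nat.strong_induction_on with
  | _ d ih =>
    have hd : d ≠ 0 := hS _ hi
    -- Evaluate at n = d: larger shifts do not divide d, smaller ones have coefficient 0 by
    -- induction, and σ(1) = 1 at the shift d itself.
    have := step φ d hd
    rw [Finset.sum_eq_single_of_mem (φ, d) (by simpa using hi)] at this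
    · simpa [shiftCoeff, Nat.div_self (Nat.pos_of_ne_zero hd), sigmaPrim, sigmaChar_one] using this
    · rintro ⟨φ', d'⟩ hj hne
      obtain ⟨hjS, rfl⟩ := by simpa using hj
      rcases lt_trichotomy d' d with h | h | h
      · rw [ih d' h hjS, zero_mul]
      · exact absurd (by rw [h]) hne
      · have : ¬ d' ∣ d := fun h' ↦ absurd (Nat.le_of_dvd (Nat.pos_of_ne_zero hd) h') (by omega)
        simp [shiftCoeff, this]

end LinearIndependence

end EisDecomp

/-! ### Reduction to primitive characters, and the span of shifted newform coefficients. -/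

namespace EisDecomp

theorem shiftCoeff_shiftCoeff {d e : ℕ} (hd : d ≠ 0) (a : ℕ → ℂ) :
    shiftCoeff d (shiftCoeff e a) = shiftCoeff (d * e) a := by
  ext n
  unfold shiftCoeff
  by_cases h : d ∣ n
  · obtain ⟨m, rfl⟩ := h
    rw [if_pos (Dvd.intro m rfl), Nat.mul_div_cancel_left _ (Nat.pos_of_ne_zero hd),
      Nat.mul_div_mul_left _ _ (Nat.pos_of_ne_zero hd)]
    simp only [Nat.mul_dvd_mul_iff_left (Nat.pos_of_ne_zero hd)]
  · rw [if_neg h, if_neg fun h' ↦ h ((Dvd.intro e rfl).trans h')]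

theorem shiftCoeff_smul (d : ℕ) (c : ℂ) (a : ℕ → ℂ) :
    shiftCoeff d (c • a) = c • shiftCoeff d a := by
  ext n
  by_cases h : d ∣ n <;> simp [shiftCoeff, h]

theorem shiftCoeff_sum {ι : Type*} (d : ℕ) (s : Finset ι) (a : ι → ℕ → ℂ) :
    shiftCoeff d (∑ i ∈ s, a i) = ∑ i ∈ s, shiftCoeff d (a i) := by
  ext n
  by_cases h : d ∣ n <;> simp [shiftCoeff, h]

theorem shiftCoeff_mul_comp_mul {N d : ℕ} (hN : N ≠ 0) (a : ℕ → ℂ) (n : ℕ) :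
    shiftCoeff (N * d) a (N * n) = shiftCoeff d a n := by
  rw [← shiftCoeff_shiftCoeff hN, shiftCoeff_mul hN]

theorem convSum_smul (k : ℕ) (c : ℂ) (w : ℕ → ℕ → ℂ) :
    convSum k (fun m r ↦ c * w m r) = c • convSum k w := by
  ext n
  simp [convSum, Finset.mul_sum, mul_assoc]

theorem convSum_sum {ι : Type*} (k : ℕ) (s : Finset ι) (w : ι → ℕ → ℕ → ℂ) :
    convSum k (fun m r ↦ ∑ i ∈ s, w i m r) = ∑ i ∈ s, convSum k (w i) := by
  ext n
  simp only [convSum, Finset.sum_mul, Finset.sum_apply]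
  exact Finset.sum_comm

/-- Substitute m = gm' and r = hr'; the factor h^(k-1) is what r^(k-1) leaves behind. -/
theorem convSum_shiftCoeff {k g h : ℕ} (hg : g ≠ 0) (hh : h ≠ 0) (u v : ℕ → ℂ) :
    convSum k (fun m r ↦ shiftCoeff g u m * shiftCoeff h v r) =
      (h : ℂ) ^ (k - 1) • shiftCoeff (g * h) (convSum k fun m r ↦ u m * v r) := by
  ext n
  rcases eq_or_ne n 0 with rfl | hn
  · simp [convSum, shiftCoeff]
  have hg' := Nat.pos_of_ne_zero hg
  have hh' := Nat.pos_of_ne_zero hh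
  have hzero : ∀ x : ℕ × ℕ, ¬ (g ∣ x.1 ∧ h ∣ x.2) →
      shiftCoeff g u x.1 * shiftCoeff h v x.2 * (x.2 : ℂ) ^ (k - 1) = 0 := by
    intro x hx
    rw [not_and_or] at hx
    rcases hx with h' | h' <;> simp [shiftCoeff, h']
  by_cases hgh : g * h ∣ n
  · obtain ⟨n', rfl⟩ := hgh
    rw [Pi.smul_apply, shiftCoeff_mul (mul_ne_zero hg hh), smul_eq_mul, convSum, convSum,
      Finset.mul_sum]
    symm
    refine Finset.sum_of_injOn (fun x ↦ (g * x.1, h * x.2)) ?_ ?_ ?_ ?_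
    · rintro ⟨a, b⟩ - ⟨a', b'⟩ - hab
      simpa [hg, hh] using hab
    · rintro ⟨a, b⟩ hab
      simp only [Finset.mem_coe, Nat.mem_divisorsAntidiagonal] at hab ⊢
      exact ⟨by rw [← hab.1]; ring, hn⟩
    · rintro ⟨a, b⟩ hab hnot
      refine hzero _ fun ⟨⟨a', ha'⟩, ⟨b', hb'⟩⟩ ↦ hnot ⟨(a', b'), ?_, Prod.ext ha'.symm hb'.symm⟩
      simp only [Finset.mem_coe, Nat.mem_divisorsAntidiagonal] at hab ha' hb' ⊢
      refine ⟨?_, right_ne_zero_of_mul hn⟩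
      have h1 := hab.1
      rw [ha', hb'] at h1
      exact Nat.eq_of_mul_eq_mul_left (Nat.mul_pos hg' hh') (by rw [← h1]; ring)
    · rintro ⟨a, b⟩ -
      simp only [shiftCoeff_mul hg, shiftCoeff_mul hh]
      push_cast
      ring
  · rw [Pi.smul_apply, shiftCoeff, if_neg hgh, smul_zero]
    refine Finset.sum_eq_zero fun x hx ↦ hzero x fun ⟨h1, h2⟩ ↦ hgh ?_
    rw [← (Nat.mem_divisorsAntidiagonal.1 hx).1]
    exact mul_dvd_mul h1 h2

section Imprimitive

open ArithmeticFunction in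
theorem sum_moebius_divisors (n : ℕ) :
    ∑ d ∈ n.divisors, (ArithmeticFunction.moebius d : ℂ) = if n = 1 then 1 else 0 := by
  have := congrArg (fun f : ArithmeticFunction ℤ ↦ f n) moebius_mul_coe_zeta
  simp only [coe_mul_zeta_apply, ArithmeticFunction.one_apply] at this
  exact_mod_cast congrArg (Int.cast : ℤ → ℂ) this

/-- A Dirichlet character in terms of the primitive character inducing it. -/
theorem apply_eq_sum_moebius {n : ℕ} [NeZero n] (ψ : DirichletCharacter ℂ n) (m : ℕ) :
    ψ (m : ZMod n) = ∑ e ∈ n.divisors, ((ArithmeticFunction.moebius e : ℂ) *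
      ψ.primitiveCharacter (e : ZMod ψ.conductor)) *
        shiftCoeff e (fun j ↦ ψ.primitiveCharacter (j : ZMod ψ.conductor)) m := by
  have h1 : ∀ e ∈ n.divisors, ((ArithmeticFunction.moebius e : ℂ) *
      ψ.primitiveCharacter (e : ZMod ψ.conductor)) *
        shiftCoeff e (fun j ↦ ψ.primitiveCharacter (j : ZMod ψ.conductor)) m =
      (if e ∣ m then (ArithmeticFunction.moebius e : ℂ) else 0) *
        ψ.primitiveCharacter (m : ZMod ψ.conductor) := by
    intro e _
    by_cases he : e ∣ m
    · rw [shiftCoeff, if_pos he, if_pos he, mul_assoc, ← map_mul, ← Nat.cast_mul,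
        Nat.mul_div_cancel' he]
    · simp [shiftCoeff, he]
  have hgcd : n.gcd m ≠ 0 := Nat.gcd_ne_zero_left (NeZero.ne n)
  -- Only common divisors e of n and m contribute. Their Möbius sum detects whether m is prime to n,
  -- which is exactly where ψ agrees with its primitive companion instead of vanishing.
  have h2 : (n.divisors.filter (· ∣ m)) = (n.gcd m).divisors := by
    ext e
    simp [Nat.dvd_gcd_iff, hgcd, NeZero.ne n]
  rw [Finset.sum_congr rfl h1, ← Finset.sum_mul, ← Finset.sum_filter, h2,
    sum_moebius_divisors]
  split_ifs with h
  · have hc : IsCoprime (m : ℤ) n := (Nat.isCoprime_iff_coprime.2 h).symm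
    have := ψ.primitiveCharacter_apply_of_isCoprime hc
    simpa using this.symm
  · rw [zero_mul]
    have : ψ ((m : ℤ) : ZMod n) = 0 := (ψ.apply_eq_zero_iff m).2 fun h' ↦
      h (Nat.isCoprime_iff_coprime.1 h'.symm)
    simpa using this

/-- `σ^{k-1}` of imprimitive characters in terms of the primitive ones. -/
theorem sigmaChar_eq_sum_shiftCoeff (k : ℕ) {n₁ n₂ : ℕ} [NeZero n₁] [NeZero n₂]
    (ψ₁ : DirichletCharacter ℂ n₁) (ψ₂ : DirichletCharacter ℂ n₂) :
    sigmaChar ψ₁ ψ₂ k = ∑ e ∈ n₁.divisors, ∑ f ∈ n₂.divisors,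
      (((ArithmeticFunction.moebius e : ℂ) * ψ₁.primitiveCharacter (e : ZMod ψ₁.conductor)) *
        ((ArithmeticFunction.moebius f : ℂ) * ψ₂.primitiveCharacter (f : ZMod ψ₂.conductor)) *
        (f : ℂ) ^ (k - 1)) •
        shiftCoeff (e * f) (sigmaChar ψ₁.primitiveCharacter ψ₂.primitiveCharacter k) := by
  rw [sigmaChar_eq_convSum, sigmaChar_eq_convSum]
  have : (fun m r : ℕ ↦ ψ₁ (m : ZMod n₁) * ψ₂ (r : ZMod n₂)) = fun m r ↦
      ∑ e ∈ n₁.divisors, ∑ f ∈ n₂.divisors,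
      (((ArithmeticFunction.moebius e : ℂ) * ψ₁.primitiveCharacter (e : ZMod ψ₁.conductor)) *
        ((ArithmeticFunction.moebius f : ℂ) * ψ₂.primitiveCharacter (f : ZMod ψ₂.conductor))) *
        (shiftCoeff e (fun j ↦ ψ₁.primitiveCharacter (j : ZMod ψ₁.conductor)) m *
        shiftCoeff f (fun j ↦ ψ₂.primitiveCharacter (j : ZMod ψ₂.conductor)) r) := by
    ext m r
    rw [apply_eq_sum_moebius ψ₁, apply_eq_sum_moebius ψ₂, Finset.sum_mul_sum]
    refine Finset.sum_congr rfl fun e _ ↦ Finset.sum_congr rfl fun f _ ↦ ?_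
    ring
  rw [this, convSum_sum]
  refine Finset.sum_congr rfl fun e he ↦ ?_
  rw [convSum_sum]
  refine Finset.sum_congr rfl fun f hf ↦ ?_
  rw [convSum_smul, convSum_shiftCoeff (Nat.pos_of_mem_divisors he).ne'
    (Nat.pos_of_mem_divisors hf).ne', smul_smul]

end Imprimitive

section Span

variable {N : ℕ} [NeZero N]

/-- The pairs of characters with `ψ₁ψ₂(-1) = (-1)ᵏ`. -/
def HasParity (k : ℕ) (ψ : DirichletCharacter ℂ N × DirichletCharacter ℂ N) : Prop :=
  ψ.1 (-1) * ψ.2 (-1) = (-1) ^ k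

/-- The span of the coefficient sequences of the shifted Eisenstein newforms of level dividing
`N`. -/
noncomputable def coeffSpan (k N : ℕ) : Submodule ℂ (ℕ → ℂ) :=
  Submodule.span ℂ {a | ∃ (ψ : DirichletCharacter ℂ N × DirichletCharacter ℂ N) (d : ℕ),
    ψ.1.conductor * ψ.2.conductor * d ∣ N ∧ HasParity k ψ ∧ a = shiftCoeff d (sigmaPrim k ψ)}

theorem sigmaPrim_changeLevel (k : ℕ) {n₁ n₂ : ℕ} (h₁ : n₁ ∣ N) (h₂ : n₂ ∣ N)
    (ψ₁ : DirichletCharacter ℂ n₁) (ψ₂ : DirichletCharacter ℂ n₂) :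
    sigmaPrim k (DirichletCharacter.changeLevel h₁ ψ₁, DirichletCharacter.changeLevel h₂ ψ₂) =
      sigmaChar ψ₁.primitiveCharacter ψ₂.primitiveCharacter k := by
  ext n
  unfold sigmaPrim sigmaChar
  refine Finset.sum_congr rfl fun d _ ↦ ?_
  have e₁ := DirichletCharacter.primitiveCharacter_changeLevel_apply h₁ ψ₁ ((n / d : ℕ) : ℤ)
  have e₂ := DirichletCharacter.primitiveCharacter_changeLevel_apply h₂ ψ₂ ((d : ℕ) : ℤ)
  rw [Int.cast_natCast, Int.cast_natCast] at e₁ e₂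
  rw [e₁, e₂]

omit [NeZero N] in
theorem changeLevel_neg_one {n : ℕ} (h : n ∣ N) (ψ : DirichletCharacter ℂ n) :
    DirichletCharacter.changeLevel h ψ (-1) = ψ (-1) := by
  simpa using ψ.changeLevel_eq_cast_of_dvd' h (a := -1) isCoprime_one_left.neg_left

/-- In the Möbius expansion a term (e, f) survives only if e and f are prime to the respective
conductors. Then conductor times e divides n₁, and conductor times f divides n₂, so each surviving
shift has level dividing n₁n₂D = N. -/
theorem shiftCoeff_sigmaChar_mem_coeffSpan {k n₁ n₂ D : ℕ} (hN : n₁ * n₂ * D = N)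
    (ψ₁ : DirichletCharacter ℂ n₁) (ψ₂ : DirichletCharacter ℂ n₂)
    (hpar : ψ₁ (-1) * ψ₂ (-1) = (-1) ^ k) :
    shiftCoeff D (sigmaChar ψ₁ ψ₂ k) ∈ coeffSpan k N := by
  have hN0 := hN ▸ NeZero.ne N
  have : NeZero n₁ := ⟨by rintro rfl; simp at hN0⟩
  have : NeZero n₂ := ⟨by rintro rfl; simp at hN0⟩
  have hD : D ≠ 0 := by rintro rfl; simp at hN0
  have h₁ : n₁ ∣ N := hN ▸ Dvd.intro (n₂ * D) (by ring)
  have h₂ : n₂ ∣ N := hN ▸ Dvd.intro (n₁ * D) (by ring)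
  have hcop : ∀ {n : ℕ} (ψ : DirichletCharacter ℂ n) [NeZero n] {e : ℕ}, e ∣ n →
      ψ.primitiveCharacter (e : ZMod ψ.conductor) ≠ 0 → ψ.conductor * e ∣ n := by
    intro n ψ _ e he hne
    refine Nat.Coprime.mul_dvd_of_dvd_of_dvd ?_ ψ.conductor_dvd_level he
    have := (ψ.primitiveCharacter.apply_ne_zero_iff (e : ℤ)).1 (by simpa using hne)
    exact (Nat.isCoprime_iff_coprime.1 this).symm
  rw [sigmaChar_eq_sum_shiftCoeff, shiftCoeff_sum]
  refine Submodule.sum_mem _ fun e he ↦ ?_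
  rw [shiftCoeff_sum]
  refine Submodule.sum_mem _ fun f hf ↦ ?_
  rw [shiftCoeff_smul]
  by_cases he0 : ψ₁.primitiveCharacter (e : ZMod ψ₁.conductor) = 0
  · simp [he0]
  by_cases hf0 : ψ₂.primitiveCharacter (f : ZMod ψ₂.conductor) = 0
  · simp [hf0]
  refine Submodule.smul_mem _ _ (Submodule.subset_span
    ⟨(DirichletCharacter.changeLevel h₁ ψ₁, DirichletCharacter.changeLevel h₂ ψ₂),
      D * (e * f), ?_, ?_, ?_⟩)
  · simp only [DirichletCharacter.conductor_changeLevel]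
    have := mul_dvd_mul (mul_dvd_mul (hcop ψ₁ (Nat.dvd_of_mem_divisors he) he0)
      (hcop ψ₂ (Nat.dvd_of_mem_divisors hf) hf0)) (dvd_refl D)
    rw [hN] at this
    convert! this using 1
    ring
  · rw [HasParity, changeLevel_neg_one, changeLevel_neg_one, hpar]
  · rw [sigmaPrim_changeLevel, shiftCoeff_shiftCoeff hD]

/-- The indicator function of a residue class in terms of Dirichlet characters. -/
theorem exists_eq_sum_shiftCoeff (a : ZMod N) :
    ∃ (g n : ℕ) (_ : NeZero n) (α : ZMod n), g * n = N ∧ g = a.val.gcd N ∧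
      ∀ ε : ℤ, ε = 1 ∨ ε = -1 → ∀ m : ℕ, (if (m : ZMod N) = ε * a then 1 else 0 : ℂ) =
        (n.totient : ℂ)⁻¹ * ∑ ψ : DirichletCharacter ℂ n, ψ α⁻¹ * ψ (ε : ZMod n) *
          shiftCoeff g (fun j ↦ ψ (j : ZMod n)) m := by
  have hN := NeZero.ne N
  set g := a.val.gcd N with hg
  have hg0 : g ≠ 0 := Nat.gcd_ne_zero_right hN
  obtain ⟨n, hn⟩ : g ∣ N := Nat.gcd_dvd_right _ _
  obtain ⟨a', ha'⟩ : g ∣ a.val := Nat.gcd_dvd_left _ _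
  have hn0 : n ≠ 0 := by rintro rfl; simp [hN] at hn
  have : NeZero n := ⟨hn0⟩
  -- Writing a = g a' with g = gcd(a, N), the class of a mod N is g times the class of the unit a'
  -- mod n = N/g. On the latter, orthogonality of characters mod n applies.
  have hcop : Nat.Coprime a' n := by
    have h1 : g * a'.gcd n = g * 1 := by
      rw [← Nat.gcd_mul_left, ← ha', ← hn, mul_one]
    exact Nat.eq_of_mul_eq_mul_left (Nat.pos_of_ne_zero hg0) h1
  have hunit : IsUnit (a' : ZMod n) := (ZMod.isUnit_iff_coprime a' n).2 hcop
  have htot : (n.totient : ℂ) ≠ 0 := by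
    exact_mod_cast (Nat.totient_pos.2 (Nat.pos_of_ne_zero hn0)).ne'
  refine ⟨g, n, this, a', hn.symm, rfl, fun ε hε m ↦ ?_⟩
  have hεsq : (ε : ZMod n) * ε = 1 := by
    rcases hε with rfl | rfl <;> simp
  have hval : ((a.val : ℕ) : ZMod N) = a := ZMod.natCast_zmod_val a
  have hiff : (m : ZMod N) = ε * a ↔ (N : ℤ) ∣ m - ε * (g * a' : ℕ) := by
    rw [← hval, ha', ← ZMod.intCast_eq_intCast_iff_dvd_sub, eq_comm]
    simp
  by_cases hgm : g ∣ m
  · obtain ⟨m', rfl⟩ := hgm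
    simp only [shiftCoeff_mul hg0]
    have hsum : ∑ ψ : DirichletCharacter ℂ n, ψ (a' : ZMod n)⁻¹ * ψ (ε : ZMod n) * ψ (m' : ZMod n) =
        if (a' : ZMod n) = ε * m' then (n.totient : ℂ) else 0 := by
      rw [← DirichletCharacter.sum_char_inv_mul_char_eq ℂ hunit]
      refine Finset.sum_congr rfl fun ψ _ ↦ ?_
      rw [map_mul, mul_assoc]
    have hiff' : ((g * m' : ℕ) : ZMod N) = ε * a ↔ (a' : ZMod n) = ε * m' := by
      rw [hiff]
      have e1 : ((g * m' : ℕ) : ℤ) - ε * (g * a' : ℕ) = g * (m' - ε * a') := by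
        push_cast; ring
      rw [e1, hn, Nat.cast_mul, mul_dvd_mul_iff_left (by exact_mod_cast hg0)]
      rw [← ZMod.intCast_eq_intCast_iff_dvd_sub]
      push_cast
      constructor
      · intro h
        rw [← h, ← mul_assoc, hεsq, one_mul]
      · intro h
        rw [h, ← mul_assoc, hεsq, one_mul]
    rw [hsum, if_congr hiff' rfl rfl]
    split_ifs
    · rw [inv_mul_cancel₀ htot]
    · rw [mul_zero]
  · simp only [shiftCoeff, if_neg hgm, mul_zero, Finset.sum_const_zero]
    rw [if_neg]
    intro h
    refine hgm ?_
    have h1 := (Int.natCast_dvd_natCast.2 (Dvd.intro n hn.symm : g ∣ N)).trans (hiff.1 h)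
    have h2 : (g : ℤ) ∣ ε * (g * a' : ℕ) := by
      push_cast
      exact ⟨ε * a', by ring⟩
    exact Int.natCast_dvd_natCast.1 ((dvd_sub_left h2).1 h1)

/-- The coefficient sequences arising from Eisenstein series of level `N` lie in the span of
those of shifted newforms. -/
theorem convSum_mem_coeffSpan (k : ℕ) (φ : ZMod N → ZMod N → ℂ) :
    (fun n ↦ convSum k (fun m r ↦ φ m r + (-1) ^ k * φ (-m) (-r)) (N * n)) ∈ coeffSpan k N := by
  classical
  have hN := NeZero.ne N
  -- By linearity it suffices to treat the indicator function of a single pair of classes (a, b).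
  have h0 : (fun n ↦ convSum k (fun m r ↦ φ m r + (-1) ^ k * φ (-m) (-r)) (N * n)) =
      ∑ a : ZMod N, ∑ b : ZMod N, φ a b • fun n ↦ convSum k (fun m r ↦
        (if (m : ZMod N) = (1 : ℤ) * a then 1 else 0) * (if (r : ZMod N) = (1 : ℤ) * b then 1 else 0)
        + (-1) ^ k * ((if (m : ZMod N) = (-1 : ℤ) * a then 1 else 0) *
          (if (r : ZMod N) = (-1 : ℤ) * b then 1 else 0))) (N * n) := by
    ext n
    simp only [Finset.sum_apply, Pi.smul_apply, convSum, Finset.smul_sum]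
    rw [Finset.sum_congr rfl fun a _ ↦ Finset.sum_comm, Finset.sum_comm]
    refine Finset.sum_congr rfl fun x _ ↦ ?_
    have e : ∀ (a : ZMod N) (m : ℕ), ((m : ZMod N) = (-1 : ℤ) * a) ↔ (-(m : ZMod N) = a) := by
      intro a m
      simp [neg_eq_iff_eq_neg]
    simp only [e]
    simp only [Int.cast_one, one_mul, smul_eq_mul, mul_add, add_mul, Finset.sum_add_distrib]
    simp [mul_ite, ite_mul, Finset.sum_ite_eq]
    ring
  rw [h0]
  refine Submodule.sum_mem _ fun a _ ↦ Submodule.sum_mem _ fun b _ ↦ Submodule.smul_mem _ _ ?_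
  obtain ⟨g, n₁, _, α, hgn, hg, hα⟩ := exists_eq_sum_shiftCoeff a
  obtain ⟨h, n₂, _, β, hhn, hh, hβ⟩ := exists_eq_sum_shiftCoeff b
  have hg0 : g ≠ 0 := by rintro rfl; simp [hN.symm] at hgn
  have hh0 : h ≠ 0 := by rintro rfl; simp [hN.symm] at hhn
  -- The expansions of the two indicators produce a shift by gh. When gh = ND, reading it at the
  -- multiples Nn turns it into a shift by D, and n₁n₂D = N.
  by_cases hD : N ∣ g * h
  · obtain ⟨D, hD⟩ := hD
    have hlev : n₁ * n₂ * D = N := by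
      have : N * N * (n₁ * n₂ * D) = N * N * N := by
        calc N * N * (n₁ * n₂ * D) = N * (n₁ * n₂) * (N * D) := by ring
          _ = N * (n₁ * n₂) * (g * h) := by rw [hD]
          _ = N * (g * n₁) * (h * n₂) := by ring
          _ = N * N * N := by rw [hgn, hhn]
      exact Nat.eq_of_mul_eq_mul_left (Nat.mul_pos (Nat.pos_of_ne_zero hN)
        (Nat.pos_of_ne_zero hN)) this
    have h1 : (fun n ↦ convSum k (fun m r ↦
        (if (m : ZMod N) = (1 : ℤ) * a then 1 else 0) * (if (r : ZMod N) = (1 : ℤ) * b then 1 else 0)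
        + (-1) ^ k * ((if (m : ZMod N) = (-1 : ℤ) * a then 1 else 0) *
          (if (r : ZMod N) = (-1 : ℤ) * b then 1 else 0))) (N * n)) =
        ∑ ψ₁ : DirichletCharacter ℂ n₁, ∑ ψ₂ : DirichletCharacter ℂ n₂,
          ((n₁.totient : ℂ)⁻¹ * (n₂.totient : ℂ)⁻¹ * ψ₁ α⁻¹ * ψ₂ β⁻¹ *
            (1 + (-1) ^ k * (ψ₁ (-1) * ψ₂ (-1))) * (h : ℂ) ^ (k - 1)) •
            shiftCoeff D (sigmaChar ψ₁ ψ₂ k) := by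
      have h2 : (fun m r : ℕ ↦
        (if (m : ZMod N) = (1 : ℤ) * a then 1 else 0) * (if (r : ZMod N) = (1 : ℤ) * b then 1 else 0)
        + (-1) ^ k * ((if (m : ZMod N) = (-1 : ℤ) * a then 1 else 0) *
          (if (r : ZMod N) = (-1 : ℤ) * b then 1 else 0)) : ℕ → ℕ → ℂ) = fun m r ↦
        ∑ ψ₁ : DirichletCharacter ℂ n₁, ∑ ψ₂ : DirichletCharacter ℂ n₂,
          ((n₁.totient : ℂ)⁻¹ * (n₂.totient : ℂ)⁻¹ * ψ₁ α⁻¹ * ψ₂ β⁻¹ *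
            (1 + (-1) ^ k * (ψ₁ (-1) * ψ₂ (-1)))) *
            (shiftCoeff g (fun j ↦ ψ₁ (j : ZMod n₁)) m *
              shiftCoeff h (fun j ↦ ψ₂ (j : ZMod n₂)) r) := by
        ext m r
        rw [hα 1 (.inl rfl), hβ 1 (.inl rfl), hα (-1) (.inr rfl), hβ (-1) (.inr rfl)]
        have e : ∀ (F : DirichletCharacter ℂ n₁ → ℂ) (G : DirichletCharacter ℂ n₂ → ℂ),
            ((n₁.totient : ℂ)⁻¹ * ∑ ψ, F ψ) * ((n₂.totient : ℂ)⁻¹ * ∑ ψ, G ψ) =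
            ∑ ψ₁, ∑ ψ₂, (n₁.totient : ℂ)⁻¹ * (n₂.totient : ℂ)⁻¹ * (F ψ₁ * G ψ₂) := by
          intro F G
          rw [mul_mul_mul_comm, Finset.sum_mul_sum]
          simp only [Finset.mul_sum]
        rw [e, e]
        simp only [Finset.mul_sum]
        rw [← Finset.sum_add_distrib]
        refine Finset.sum_congr rfl fun ψ₁ _ ↦ ?_
        rw [← Finset.sum_add_distrib]
        refine Finset.sum_congr rfl fun ψ₂ _ ↦ ?_
        simp only [Int.cast_one, map_one, Int.cast_neg]
        ring
      rw [h2, convSum_sum]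
      simp only [convSum_sum, convSum_smul, convSum_shiftCoeff hg0 hh0, smul_smul]
      ext n
      simp only [Finset.sum_apply, Pi.smul_apply, hD, shiftCoeff_mul_comp_mul hN,
        ← sigmaChar_eq_convSum]
    rw [h1]
    refine Submodule.sum_mem _ fun ψ₁ _ ↦ Submodule.sum_mem _ fun ψ₂ _ ↦ ?_
    -- The reflected half of the weight cancels all pairs of the wrong parity.
    by_cases hpar : ψ₁ (-1) * ψ₂ (-1) = (-1) ^ k
    · exact Submodule.smul_mem _ _ (shiftCoeff_sigmaChar_mem_coeffSpan hlev ψ₁ ψ₂ hpar)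
    · have : 1 + (-1) ^ k * (ψ₁ (-1) * ψ₂ (-1)) = 0 := by
        have s1 : (ψ₁ (-1) * ψ₂ (-1)) ^ 2 = 1 := by
          rw [mul_pow, ← map_pow, ← map_pow]; simp
        rcases sq_eq_one_iff.1 s1 with h | h <;>
        rcases neg_one_pow_eq_or ℂ k with h' | h' <;> simp_all
      simp [this]
  · convert! Submodule.zero_mem (coeffSpan k N) using 1
    ext n
    refine Finset.sum_eq_zero fun x hx ↦ ?_
    have hx' := (Nat.mem_divisorsAntidiagonal.1 hx).1
    have hzero : ∀ ε : ℤ, ε = 1 ∨ ε = -1 →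
        (if (x.1 : ZMod N) = ε * a then 1 else 0 : ℂ) *
          (if (x.2 : ZMod N) = ε * b then 1 else 0) = 0 := by
      intro ε hε
      by_contra hne
      have hx1 : (x.1 : ZMod N) = ε * a := by
        by_contra h'
        simp [h'] at hne
      have hx2 : (x.2 : ZMod N) = ε * b := by
        by_contra h'
        simp [h'] at hne
      -- A factorization mr = Nn with m ≡ ±a and r ≡ ±b would give N ∣ ab, hence N ∣ gcd(a, N)
      -- gcd(b, N), the excluded case.
      have hgcd : (N : ℤ) ∣ a.val * b.val := by
        rw [← ZMod.intCast_zmod_eq_zero_iff_dvd]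
        push_cast
        rw [ZMod.natCast_zmod_val, ZMod.natCast_zmod_val]
        have : (x.1 : ZMod N) * x.2 = 0 := by
          rw [← Nat.cast_mul, hx']; simp
        rw [hx1, hx2] at this
        rcases hε with rfl | rfl <;> simpa using this
      have hgcd' : N ∣ a.val * b.val := by exact_mod_cast hgcd
      apply hD
      rw [hg, hh]
      rw [Nat.gcd_comm, Nat.gcd_comm b.val]
      exact (Nat.dvd_gcd dvd_rfl hgcd').trans (Nat.gcd_mul_right_dvd_mul_gcd ..)
    beta_reduce
    rw [hzero 1 (.inl rfl), hzero (-1) (.inr rfl)]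
    simp

end Span

end EisDecomp

/-! ### Fourier expansion of weighted Eisenstein sums via Lipschitz' formula. -/

namespace EisDecomp

open Complex Filter Function
open UpperHalfPlane hiding I
open scoped Real Manifold

noncomputable section

variable {N : ℕ}

theorem tsum_residueClass [NeZero N] (g : ℤ → ℂ) (b : ℤ) :
    ∑' n : ℤ, g (b + N * n) = ∑' d : ℤ, if (d : ZMod N) = b then g d else 0 := by
  have hN : (N : ℤ) ≠ 0 := by exact_mod_cast NeZero.ne N
  have hinj : Injective fun n : ℤ ↦ b + N * n := fun m n h ↦ by
    simpa [NeZero.ne N] using h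
  rw [← hinj.tsum_eq (f := fun d : ℤ ↦ if (d : ZMod N) = b then g d else 0)]
  · simp
  · intro d hd
    by_contra h
    refine hd (if_neg fun h' ↦ h ?_)
    obtain ⟨n, hn⟩ := (ZMod.intCast_eq_intCast_iff_dvd_sub _ _ _).1 h'.symm
    exact ⟨n, by simp only; linarith⟩

theorem tsum_residueClasses [NeZero N] (f : ZMod N → ℂ) {g : ℤ → ℂ} (hg : Summable g) :
    ∑' d : ℤ, f d * g d = ∑ b : ZMod N, f b * ∑' n : ℤ, g (b.val + N * n) := by
  have h1 : ∀ b : ZMod N, ∑' n : ℤ, g (b.val + N * n) =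
      ∑' d : ℤ, if (d : ZMod N) = b then g d else 0 := fun b ↦ by
    rw [tsum_residueClass]; simp
  simp_rw [h1, ← tsum_mul_left]
  rw [← Summable.tsum_finsetSum]
  · exact tsum_congr fun d ↦ by simp
  · intro b _
    refine Summable.mul_left _ (Summable.of_norm_bounded hg.norm fun d ↦ ?_)
    split_ifs <;> simp

theorem summable_mul_of_summable [NeZero N] (f : ZMod N → ℂ) {g : ℤ → ℂ} (hg : Summable g) :
    Summable fun d : ℤ ↦ f d * g d := by
  refine Summable.of_norm_bounded (hg.norm.mul_left (∑ b, ‖f b‖)) fun d ↦ ?_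
  rw [norm_mul]
  gcongr
  exact Finset.single_le_sum (f := fun b ↦ ‖f b‖) (fun _ _ ↦ norm_nonneg _) (Finset.mem_univ _)

/-- The weighted double sum `∑_c ∑_d φ(c, d) (cz + d)⁻ᵏ`, for a weight `φ` on residue classes. -/
def eisSum (k : ℕ) (φ : ZMod N → ZMod N → ℂ) (z : ℍ) : ℂ :=
  ∑' c : ℤ, ∑' d : ℤ, φ c d * (((c : ℂ) * z + d) ^ k)⁻¹

/-- The constant factor in Lipschitz' formula. -/
def lipschitzFactor (k : ℕ) : ℂ := (-2 * π * I) ^ k / ((k - 1).factorial : ℂ)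

theorem lipschitzFactor_ne_zero (k : ℕ) : lipschitzFactor k ≠ 0 := by
  refine div_ne_zero (pow_ne_zero _ ?_) (by exact_mod_cast Nat.factorial_ne_zero _)
  simp [Real.pi_ne_zero]

theorem summable_linear_inv {k : ℕ} (hk : 2 ≤ k) (z : ℂ) (c : ℤ) :
    Summable fun d : ℤ ↦ (((c : ℂ) * z + d) ^ k)⁻¹ := by
  simpa using EisensteinSeries.linear_right_summable z c (k := k) (by exact_mod_cast hk)

variable [NeZero N]

/-- Lipschitz' formula with weights. -/
theorem tsum_weighted_linear_inv {k : ℕ} (hk : 2 ≤ k) (f : ZMod N → ℂ) (c : ℕ+) (z : ℍ) :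
    ∑' d : ℤ, f d * (((c : ℂ) * z + d) ^ k)⁻¹ = lipschitzFactor k / (N : ℂ) ^ k *
      ∑' r : ℕ+, ZMod.dft f (-(r : ℕ)) * ((r : ℂ) ^ (k - 1) *
        Periodic.qParam N z ^ (c * r : ℕ)) := by
  have hN : (N : ℂ) ≠ 0 := Nat.cast_ne_zero.2 (NeZero.ne N)
  have hN' : 0 < (N : ℝ) := Nat.cast_pos.2 (Nat.pos_of_ne_zero (NeZero.ne N))
  have hs := summable_linear_inv hk (z : ℂ) (c : ℤ)
  simp only [Int.cast_natCast] at hs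
  have hqn : ‖Periodic.qParam N z‖ < 1 := Periodic.norm_qParam_lt_one hN' z.im_pos
  have hsum : Summable fun r : ℕ+ ↦ (r : ℂ) ^ (k - 1) * Periodic.qParam N z ^ (c * r : ℕ) :=
    (summable_prod_mul_pow (k - 1) hqn).prod_factor c
  rw [tsum_residueClasses f hs]
  -- For each class b, Lipschitz' formula is used at the point (cz + b)/N. The resulting factors
  -- exp(2πirb/N), weighted by f(b), add up to the discrete Fourier transform of f at -r.
  have key : ∀ b : ZMod N, ∑' n : ℤ, (((c : ℂ) * z + ((b.val + N * n : ℤ) : ℂ)) ^ k)⁻¹ =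
      lipschitzFactor k / (N : ℂ) ^ k * ∑' r : ℕ+, ZMod.stdAddChar ((r : ZMod N) * b) *
        ((r : ℂ) ^ (k - 1) * Periodic.qParam N z ^ (c * r : ℕ)) := by
    intro b
    have him : 0 < (((c : ℂ) * z + b.val) / N).im := by
      have hc : (0 : ℝ) < c := Nat.cast_pos.2 c.pos
      have : (((c : ℂ) * z + b.val) / N).im = c * z.im / N := by
        rw [Complex.div_natCast_im, Complex.add_im, Complex.natCast_im, Complex.mul_im]
        simp
      rw [this]
      exact div_pos (mul_pos hc z.im_pos) hN'
    have h1 := EisensteinSeries.qExpansion_identity_pnat (k := k - 1) (by omega) ⟨_, him⟩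
    rw [Nat.sub_add_cancel (by omega : 1 ≤ k)] at h1
    have h2 : ∀ n : ℤ, (((c : ℂ) * z + ((b.val + N * n : ℤ) : ℂ)) ^ k)⁻¹ =
        ((N : ℂ) ^ k)⁻¹ * (1 / (((c : ℂ) * z + b.val) / N + n) ^ k) := by
      intro n
      rw [one_div, ← mul_inv, ← mul_pow]
      congr 2
      push_cast
      field_simp
      ring
    simp_rw [h2]
    rw [tsum_mul_left]
    refine (congrArg (((N : ℂ) ^ k)⁻¹ * ·) h1).trans ?_
    rw [lipschitzFactor, ← mul_assoc, div_eq_mul_inv _ ((N : ℂ) ^ k), mul_comm _ ((N : ℂ) ^ k)⁻¹]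
    congr 1
    refine tsum_congr fun r ↦ ?_
    rw [mul_left_comm]
    congr 1
    have : (r : ZMod N) * b = ((r * b.val : ℤ) : ZMod N) := by simp
    rw [this, ZMod.stdAddChar_coe, Periodic.qParam, ← Complex.exp_nat_mul, ← Complex.exp_nat_mul,
      ← Complex.exp_add]
    congr 1
    push_cast
    field_simp
    ring
  simp only [key, ZMod.dft_apply, Finset.sum_mul, smul_eq_mul]
  rw [Summable.tsum_finsetSum, Finset.mul_sum]
  · refine Finset.sum_congr rfl fun b _ ↦ ?_
    rw [mul_left_comm, ← tsum_mul_left]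
    congr 1
    refine tsum_congr fun r ↦ ?_
    rw [show -(b * -((r : ℕ) : ZMod N)) = (r : ZMod N) * b by ring]
    ring
  · intro b _
    refine Summable.of_norm_bounded (hsum.norm.mul_left ‖f b‖) fun r ↦ ?_
    rw [norm_mul, norm_mul, ZMod.stdAddChar_apply, Circle.norm_coe, one_mul]

/-- The Fourier transform in the second variable. -/
def dftRight (φ : ZMod N → ZMod N → ℂ) (m r : ZMod N) : ℂ := ZMod.dft (φ m) (-r)

/-- The coefficients of `eisSum k φ` as a series in `exp(2πiz/N)`. -/
def eisSumCoeff (k : ℕ) (φ : ZMod N → ZMod N → ℂ) (n : ℕ) : ℂ :=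
  if n = 0 then ∑' d : ℤ, φ 0 d * ((d : ℂ) ^ k)⁻¹ else
    lipschitzFactor k / (N : ℂ) ^ k *
      convSum k (fun m r ↦ dftRight φ m r + (-1) ^ k * dftRight φ (-m) (-r)) n

theorem dft_comp_neg_apply (f : ZMod N → ℂ) (r : ZMod N) :
    ZMod.dft (fun j ↦ f (-j)) r = ZMod.dft f (-r) := by
  rw [ZMod.dft_comp_neg]

/-- The outer sum splits into c > 0, c = 0 and c < 0; the last reduces to the first by d ↦ -d, at
the cost of (-1)^k and a reflected weight. After Lipschitz' formula the series over (c, r) converges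
absolutely and may be regrouped by n = cr. Convergence of the outer sum is recorded as well, since
for k = 2 the original double series does not converge absolutely. -/
theorem hasSum_eisSum {k : ℕ} (hk : 2 ≤ k) (φ : ZMod N → ZMod N → ℂ) (z : ℍ) :
    HasSum (fun c : ℤ ↦ ∑' d : ℤ, φ c d * (((c : ℂ) * z + d) ^ k)⁻¹) (eisSum k φ z) ∧
    HasSum (fun n ↦ eisSumCoeff k φ n * Periodic.qParam N z ^ n) (eisSum k φ z) := by
  have hN' : 0 < (N : ℝ) := Nat.cast_pos.2 (Nat.pos_of_ne_zero (NeZero.ne N))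
  set q := Periodic.qParam N z with hq
  have hqn : ‖q‖ < 1 := Periodic.norm_qParam_lt_one hN' z.im_pos
  set A := lipschitzFactor k / (N : ℂ) ^ k with hA
  have hsum : ∀ w : ZMod N → ZMod N → ℂ,
      Summable fun x : ℕ+ × ℕ+ ↦ w x.1 x.2 * ((x.2 : ℂ) ^ (k - 1) * q ^ (x.1 * x.2 : ℕ)) := by
    intro w
    refine Summable.of_norm_bounded
      ((summable_prod_mul_pow (k - 1) hqn).norm.mul_left (∑ a, ∑ b, ‖w a b‖)) fun x ↦ ?_
    rw [norm_mul]
    gcongr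
    exact (Finset.single_le_sum (f := fun b ↦ ‖w x.1 b‖) (fun _ _ ↦ norm_nonneg _)
      (Finset.mem_univ _)).trans (Finset.single_le_sum (f := fun a ↦ ∑ b, ‖w a b‖)
      (fun _ _ ↦ Finset.sum_nonneg fun _ _ ↦ norm_nonneg _) (Finset.mem_univ _))
  set F : ℤ → ℂ := fun c ↦ ∑' d : ℤ, φ c d * (((c : ℂ) * z + d) ^ k)⁻¹ with hF
  have hpos : ∀ c : ℕ+, F c = A * ∑' r : ℕ+, dftRight φ (c : ℕ) (r : ℕ) *
      ((r : ℂ) ^ (k - 1) * q ^ (c * r : ℕ)) := by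
    intro c
    simpa [hF, hA, hq, dftRight] using tsum_weighted_linear_inv hk (φ (c : ℕ)) c z
  have hneg : ∀ c : ℕ+, F (-c) = A * ∑' r : ℕ+, ((-1) ^ k * dftRight φ (-(c : ℕ)) (-(r : ℕ))) *
      ((r : ℂ) ^ (k - 1) * q ^ (c * r : ℕ)) := by
    intro c
    have h1 : F (-c) = (-1) ^ k *
        ∑' d : ℤ, φ (-(c : ℕ)) (-(d : ZMod N)) * (((c : ℂ) * z + d) ^ k)⁻¹ := by
      rw [← tsum_mul_left]
      refine ((Equiv.neg ℤ).tsum_eq _).symm.trans (tsum_congr fun d ↦ ?_)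
      have : ((-(c : ℕ) : ℤ) : ℂ) * (z : ℂ) + ((-d : ℤ) : ℂ) = -((c : ℂ) * z + d) := by
        push_cast; ring
      simp only [Equiv.neg_apply, this]
      rw [neg_pow, mul_inv, ← inv_pow, inv_neg_one]
      push_cast
      ring
    have h2 := tsum_weighted_linear_inv hk (fun j ↦ φ (-(c : ℕ)) (-j)) c z
    rw [h1, h2, mul_left_comm, ← tsum_mul_left]
    congr 1
    refine tsum_congr fun r ↦ ?_
    rw [dft_comp_neg_apply, dftRight]
    ring
  -- the two halves of the outer sum
  have h1 : HasSum (fun c : ℕ+ ↦ F c) (A * ∑' x : ℕ+ × ℕ+, dftRight φ (x.1 : ℕ) (x.2 : ℕ) *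
      ((x.2 : ℂ) ^ (k - 1) * q ^ (x.1 * x.2 : ℕ))) := by
    simp_rw [hpos]
    exact ((hsum (dftRight φ)).hasSum.prod_fiberwise
      fun c ↦ ((hsum (dftRight φ)).prod_factor c).hasSum).mul_left A
  have hs2 := hsum fun m r ↦ (-1) ^ k * dftRight φ (-m) (-r)
  have h2 : HasSum (fun c : ℕ+ ↦ F (-c)) (A * ∑' x : ℕ+ × ℕ+,
      ((-1) ^ k * dftRight φ (-(x.1 : ℕ)) (-(x.2 : ℕ))) *
      ((x.2 : ℂ) ^ (k - 1) * q ^ (x.1 * x.2 : ℕ))) := by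
    simp_rw [hneg]
    exact (hs2.hasSum.prod_fiberwise fun c ↦ (hs2.prod_factor c).hasSum).mul_left A
  set T := ∑' x : ℕ+ × ℕ+, dftRight φ (x.1 : ℕ) (x.2 : ℕ) *
      ((x.2 : ℂ) ^ (k - 1) * q ^ (x.1 * x.2 : ℕ))
  set T' := ∑' x : ℕ+ × ℕ+, ((-1) ^ k * dftRight φ (-(x.1 : ℕ)) (-(x.2 : ℕ))) *
      ((x.2 : ℂ) ^ (k - 1) * q ^ (x.1 * x.2 : ℕ))
  have hZ : HasSum F (A * T + F 0 + A * T') := by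
    refine HasSum.of_add_one_of_neg_add_one ?_ ?_
    · rw [← Equiv.pnatEquivNat.hasSum_iff]
      convert! h1 using 2 with c
      simp [← PNat.natPred_add_one]
    · rw [← Equiv.pnatEquivNat.hasSum_iff]
      convert! h2 using 2 with c
      simp [← PNat.natPred_add_one]
  have hE : eisSum k φ z = A * T + F 0 + A * T' := hZ.tsum_eq
  refine ⟨hE ▸ hZ, ?_⟩
  set W : ℕ → ℕ → ℂ := fun m r ↦ dftRight φ m r + (-1) ^ k * dftRight φ (-m) (-r) with hW
  have h3 : HasSum (fun x : ℕ+ × ℕ+ ↦ W x.1 x.2 * ((x.2 : ℂ) ^ (k - 1) * q ^ (x.1 * x.2 : ℕ)))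
      (T + T') := by
    convert! (hsum (dftRight φ)).hasSum.add hs2.hasSum using 2 with x
    rw [hW]
    ring
  -- Regroup the pairs (m, r) according to their product n.
  have h4 : HasSum (fun n : ℕ+ ↦ convSum k W n * q ^ (n : ℕ)) (T + T') := by
    refine (sigmaAntidiagonalEquivProd.hasSum_iff.2 h3).sigma fun n ↦ ?_
    convert! hasSum_fintype _ using 1
    rw [convSum, Finset.sum_mul, Finset.univ_eq_attach,
      ← Finset.sum_attach]
    refine Finset.sum_congr rfl fun x _ ↦ ?_
    simp only [comp_apply, sigmaAntidiagonalEquivProd, divisorsAntidiagonalFactors, Equiv.coe_fn_mk,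
      PNat.mk_coe]
    rw [(Nat.mem_divisorsAntidiagonal.1 x.2).1]
    ring
  have h5 : HasSum (fun n : ℕ ↦ eisSumCoeff k φ (n + 1) * q ^ (n + 1)) (A * (T + T')) := by
    rw [← Equiv.pnatEquivNat.hasSum_iff]
    convert! h4.mul_left A using 2 with n
    simp only [comp_apply, Equiv.pnatEquivNat_apply, PNat.natPred_add_one]
    rw [eisSumCoeff, if_neg n.ne_zero, mul_assoc]
  have h6 := (hasSum_nat_add_iff (f := fun n ↦ eisSumCoeff k φ n * q ^ n) 1).1 h5
  rw [hE]
  convert! h6 using 1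
  simp [eisSumCoeff, hF]
  ring

theorem hasQSeries_eisSum {k : ℕ} (hk : 2 ≤ k) (φ : ZMod N → ZMod N → ℂ) :
    HasQSeries N (eisSum k φ) (eisSumCoeff k φ) := fun z ↦ (hasSum_eisSum hk φ z).2

theorem eisSum_add {k : ℕ} (hk : 2 ≤ k) (φ φ' : ZMod N → ZMod N → ℂ) :
    eisSum k (φ + φ') = eisSum k φ + eisSum k φ' := by
  ext z
  rw [Pi.add_apply]
  refine HasSum.unique (hasSum_eisSum hk (φ + φ') z).1 ?_
  convert! (hasSum_eisSum hk φ z).1.add (hasSum_eisSum hk φ' z).1 using 2 with c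
  rw [← Summable.tsum_add (summable_mul_of_summable _ (summable_linear_inv hk _ _))
    (summable_mul_of_summable _ (summable_linear_inv hk _ _))]
  simp [add_mul]

omit [NeZero N] in
theorem eisSum_smul (k : ℕ) (a : ℂ) (φ : ZMod N → ZMod N → ℂ) :
    eisSum k (a • φ) = a • eisSum k φ := by
  ext z
  simp [eisSum, mul_assoc, tsum_mul_left]

/-- `eisSum` as a linear map. -/
def eisSumLinear {k : ℕ} (hk : 2 ≤ k) : (ZMod N → ZMod N → ℂ) →ₗ[ℂ] (ℍ → ℂ) where
  toFun := eisSum k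
  map_add' := eisSum_add hk
  map_smul' := eisSum_smul k

/-- The indicator function of a pair of residue classes. -/
def residueIndicator (a b : ZMod N) : ZMod N → ZMod N → ℂ := Pi.single a (Pi.single b 1)

theorem eisensteinG_eq_eisSum (k : ℕ) (a b : ℤ) :
    eisensteinG k N a b = eisSum k (residueIndicator (a : ZMod N) (b : ZMod N)) := by
  ext z
  rw [eisensteinG, eisSum]
  have h1 : ∀ c : ℤ, ∑' n : ℤ, 1 / ((c : ℂ) * z + ((b + N * n : ℤ) : ℂ)) ^ k =
      ∑' d : ℤ, (Pi.single (b : ZMod N) 1 : ZMod N → ℂ) d * (((c : ℂ) * z + d) ^ k)⁻¹ := by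
    intro c
    rw [tsum_residueClass (fun d : ℤ ↦ 1 / ((c : ℂ) * z + (d : ℂ)) ^ k)]
    refine tsum_congr fun d ↦ ?_
    by_cases h : (d : ZMod N) = b <;> simp [h]
  rw [← tsum_congr fun m ↦ (h1 (a + N * m)).symm,
    tsum_residueClass fun c ↦
      ∑' d : ℤ, (Pi.single (b : ZMod N) 1 : ZMod N → ℂ) d * (((c : ℂ) * z + d) ^ k)⁻¹]
  refine tsum_congr fun c ↦ ?_
  by_cases h : (c : ZMod N) = a <;> simp [residueIndicator, h]

theorem eq_sum_residueIndicator (φ : ZMod N → ZMod N → ℂ) :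
    φ = ∑ a, ∑ b, φ a b • residueIndicator a b := by
  ext c d
  simp [residueIndicator, Finset.sum_apply, Pi.single_apply, ite_apply]

/-- This replaces membership in the span by the choice of one weight φ. -/
theorem span_eisensteinG {k : ℕ} (hk : 2 ≤ k) :
    Submodule.span ℂ (Set.range fun ab : ℤ × ℤ ↦ eisensteinG k N ab.1 ab.2) =
      LinearMap.range (eisSumLinear (N := N) hk) := by
  apply le_antisymm
  · rw [Submodule.span_le]
    rintro _ ⟨⟨a, b⟩, rfl⟩
    exact ⟨_, (eisensteinG_eq_eisSum k a b).symm⟩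
  · rintro _ ⟨φ, rfl⟩
    rw [eq_sum_residueIndicator φ, map_sum]
    refine Submodule.sum_mem _ fun a _ ↦ ?_
    rw [map_sum]
    refine Submodule.sum_mem _ fun b _ ↦ ?_
    rw [map_smul]
    refine Submodule.smul_mem _ _ (Submodule.subset_span ⟨(a.val, b.val), ?_⟩)
    simp only [eisensteinG_eq_eisSum]
    simp [eisSumLinear]

end

end EisDecomp

/-! ### Behaviour of the Eisenstein sums under SL(2, ℤ), including weight 2. -/

namespace EisDecomp

open Complex Filter Function
open UpperHalfPlane hiding I
open scoped Real Manifold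

noncomputable section

open EisensteinSeries Matrix Asymptotics

variable {N : ℕ}

/-- Right multiplication by an element of `SL(2, ℤ)` on integral vectors. -/
def vecMulEquiv (γ : SL(2, ℤ)) : (Fin 2 → ℤ) ≃ (Fin 2 → ℤ) where
  toFun v := v ᵥ* (γ : Matrix (Fin 2) (Fin 2) ℤ)
  invFun v := v ᵥ* ((γ⁻¹ : SL(2, ℤ)) : Matrix (Fin 2) (Fin 2) ℤ)
  left_inv v := by
    simp [vecMul_vecMul, mul_adjugate]
  right_inv v := by
    simp [vecMul_vecMul, adjugate_mul]

theorem vecMulEquiv_apply (γ : SL(2, ℤ)) (v : Fin 2 → ℤ) :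
    vecMulEquiv γ v = v ᵥ* (γ : Matrix (Fin 2) (Fin 2) ℤ) := rfl

theorem slash_eq_of_smul_eq {k : ℕ} {γ : SL(2, ℤ)} {f g : ℍ → ℂ}
    (h : ∀ z, f (γ • z) = denom γ z ^ (k : ℤ) * g z) : f ∣[(k : ℤ)] γ = g := by
  ext z
  rw [ModularForm.SL_slash_apply, h, _root_.zpow_neg, mul_comm, ← mul_assoc]
  rw [inv_mul_cancel₀ (zpow_ne_zero _ (denom_ne_zero _ _)), one_mul]

theorem tsum_eisSummand_slash (k N : ℕ) (γ : SL(2, ℤ)) :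
    (fun z ↦ ∑' v : Fin 2 → ℤ, eisSummand k ((N : ℤ) • v) z) ∣[(k : ℤ)] γ =
      fun z ↦ ∑' v : Fin 2 → ℤ, eisSummand k ((N : ℤ) • v) z := by
  refine slash_eq_of_smul_eq fun z ↦ ?_
  simp only [eisSummand_SL2_apply, tsum_mul_left, smul_vecMul]
  congr 1
  have := (vecMulEquiv γ).tsum_eq fun v ↦ eisSummand k ((N : ℤ) • v) z
  simp only [vecMulEquiv_apply] at this
  exact this

/-- The matrix γ permutes the lattice vectors v. Subtracting the term of the zero class makes the
series absolutely convergent for k = 2 too, so that this sum really is the one of interest. -/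
theorem tsum_eisSummand_sub_slash (k N : ℕ) (u : Fin 2 → ℤ) (γ : SL(2, ℤ)) :
    (fun z ↦ ∑' v : Fin 2 → ℤ, (eisSummand k (u + (N : ℤ) • v) z -
      eisSummand k ((N : ℤ) • v) z)) ∣[(k : ℤ)] γ =
    fun z ↦ ∑' v : Fin 2 → ℤ, (eisSummand k (u ᵥ* (γ : Matrix (Fin 2) (Fin 2) ℤ) + (N : ℤ) • v) z -
      eisSummand k ((N : ℤ) • v) z) := by
  refine slash_eq_of_smul_eq fun z ↦ ?_
  simp only [eisSummand_SL2_apply, ← mul_sub, tsum_mul_left, smul_vecMul, add_vecMul]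
  congr 1
  have := (vecMulEquiv γ).tsum_eq fun v ↦
    eisSummand k (u ᵥ* (γ : Matrix (Fin 2) (Fin 2) ℤ) + (N : ℤ) • v) z -
      eisSummand k ((N : ℤ) • v) z
  simp only [vecMulEquiv_apply] at this
  exact this

theorem summable_eisSummand {k : ℕ} (hk : 3 ≤ k) (z : ℍ) :
    Summable fun v ↦ eisSummand k v z := by
  refine Summable.of_norm_bounded ((summable_one_div_norm_rpow (k := k) (by
    exact_mod_cast hk)).mul_left (r z ^ (-k : ℝ))) fun v ↦ ?_
  have := summand_bound z (k := k) (by positivity) v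
  rw [eisSummand, norm_zpow]
  exact_mod_cast this

theorem summable_eisSummand_sub {k : ℕ} (hk : 2 ≤ k) (u : Fin 2 → ℤ) (z : ℍ) :
    Summable fun v ↦ eisSummand k v z - eisSummand k (v - u) z := by
  rcases hk.lt_or_eq with hk | rfl
  · exact (summable_eisSummand hk z).sub
      ((Equiv.subRight u).summable_iff.2 (summable_eisSummand hk z))
  · set A : (Fin 2 → ℤ) → ℂ := fun v ↦ v 0 * z + v 1 with hA
    have hA0 : ∀ v, v ≠ 0 → A v ≠ 0 := fun v hv ↦ by
      have := linear_ne_zero (cd := fun i ↦ (v i : ℝ)) z (by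
        contrapose! hv
        ext i
        have := congrFun hv i
        simpa using this)
      simpa [hA] using this
    have hB : ∀ w : Fin 2 → ℤ, (fun v ↦ (A (v - w))⁻¹) =O[cofinite] fun v ↦ ‖v‖⁻¹ := fun w ↦ by
      convert! isBigO_linear_add_const_vec z (-w 0) (-w 1) using 2 with v
      simp only [hA, Pi.sub_apply]
      push_cast
      ring_nf
    have h0 := hB 0
    simp only [sub_zero] at h0
    have hu := hB u
    refine summable_of_isBigO_rpow_norm (a := 3) (by norm_num) ?_
    -- For k = 2, with x = A(v) and y = A(v - u) = x - A(u), one has 1/x² - 1/y² = -A(u)(1/(xy²) +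
    -- 1/(x²y)), of order |v|⁻³, which is summable over a rank 2 lattice.
    have h3 : (fun v ↦ -A u * ((A v)⁻¹ * (A (v - u))⁻¹ * (A (v - u))⁻¹ +
        (A v)⁻¹ * (A v)⁻¹ * (A (v - u))⁻¹)) =O[cofinite] fun v ↦ (‖v‖ ^ (3 : ℝ))⁻¹ := by
      refine IsBigO.const_mul_left ?_ _
      have : (fun v : Fin 2 → ℤ ↦ (‖v‖ ^ (3 : ℝ))⁻¹) = fun v ↦ ‖v‖⁻¹ * ‖v‖⁻¹ * ‖v‖⁻¹ := by
        ext v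
        rw [← mul_inv, ← mul_inv, show (3 : ℝ) = (3 : ℕ) by norm_num, Real.rpow_natCast]
        ring
      rw [this]
      exact ((h0.mul hu).mul hu).add ((h0.mul h0).mul hu)
    refine h3.congr' ?_ EventuallyEq.rfl
    have hfin : ({0, u} : Set (Fin 2 → ℤ)).Finite := by simp
    filter_upwards [hfin.compl_mem_cofinite] with v hv
    simp only [Set.mem_compl_iff, Set.mem_insert_iff, Set.mem_singleton_iff, not_or] at hv
    have h1 := hA0 v hv.1
    have h2 := hA0 (v - u) (sub_ne_zero.2 hv.2)
    have h4 : A (v - u) = A v - A u := by simp only [hA, Pi.sub_apply]; push_cast; ring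
    have h5 : ∀ w, eisSummand (2 : ℕ) w z = (A w ^ 2)⁻¹ := fun w ↦ by
      simp only [eisSummand, hA]; norm_cast
    rw [h5, h5]
    have h6 : A u = A v - A (v - u) := by rw [h4]; ring
    rw [h6]
    field_simp
    ring

variable [NeZero N]

theorem injective_add_mul (a : ℤ) : Injective fun m : ℤ ↦ a + N * m := fun m n h ↦ by
  simpa [NeZero.ne N] using h

theorem hasSum_eisensteinG {k : ℕ} (hk : 2 ≤ k) (a b : ℤ) (z : ℍ) :
    HasSum (fun m : ℤ ↦ ∑' n : ℤ, eisSummand k (![a, b] + (N : ℤ) • ![m, n]) z)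
      (eisensteinG k N a b z) := by
  have h := (hasSum_eisSum hk (residueIndicator (a : ZMod N) (b : ZMod N)) z).1
  have hs := h.summable.comp_injective (injective_add_mul (N := N) a)
  have : ∀ m : ℤ, ∑' n : ℤ, eisSummand k (![a, b] + (N : ℤ) • ![m, n]) z =
      ∑' d : ℤ, residueIndicator (a : ZMod N) (b : ZMod N) ((a + N * m : ℤ) : ZMod N) d *
        (((a + N * m : ℤ) * (z : ℂ) + d) ^ k)⁻¹ := by
    intro m
    have := tsum_residueClass (N := N) (fun d : ℤ ↦ (((a + N * m : ℤ) * (z : ℂ) + d) ^ k)⁻¹) b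
    convert! this using 1
    · simp [eisSummand]
    · refine tsum_congr fun d ↦ ?_
      by_cases h : (d : ZMod N) = b <;> simp [residueIndicator, h]
  have hs' := hs.hasSum
  simp only [comp_def, ← this] at hs'
  convert! hs' using 1
  rw [eisensteinG]
  simp [eisSummand]

/-- Absolute convergence identifies the lattice sum with the iterated sums, so all failure of
modularity sits in the single series of the class (0, 0). -/
theorem hasSum_eisensteinG_sub {k : ℕ} (hk : 2 ≤ k) (u : Fin 2 → ℤ) (z : ℍ) :
    ∑' v : Fin 2 → ℤ, (eisSummand k (u + (N : ℤ) • v) z - eisSummand k ((N : ℤ) • v) z) =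
      eisensteinG k N (u 0) (u 1) z - eisensteinG k N 0 0 z := by
  have hs : Summable fun v : Fin 2 → ℤ ↦
      (eisSummand k (u + (N : ℤ) • v) z - eisSummand k ((N : ℤ) • v) z) := by
    have hinj : Injective fun v : Fin 2 → ℤ ↦ u + (N : ℤ) • v := fun v w h ↦ by
      ext i
      have := congrFun h i
      simpa [NeZero.ne N] using this
    have := (summable_eisSummand_sub hk u z).comp_injective hinj
    simpa [comp_def] using this
  rw [← (finTwoArrowEquiv ℤ).symm.tsum_eq]
  refine ((finTwoArrowEquiv ℤ).symm.summable_iff.2 hs).tsum_prod.trans ?_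
  have hs2 : ∀ (a b m : ℤ), Summable fun n : ℤ ↦ eisSummand k (![a, b] + (N : ℤ) • ![m, n]) z := by
    intro a b m
    have := (summable_linear_inv hk (z : ℂ) (a + N * m)).comp_injective (injective_add_mul (N := N) b)
    simpa [comp_def, eisSummand] using this
  have h1 := (hasSum_eisensteinG (N := N) hk (u 0) (u 1) z).sub (hasSum_eisensteinG (N := N) hk 0 0 z)
  rw [← h1.tsum_eq]
  refine tsum_congr fun m ↦ ?_
  rw [← (hs2 _ _ _).tsum_sub (hs2 _ _ _)]
  refine tsum_congr fun n ↦ ?_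
  have : u = ![u 0, u 1] := by ext i; fin_cases i <;> rfl
  have h00 : ![(0 : ℤ), 0] = 0 := by ext i; fin_cases i <;> rfl
  rw [← this, h00, zero_add]
  rfl

theorem G2_eq_eisensteinG : eisensteinG 2 N 0 0 = ((N : ℂ) ^ 2)⁻¹ • G2 := by
  ext z
  have h := hasSum_eisensteinG (N := N) le_rfl 0 0 z
  have hN : (N : ℂ) ^ 2 ≠ 0 := pow_ne_zero _ (Nat.cast_ne_zero.2 (NeZero.ne N))
  have h1 : ∀ m : ℤ, e2Summand m z = (N : ℂ) ^ 2 *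
      ∑' n : ℤ, eisSummand (2 : ℕ) (![0, 0] + (N : ℤ) • ![m, n]) z := by
    intro m
    rw [e2Summand, ← tsum_mul_left]
    refine tsum_congr fun n ↦ ?_
    simp only [eisSummand]
    have : ((2 : ℕ) : ℤ) = 2 := rfl
    simp only [this, _root_.zpow_neg, zpow_ofNat]
    simp only [Pi.add_apply, Pi.smul_apply, cons_val_zero, cons_val_one, zero_add, smul_eq_mul]
    push_cast
    rw [mul_assoc, ← mul_add, mul_pow, mul_inv, ← mul_assoc, mul_inv_cancel₀ hN, one_mul]
  have h2 : HasSum (fun m ↦ e2Summand m z) ((N : ℂ) ^ 2 * eisensteinG 2 N 0 0 z) := by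
    simp_rw [h1]
    exact h.mul_left _
  have h3 : G2 z = (N : ℂ) ^ 2 * eisensteinG 2 N 0 0 z := by
    rw [G2]
    -- `G2` sums over symmetric intervals; unconditional convergence of the outer sum makes this the
    -- ordinary sum.
    rw [tsum_eq_of_summable_unconditional h2.summable, h2.tsum_eq]
  rw [Pi.smul_apply, smul_eq_mul, h3, inv_mul_cancel_left₀ hN]

theorem eisensteinG_zero_slash {k : ℕ} (hk : 2 ≤ k) (γ : SL(2, ℤ)) :
    eisensteinG k N 0 0 ∣[(k : ℤ)] γ = eisensteinG k N 0 0 -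
      (if k = 2 then ((N : ℂ) ^ 2)⁻¹ else 0) • D2 γ := by
  rcases hk.lt_or_eq with hk' | rfl
  · have hinj : Injective fun v : Fin 2 → ℤ ↦ (N : ℤ) • v := fun v w h ↦ by
      ext i
      have := congrFun h i
      simpa [NeZero.ne N] using this
    have : eisensteinG k N 0 0 = fun z ↦ ∑' v : Fin 2 → ℤ, eisSummand k ((N : ℤ) • v) z := by
      ext z
      have hs := (summable_eisSummand hk' z).comp_injective hinj
      rw [← (finTwoArrowEquiv ℤ).symm.tsum_eq]
      refine Eq.symm (((finTwoArrowEquiv ℤ).symm.summable_iff.2 hs).tsum_prod.trans ?_)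
      rw [← (hasSum_eisensteinG (N := N) hk 0 0 z).tsum_eq]
      refine tsum_congr fun m ↦ tsum_congr fun n ↦ ?_
      have h00 : ![(0 : ℤ), 0] = 0 := by ext i; fin_cases i <;> rfl
      rw [h00, zero_add]
      rfl
    rw [this, tsum_eisSummand_slash, if_neg hk'.ne']
    simp
  · rw [G2_eq_eisensteinG, ModularForm.SL_smul_slash, if_pos rfl, ← smul_sub]
    congr 1
    exact G2_slash_action γ

/-- All classes inherit the same defect from the class (0, 0). Hence a weighted combination is
modular up to the total weight, which explains `quasiFactor`. -/
theorem eisensteinG_slash {k : ℕ} (hk : 2 ≤ k) (u : Fin 2 → ℤ) (γ : SL(2, ℤ)) :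
    eisensteinG k N (u 0) (u 1) ∣[(k : ℤ)] γ =
      eisensteinG k N ((u ᵥ* (γ : Matrix (Fin 2) (Fin 2) ℤ)) 0)
        ((u ᵥ* (γ : Matrix (Fin 2) (Fin 2) ℤ)) 1) -
      (if k = 2 then ((N : ℂ) ^ 2)⁻¹ else 0) • D2 γ := by
  have h : ∀ w : Fin 2 → ℤ, eisensteinG k N (w 0) (w 1) =
      (fun z ↦ ∑' v : Fin 2 → ℤ, (eisSummand k (w + (N : ℤ) • v) z -
        eisSummand k ((N : ℤ) • v) z)) + eisensteinG k N 0 0 := by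
    intro w
    ext z
    rw [Pi.add_apply, hasSum_eisensteinG_sub hk]
    ring
  rw [h u, SlashAction.add_slash, tsum_eisSummand_sub_slash, eisensteinG_zero_slash hk,
    h (u ᵥ* (γ : Matrix (Fin 2) (Fin 2) ℤ))]
  abel

/-- The action of `SL(2, ℤ)` on weights by right translation. -/
def slashWeight (γ : SL(2, ℤ)) (φ : ZMod N → ZMod N → ℂ) (c d : ZMod N) : ℂ :=
  φ (c * (γ 1 1 : ℤ) - d * (γ 1 0 : ℤ)) (d * (γ 0 0 : ℤ) - c * (γ 0 1 : ℤ))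

/-- The factor that measures the failure of modularity of `eisSum k φ`. -/
def quasiFactor (k : ℕ) (φ : ZMod N → ZMod N → ℂ) : ℂ :=
  if k = 2 then ((N : ℂ) ^ 2)⁻¹ * ∑ a, ∑ b, φ a b else 0

theorem quasiFactor_add (k : ℕ) (φ φ' : ZMod N → ZMod N → ℂ) :
    quasiFactor k (φ + φ') = quasiFactor k φ + quasiFactor k φ' := by
  simp only [quasiFactor, Pi.add_apply, Finset.sum_add_distrib]
  split_ifs <;> ring

theorem quasiFactor_smul (k : ℕ) (a : ℂ) (φ : ZMod N → ZMod N → ℂ) :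
    quasiFactor k (a • φ) = a * quasiFactor k φ := by
  simp only [quasiFactor, Pi.smul_apply, smul_eq_mul, ← Finset.mul_sum]
  split_ifs <;> ring

omit [NeZero N] in
theorem residueIndicator_apply (a b c d : ZMod N) :
    residueIndicator a b c d = if c = a ∧ d = b then 1 else 0 := by
  by_cases h : c = a <;> simp [residueIndicator, h, Pi.single_apply]

theorem eisSum_slash_residueIndicator {k : ℕ} (hk : 2 ≤ k) (a b : ZMod N) (γ : SL(2, ℤ)) :
    eisSum k (residueIndicator a b) ∣[(k : ℤ)] γ =
      eisSum k (slashWeight γ (residueIndicator a b)) -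
      quasiFactor k (residueIndicator a b) • D2 γ := by
  obtain ⟨a, rfl⟩ := ZMod.intCast_surjective a
  obtain ⟨b, rfl⟩ := ZMod.intCast_surjective b
  have h := eisensteinG_slash (N := N) hk ![a, b] γ
  simp only [eisensteinG_eq_eisSum, cons_val_zero, cons_val_one] at h
  rw [h]
  congr 2
  · have hdet : (γ 0 0 : ZMod N) * (γ 1 1 : ℤ) - (γ 0 1 : ℤ) * (γ 1 0 : ℤ) = 1 := by
      have := γ.det_coe
      rw [det_fin_two] at this
      exact_mod_cast congrArg (Int.cast : ℤ → ZMod N) this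
    have hv : ∀ i, (![a, b] ᵥ* (γ : Matrix (Fin 2) (Fin 2) ℤ)) i = a * γ 0 i + b * γ 1 i :=
      fun i ↦ by simp only [vecMul, vec2_dotProduct, cons_val_zero, cons_val_one]
    ext c d
    simp only [residueIndicator_apply, slashWeight, hv]
    congr 1
    push_cast
    rw [eq_iff_iff]
    constructor
    · rintro ⟨rfl, rfl⟩
      exact ⟨by linear_combination (a : ZMod N) * hdet, by linear_combination (b : ZMod N) * hdet⟩
    · rintro ⟨ha, hb⟩
      rw [← ha, ← hb]
      exact ⟨by linear_combination (-c) * hdet, by linear_combination (-d) * hdet⟩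
  · have : ∑ c : ZMod N, ∑ d : ZMod N, residueIndicator (a : ZMod N) (b : ZMod N) c d = 1 := by
      simp [residueIndicator_apply, ite_and]
    rw [quasiFactor, this, mul_one]

theorem eisSum_slash {k : ℕ} (hk : 2 ≤ k) (φ : ZMod N → ZMod N → ℂ) (γ : SL(2, ℤ)) :
    eisSum k φ ∣[(k : ℤ)] γ = eisSum k (slashWeight γ φ) - quasiFactor k φ • D2 γ := by
  let P : (ZMod N → ZMod N → ℂ) → Prop := fun φ ↦
    eisSum k φ ∣[(k : ℤ)] γ = eisSum k (slashWeight γ φ) - quasiFactor k φ • D2 γ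
  have hadd : ∀ φ φ', P φ → P φ' → P (φ + φ') := by
    intro φ φ' h h'
    simp only [P] at h h' ⊢
    rw [eisSum_add hk, SlashAction.add_slash, h, h', quasiFactor_add, add_smul,
      show slashWeight γ (φ + φ') = slashWeight γ φ + slashWeight γ φ' from rfl, eisSum_add hk]
    abel
  have hsmul : ∀ (a : ℂ) φ, P φ → P (a • φ) := by
    intro a φ h
    simp only [P] at h ⊢
    rw [eisSum_smul, ModularForm.SL_smul_slash, h, quasiFactor_smul, smul_sub, mul_smul,
      show slashWeight γ (a • φ) = a • slashWeight γ φ from rfl, eisSum_smul]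
  have hzero : P 0 := by
    simpa using hsmul 0 _ (eisSum_slash_residueIndicator hk (0 : ZMod N) 0 γ)
  change P φ
  rw [eq_sum_residueIndicator φ]
  exact Finset.sum_induction _ P hadd hzero fun a _ ↦ Finset.sum_induction _ P hadd hzero
    fun b _ ↦ hsmul _ _ (eisSum_slash_residueIndicator hk a b γ)

end

end EisDecomp

/-! ### Realization of E(χ₁, χ₂, k) as an Eisenstein sum. -/

namespace EisDecomp

open Complex Filter Function
open UpperHalfPlane hiding I
open scoped Real Manifold

noncomputable section

open EisensteinSeries

section scaledChar

variable {M n D : ℕ}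

/-- The function `m ↦ χ(m / D)` on the multiples of `D` modulo `M`, extended by zero. -/
def scaledChar (D : ℕ) (χ : DirichletCharacter ℂ n) (m : ZMod M) : ℂ :=
  shiftCoeff D (fun j ↦ χ (j : ZMod n)) m.val

theorem scaledChar_natCast (hM : D * n = M) (χ : DirichletCharacter ℂ n) (m : ℕ) :
    scaledChar D χ (m : ZMod M) = shiftCoeff D (fun j ↦ χ (j : ZMod n)) m := by
  subst hM
  simp only [scaledChar, shiftCoeff, ZMod.val_natCast]
  simp only [Nat.dvd_mod_iff (dvd_mul_right D n), Nat.mod_mul_right_div_self, ZMod.natCast_mod]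

theorem scaledChar_mul_intCast [NeZero M] (hM : D * n = M) (χ : DirichletCharacter ℂ n) {e : ℤ}
    (he : IsCoprime e M) (m : ZMod M) :
    scaledChar D χ (m * (e : ZMod M)) = χ (e : ZMod n) * scaledChar D χ m := by
  have hD : D ≠ 0 := by rintro rfl; exact NeZero.ne M (by simp [← hM])
  obtain ⟨m, rfl⟩ := ZMod.natCast_zmod_surjective m
  set f := (e : ZMod M).val with hf
  have h1 : (e : ZMod M) = (f : ZMod M) := by simp [hf]
  have h2 : (e : ZMod n) = (f : ZMod n) := by
    have := (ZMod.intCast_eq_intCast_iff_dvd_sub e f M).1 (by simpa using h1)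
    have h3 : (n : ℤ) ∣ M := by rw [← hM]; push_cast; exact dvd_mul_left _ _
    simpa using (ZMod.intCast_eq_intCast_iff_dvd_sub e f n).2 (h3.trans this)
  have h4 : Nat.Coprime D f := by
    have h5 : IsUnit ((f : ℕ) : ZMod M) := by
      rw [← h1]; exact (ZMod.coe_int_isUnit_iff_isCoprime e M).2 he.symm
    have h6 := (ZMod.isUnit_iff_coprime f M).1 h5
    rw [← hM] at h6
    exact (Nat.Coprime.coprime_dvd_right (dvd_mul_right _ _) h6).symm
  rw [h1, h2, ← Nat.cast_mul, scaledChar_natCast hM, scaledChar_natCast hM]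
  unfold shiftCoeff
  by_cases h : D ∣ m
  · obtain ⟨j, rfl⟩ := h
    rw [if_pos (dvd_mul_right _ _), if_pos (by rw [mul_assoc]; exact dvd_mul_right _ _), mul_assoc,
      Nat.mul_div_cancel_left _ (Nat.pos_of_ne_zero hD),
      Nat.mul_div_cancel_left _ (Nat.pos_of_ne_zero hD)]
    push_cast
    rw [map_mul, mul_comm]
  · rw [if_neg h, if_neg (fun h' ↦ h (h4.dvd_of_dvd_mul_right h')), mul_zero]

theorem scaledChar_zero [NeZero M] (D : ℕ) (χ : DirichletCharacter ℂ n) :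
    scaledChar D χ (0 : ZMod M) = χ 0 := by
  simp [scaledChar, shiftCoeff]

theorem exists_of_scaledChar_ne_zero {χ : DirichletCharacter ℂ n} {m : ZMod M}
    [NeZero M] (h : scaledChar D χ m ≠ 0) : ∃ j : ℕ, m = ((D * j : ℕ) : ZMod M) := by
  obtain ⟨j, hj⟩ : D ∣ m.val := by
    by_contra h'
    exact h (if_neg h')
  exact ⟨j, by rw [← hj]; simp⟩

end scaledChar

variable {M N₁ N₂ : ℕ} [NeZero M]

/-- The weight whose `eisSum` is a multiple of `E(χ₁, χ₂, k)`. -/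
def newWeight (χ₁ : DirichletCharacter ℂ N₁) (χ₂ : DirichletCharacter ℂ N₂) (m : ZMod M) :
    ZMod M → ℂ :=
  ZMod.dft fun r ↦ scaledChar N₂ χ₁ m * scaledChar N₁ χ₂ r

theorem dftRight_newWeight (χ₁ : DirichletCharacter ℂ N₁) (χ₂ : DirichletCharacter ℂ N₂)
    (m r : ZMod M) :
    dftRight (newWeight χ₁ χ₂) m r = M * (scaledChar N₂ χ₁ m * scaledChar N₁ χ₂ r) := by
  rw [dftRight, newWeight, ZMod.dft_dft]
  simp

/-- This is equivariance under matrices that are triangular mod M. Substitute r ↦ rα in the Fourier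
sum; the characters contribute χ₁(α)χ₂(α), and the term containing β drops out by the support of the
weight. -/
theorem newWeight_mul (hM : N₁ * N₂ = M) (χ₁ : DirichletCharacter ℂ N₁)
    (χ₂ : DirichletCharacter ℂ N₂) {α δ : ℤ} (hα : ((α * δ : ℤ) : ZMod M) = 1)
    (m b β : ZMod M) :
    newWeight χ₁ χ₂ (m * (α : ZMod M)) (m * β + b * (δ : ZMod M)) =
      χ₁ (α : ZMod N₁) * χ₂ (α : ZMod N₂) * newWeight χ₁ χ₂ m b := by
  have hαδ : (α : ZMod M) * δ = 1 := by exact_mod_cast hα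
  have hco : IsCoprime α (M : ℤ) :=
    ((ZMod.coe_int_isUnit_iff_isCoprime α M).1 (IsUnit.of_mul_eq_one _ hαδ)).symm
  have hM' : N₂ * N₁ = M := by rw [mul_comm, hM]
  rw [newWeight, newWeight, ZMod.dft_apply, ZMod.dft_apply, Finset.mul_sum]
  let e : ZMod M ≃ ZMod M := ⟨fun r ↦ r * α, fun r ↦ r * δ,
    fun r ↦ by simp only; rw [mul_assoc, hαδ, mul_one],
    fun r ↦ by simp only; rw [mul_assoc, mul_comm (δ : ZMod M), hαδ, mul_one]⟩
  rw [← e.sum_comp]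
  refine Finset.sum_congr rfl fun r _ ↦ ?_
  simp only [e, Equiv.coe_fn_mk, smul_eq_mul]
  rw [scaledChar_mul_intCast hM' _ hco, scaledChar_mul_intCast hM _ hco]
  by_cases h : scaledChar N₂ χ₁ m * scaledChar N₁ χ₂ r = 0
  · rw [mul_mul_mul_comm, h]; simp
  · obtain ⟨i, hi⟩ := exists_of_scaledChar_ne_zero (left_ne_zero_of_mul h)
    obtain ⟨j, hj⟩ := exists_of_scaledChar_ne_zero (right_ne_zero_of_mul h)
    -- On the support, m is a multiple of N₂ and r one of N₁, so rm ≡ 0 modulo N₁N₂ = M.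
    have hmr : r * m = 0 := by
      rw [hi, hj, ← Nat.cast_mul, show N₁ * j * (N₂ * i) = N₁ * N₂ * (i * j) by ring, hM]
      simp
    have : -(r * α * (m * β + b * δ)) = -(r * b) := by
      linear_combination (-α * β) * hmr - r * b * hαδ
    rw [this]
    ring

theorem slashWeight_newWeight (hM : N₁ * N₂ = M) (χ₁ : DirichletCharacter ℂ N₁)
    (χ₂ : DirichletCharacter ℂ N₂) {γ : SL(2, ℤ)} (hγ : γ ∈ CongruenceSubgroup.Gamma0 M) :
    slashWeight (N := M) γ (newWeight χ₁ χ₂) =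
      (χ₁ ((γ 1 1 : ℤ) : ZMod N₁) * χ₂ ((γ 1 1 : ℤ) : ZMod N₂)) • newWeight χ₁ χ₂ := by
  rw [CongruenceSubgroup.Gamma0_mem] at hγ
  have hdet : ((γ 1 1 * γ 0 0 : ℤ) : ZMod M) = 1 := by
    have := γ.det_coe
    rw [Matrix.det_fin_two] at this
    have h2 := congrArg (Int.cast : ℤ → ZMod M) this
    push_cast at h2 ⊢
    rw [hγ] at h2
    linear_combination h2
  ext c d
  rw [slashWeight, hγ, mul_zero, sub_zero, Pi.smul_apply, Pi.smul_apply, smul_eq_mul,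
    ← newWeight_mul hM χ₁ χ₂ hdet c d (-(γ 0 1 : ℤ))]
  congr 1
  ring

/-- The ratio of `eisSum k (newWeight χ₁ χ₂)` and `E(χ₁, χ₂, k)`. -/
def newFactor (k M N₁ : ℕ) : ℂ :=
  lipschitzFactor k / (M : ℂ) ^ k * (2 * M * (N₁ : ℂ) ^ (k - 1))

theorem newFactor_ne_zero (k : ℕ) {M N₁ : ℕ} (hM : M ≠ 0) (hN : N₁ ≠ 0) :
    newFactor k M N₁ ≠ 0 := by
  unfold newFactor
  have hM' : (M : ℂ) ≠ 0 := Nat.cast_ne_zero.2 hM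
  have hN' : (N₁ : ℂ) ≠ 0 := Nat.cast_ne_zero.2 hN
  exact mul_ne_zero (div_ne_zero (lipschitzFactor_ne_zero k) (pow_ne_zero _ hM'))
    (mul_ne_zero (mul_ne_zero two_ne_zero hM') (pow_ne_zero _ hN'))

/-- The constants in `newFactor` arise here: 2 because by parity the weight equals its signed
reflection, M from the double Fourier transform, N₁^(k-1) from r = N₁r'. The remaining shift by N₂N₁
= M disappears at the index Mn. -/
theorem eisSumCoeff_newWeight (hM : N₁ * N₂ = M) {k : ℕ} {χ₁ : DirichletCharacter ℂ N₁}
    {χ₂ : DirichletCharacter ℂ N₂} (hpar : χ₁ (-1) * χ₂ (-1) = (-1) ^ k) {n : ℕ} (hn : n ≠ 0) :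
    eisSumCoeff (N := M) k (newWeight χ₁ χ₂) (M * n) =
      newFactor k M N₁ * sigmaChar χ₁ χ₂ k n := by
  have hM0 := NeZero.ne M
  have h1 : N₁ ≠ 0 := by rintro rfl; exact hM0 (by simp [← hM])
  have h2 : N₂ ≠ 0 := by rintro rfl; exact hM0 (by simp [← hM])
  have hM' : N₂ * N₁ = M := by rw [mul_comm, hM]
  have hc : IsCoprime (-1 : ℤ) (M : ℤ) := isCoprime_one_left.neg_left
  rw [eisSumCoeff, if_neg (mul_ne_zero hM0 hn)]
  have h3 : convSum k (fun m r ↦ dftRight (newWeight (M := M) χ₁ χ₂) m r +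
      (-1) ^ k * dftRight (newWeight (M := M) χ₁ χ₂) (-m) (-r)) =
      (2 * M : ℂ) • (N₁ : ℂ) ^ (k - 1) • shiftCoeff (N₂ * N₁) (sigmaChar χ₁ χ₂ k) := by
    rw [sigmaChar_eq_convSum, ← convSum_shiftCoeff h2 h1, ← convSum_smul]
    congr 1
    ext m r
    have hm := scaledChar_mul_intCast hM' χ₁ hc (m : ZMod M)
    have hr := scaledChar_mul_intCast hM χ₂ hc (r : ZMod M)
    simp only [Int.cast_neg, Int.cast_one, mul_neg, mul_one] at hm hr
    rw [dftRight_newWeight, dftRight_newWeight, hm, hr, scaledChar_natCast hM',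
      scaledChar_natCast hM]
    have hsq : ((-1 : ℂ) ^ k) * (-1) ^ k = 1 := by rw [← mul_pow]; simp
    linear_combination M * shiftCoeff N₂ (fun j ↦ χ₁ (j : ZMod N₁)) m *
      shiftCoeff N₁ (fun j ↦ χ₂ (j : ZMod N₂)) r * ((-1) ^ k * hpar + hsq)
  rw [h3, newFactor, Pi.smul_apply, Pi.smul_apply, hM', shiftCoeff_mul hM0, smul_eq_mul, smul_eq_mul]
  ring

/-- The left side is twice the L-function of the Fourier transform of χ at k, because parity makes
the summand even in d. The functional equation converts it to L(1-k, χ). -/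
theorem tsum_dft_char {n : ℕ} [NeZero n] {k : ℕ} (hk : 2 ≤ k) {χ : DirichletCharacter ℂ n}
    (hpar : χ (-1) = (-1) ^ k) :
    ∑' d : ℤ, ZMod.dft χ (d : ZMod n) * ((d : ℂ) ^ k)⁻¹ =
      lipschitzFactor k / (n : ℂ) ^ k * n * DirichletCharacter.LFunction χ (1 - k) := by
  have hk1 : 1 < (k : ℂ).re := by rw [natCast_re]; exact_mod_cast hk
  have hk0 : k ≠ 0 := by omega
  have hn : (n : ℂ) ≠ 0 := Nat.cast_ne_zero.2 (NeZero.ne n)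
  have hneg : (fun x : ZMod n ↦ χ (-x)) = (-1 : ℂ) ^ k • χ := by
    ext x
    rw [neg_eq_neg_one_mul, map_mul, hpar]
    rfl
  have hdneg : ∀ x : ZMod n, ZMod.dft χ (-x) = (-1) ^ k * ZMod.dft χ x := by
    intro x
    rw [← dft_comp_neg_apply, hneg, map_smul]
    rfl
  have hs : Summable fun d : ℤ ↦ ZMod.dft χ (d : ZMod n) * ((d : ℂ) ^ k)⁻¹ := by
    have := summable_mul_of_summable (ZMod.dft χ) (summable_linear_inv hk 0 0)
    simpa using this
  have hL : ∑' d : ℤ, ZMod.dft χ (d : ZMod n) * ((d : ℂ) ^ k)⁻¹ =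
      2 * ZMod.LFunction (ZMod.dft χ) k := by
    rw [ZMod.LFunction_eq_LSeries _ hk1, LSeries]
    have heven : (fun d : ℤ ↦ ZMod.dft χ (d : ZMod n) * ((d : ℂ) ^ k)⁻¹).Even := by
      intro d
      simp only
      push_cast
      rw [hdneg, neg_pow (d : ℂ), mul_inv, ← inv_pow, inv_neg_one]
      have hsq : ((-1 : ℂ) ^ k) * (-1) ^ k = 1 := by rw [← mul_pow]; simp
      linear_combination (ZMod.dft χ (d : ZMod n) * ((d : ℂ) ^ k)⁻¹) * hsq
    rw [tsum_int_eq_zero_add_two_mul_tsum_pnat heven hs]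
    simp only [Int.cast_zero, zero_pow hk0, inv_zero, mul_zero, zero_add]
    rw [two_nsmul, ← two_mul]
    congr 1
    refine Eq.trans ?_ (PNat.coe_injective.tsum_eq (f := LSeries.term _ (k : ℂ)) ?_)
    · refine tsum_congr fun d ↦ ?_
      rw [LSeries.term_of_ne_zero d.ne_zero, cpow_natCast, div_eq_mul_inv]
      simp
    · intro d hd
      rcases Nat.eq_zero_or_pos d with rfl | h
      · simp at hd
      · exact ⟨⟨d, h⟩, rfl⟩
  -- The side conditions of the functional equation: k is not a non-positive integer, and k ≠ 1.
  have hfe := ZMod.LFunction_one_sub χ (s := k) (fun m h ↦ by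
    have := congrArg Complex.re h
    simp only [natCast_re, neg_re] at this
    have h2 : (0 : ℝ) < k := by exact_mod_cast Nat.pos_of_ne_zero hk0
    linarith [Nat.cast_nonneg (α := ℝ) m]) (Or.inr (by
      intro h; rw [h] at hk1; simp at hk1))
  have hI : cexp (π * I * k / 2) = I ^ k := by
    rw [show π * I * k / 2 = k * (π / 2 * I) by ring, Complex.exp_nat_mul, exp_pi_div_two_mul_I]
  have hI' : cexp (-π * I * k / 2) = (-I) ^ k := by
    rw [show -π * I * k / 2 = k * (-π / 2 * I) by ring, Complex.exp_nat_mul,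
      exp_neg_pi_div_two_mul_I]
  have hLs : ZMod.LFunction (ZMod.dft fun x : ZMod n ↦ χ (-x)) k =
      (-1) ^ k * ZMod.LFunction (ZMod.dft χ) k := by
    rw [hneg, map_smul]
    simp only [ZMod.LFunction, Pi.smul_apply, smul_eq_mul, mul_assoc, Finset.mul_sum]
    exact Finset.sum_congr rfl fun x _ ↦ by ring
  have hG : Complex.Gamma k = ((k - 1).factorial : ℂ) := by
    rw [← Complex.Gamma_nat_eq_factorial]
    congr 1
    push_cast [Nat.cast_sub (by omega : 1 ≤ k)]
    ring
  have hπ : (2 * π : ℂ) ≠ 0 := by simp [Real.pi_ne_zero]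
  rw [hI, hI', hLs, hG, cpow_sub _ _ hn, cpow_natCast, cpow_one, cpow_neg, cpow_natCast] at hfe
  change DirichletCharacter.LFunction χ (1 - k) = _ at hfe
  have hf : ((k - 1).factorial : ℂ) ≠ 0 := by exact_mod_cast Nat.factorial_ne_zero _
  rw [hL, hfe, lipschitzFactor, neg_pow I, show -2 * π * I = (2 * π) * (-1 * I) by ring, mul_pow,
    mul_pow (-1 : ℂ)]
  have hsq : ((-1 : ℂ) ^ k) * (-1) ^ k = 1 := by rw [← mul_pow]; simp
  have hII : ((-1 : ℂ) ^ k) * (I ^ k) * I ^ k = 1 := by rw [← mul_pow, ← mul_pow]; simp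
  field_simp
  linear_combination (-2 * ZMod.LFunction (ZMod.dft χ) k) * hII -
    ((-1) ^ k * I ^ k * I ^ k) * ZMod.LFunction (ZMod.dft χ) k * hsq

/-- The constant term of `E(χ₁, χ₂, k)`. -/
def constTerm [NeZero N₂] (χ₁ : DirichletCharacter ℂ N₁) (χ₂ : DirichletCharacter ℂ N₂) (k : ℕ) :
    ℂ :=
  open Classical in (if χ₁ = 1 then 1 else 0) / 2 * DirichletCharacter.LFunction χ₂ (1 - (k : ℂ))

/-- The Fourier coefficients of `E(χ₁, χ₂, k)`. -/
def newCoeff [NeZero N₂] (χ₁ : DirichletCharacter ℂ N₁) (χ₂ : DirichletCharacter ℂ N₂) (k n : ℕ) :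
    ℂ :=
  if n = 0 then constTerm χ₁ χ₂ k else sigmaChar χ₁ χ₂ k n

omit [NeZero M] in
theorem norm_sigmaChar_le (χ₁ : DirichletCharacter ℂ N₁) (χ₂ : DirichletCharacter ℂ N₂) {k : ℕ}
    (hk : 1 ≤ k) (n : ℕ) : ‖sigmaChar χ₁ χ₂ k n‖ ≤ (n : ℝ) ^ k := by
  refine (norm_sum_le _ _).trans ?_
  have h1 : ∀ d ∈ n.divisors, ‖χ₁ ((n / d : ℕ) : ZMod N₁) * χ₂ (d : ZMod N₂) *
      (d : ℂ) ^ (k - 1)‖ ≤ (n : ℝ) ^ (k - 1) := by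
    intro d hd
    rw [norm_mul, norm_mul, norm_pow, Complex.norm_natCast]
    have hdn : (d : ℝ) ≤ n := by exact_mod_cast Nat.divisor_le hd
    calc _ ≤ 1 * 1 * (n : ℝ) ^ (k - 1) := by
          gcongr
          · exact DirichletCharacter.norm_le_one _ _
          · exact DirichletCharacter.norm_le_one _ _
      _ = _ := by ring
  refine (Finset.sum_le_card_nsmul _ _ _ h1).trans ?_
  rw [nsmul_eq_mul]
  have : (n.divisors.card : ℝ) ≤ n := by exact_mod_cast Nat.card_divisors_le_self n
  calc _ ≤ (n : ℝ) * (n : ℝ) ^ (k - 1) := by gcongr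
    _ = (n : ℝ) ^ k := by rw [← pow_succ', Nat.sub_add_cancel hk]

omit [NeZero M] in
theorem sigmaChar_zero (χ₁ : DirichletCharacter ℂ N₁) (χ₂ : DirichletCharacter ℂ N₂) (k : ℕ) :
    sigmaChar χ₁ χ₂ k 0 = 0 := by
  simp [sigmaChar]

omit [NeZero M] in
theorem hasQSeries_eisensteinE [NeZero N₂] (χ₁ : DirichletCharacter ℂ N₁)
    (χ₂ : DirichletCharacter ℂ N₂) {k : ℕ} (hk : 1 ≤ k) :
    HasQSeries 1 (eisensteinE χ₁ χ₂ k) (newCoeff χ₁ χ₂ k) := by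
  have h1 := hasQSeries_of_norm_le (h := 1) one_pos (a := sigmaChar χ₁ χ₂ k) (C := 1) (m := k)
    fun n ↦ by rw [one_mul]; exact norm_sigmaChar_le χ₁ χ₂ hk n
  have h2 := (HasQSeries.const (h := 1) (constTerm χ₁ χ₂ k)).add h1
  convert! h2 using 1
  · ext z
    rw [eisensteinE, Pi.add_apply, constTerm]
    congr 1
    rw [← PNat.coe_injective.tsum_eq]
    · refine tsum_congr fun n ↦ ?_
      rw [qParam_one_pow]
    · intro d hd
      rcases Nat.eq_zero_or_pos d with rfl | h
      · simp [sigmaChar_zero] at hd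
      · exact ⟨⟨d, h⟩, rfl⟩
  · ext n
    rcases eq_or_ne n 0 with rfl | hn
    · simp [newCoeff, sigmaChar_zero]
    · simp [newCoeff, hn]

theorem vadd_one_of_slash_T {k : ℕ} {f : ℍ → ℂ} (hf : f ∣[(k : ℤ)] ModularGroup.T = f) (z : ℍ) :
    f ((1 : ℝ) +ᵥ z) = f z := by
  rw [← congrFun hf z, ModularForm.SL_slash_apply, UpperHalfPlane.modular_T_smul]
  rw [ModularGroup.denom_apply]
  simp [ModularGroup.T]

theorem hasQSeries_one_eisSum {k : ℕ} (hk : 2 ≤ k) {φ : ZMod M → ZMod M → ℂ}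
    (hφ : slashWeight ModularGroup.T φ = φ) :
    HasQSeries 1 (eisSum k φ) (fun n ↦ eisSumCoeff k φ (M * n)) := by
  refine (hasQSeries_eisSum hk φ).of_width (NeZero.ne M) (vadd_one_of_slash_T (k := k) ?_)
  rw [eisSum_slash hk, hφ, D2_T, smul_zero, sub_zero]

theorem T_mem_Gamma0 (M : ℕ) : ModularGroup.T ∈ CongruenceSubgroup.Gamma0 M := by
  rw [CongruenceSubgroup.Gamma0_mem]
  simp [ModularGroup.T]

/-- Only the row m = 0 of the weight matters, and it carries the factor χ₁(0), which is nonzero only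
for N₁ = 1. For primitive χ₁ this is the same as χ₁ being principal, and then the row is the Fourier
transform of χ₂. -/
theorem eisSumCoeff_newWeight_zero [NeZero N₂] (hM : N₁ * N₂ = M) {k : ℕ} (hk : 2 ≤ k)
    {χ₁ : DirichletCharacter ℂ N₁}
    {χ₂ : DirichletCharacter ℂ N₂} (hχ₁ : χ₁.IsPrimitive) (hpar : χ₁ (-1) * χ₂ (-1) = (-1) ^ k) :
    eisSumCoeff (N := M) k (newWeight χ₁ χ₂) 0 = newFactor k M N₁ * constTerm χ₁ χ₂ k := by
  have hM0 := NeZero.ne M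
  have h1 : N₁ ≠ 0 := by rintro rfl; exact hM0 (by simp [← hM])
  have : NeZero N₁ := ⟨h1⟩
  rw [eisSumCoeff, if_pos rfl]
  rcases eq_or_ne N₁ 1 with rfl | hN₁
  · obtain rfl : N₂ = M := by simpa using hM
    have hχ : χ₁ = 1 := Subsingleton.elim _ _
    subst hχ
    have hw : newWeight (M := N₂) (1 : DirichletCharacter ℂ 1) χ₂ 0 = ZMod.dft χ₂ := by
      rw [newWeight]
      congr 1
      ext r
      rw [scaledChar_zero, scaledChar, shiftCoeff, if_pos (one_dvd _), Nat.div_one,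
        Subsingleton.elim (0 : ZMod 1) 1, map_one]
      simp
    have hp : χ₂ (-1) = (-1) ^ k := by
      rwa [Subsingleton.elim (-1 : ZMod 1) 1, map_one, one_mul] at hpar
    rw [hw, tsum_dft_char hk hp, newFactor, constTerm, if_pos rfl]
    simp
    ring
  · have hχ : χ₁ ≠ 1 := by
      rintro rfl
      rw [DirichletCharacter.isPrimitive_def, DirichletCharacter.conductor_one] at hχ₁
      exact hN₁ hχ₁.symm
    have : Nontrivial (ZMod N₁) := ZMod.nontrivial_iff.2 hN₁
    have hw : newWeight (M := M) χ₁ χ₂ 0 = 0 := by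
      rw [newWeight]
      simp only [scaledChar_zero, MulChar.map_zero, zero_mul]
      exact map_zero _
    simp [hw, constTerm, hχ]

theorem eisSum_newWeight [NeZero N₂] (hM : N₁ * N₂ = M) {k : ℕ} (hk : 2 ≤ k)
    {χ₁ : DirichletCharacter ℂ N₁}
    {χ₂ : DirichletCharacter ℂ N₂} (hχ₁ : χ₁.IsPrimitive) (hpar : χ₁ (-1) * χ₂ (-1) = (-1) ^ k) :
    eisSum k (newWeight (M := M) χ₁ χ₂) = newFactor k M N₁ • eisensteinE χ₁ χ₂ k := by
  have h1 := hasQSeries_one_eisSum hk (φ := newWeight (M := M) χ₁ χ₂) (by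
    rw [slashWeight_newWeight hM χ₁ χ₂ (T_mem_Gamma0 M)]
    simp [ModularGroup.T])
  have h2 := (hasQSeries_eisensteinE χ₁ χ₂ (by omega : 1 ≤ k)).smul (newFactor k M N₁)
  refine h1.ext ?_
  convert! h2 using 1
  ext n
  rcases eq_or_ne n 0 with rfl | hn
  · simp [newCoeff, eisSumCoeff_newWeight_zero hM hk hχ₁ hpar]
  · simp [newCoeff, hn, eisSumCoeff_newWeight hM hpar hn]

/-- Summing over b evaluates the inner function at 0 and leaves M χ₁(a/N₂) χ₂(0), which vanishes
unless N₂ = 1; then χ₁ is nontrivial and its values sum to zero. So E(1, 1, 2) is the only newform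
that is not modular. -/
theorem sum_newWeight (hM : N₁ * N₂ = M) (χ₁ : DirichletCharacter ℂ N₁)
    (χ₂ : DirichletCharacter ℂ N₂) (hχ₁ : χ₁.IsPrimitive) (hM1 : M ≠ 1) :
    ∑ a : ZMod M, ∑ b : ZMod M, newWeight χ₁ χ₂ a b = 0 := by
  have hM0 := NeZero.ne M
  have h1 : NeZero N₁ := ⟨by rintro rfl; exact hM0 (by simp [← hM])⟩
  have h2 : N₂ ≠ 0 := by rintro rfl; exact hM0 (by simp [← hM])
  have h3 : ∀ a : ZMod M, ∑ b : ZMod M, newWeight χ₁ χ₂ a b =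
      M * (scaledChar N₂ χ₁ a * χ₂ 0) := by
    intro a
    rw [← ZMod.dft_apply_zero, ← scaledChar_zero (M := M) N₁ χ₂]
    have := dftRight_newWeight χ₁ χ₂ a (0 : ZMod M)
    rwa [dftRight, neg_zero] at this
  simp_rw [h3]
  rcases eq_or_ne N₂ 1 with rfl | hN₂
  · obtain rfl : N₁ = M := by simpa using hM
    have hχ : χ₁ ≠ 1 := by
      rintro rfl
      rw [DirichletCharacter.isPrimitive_def, DirichletCharacter.conductor_one] at hχ₁
      exact hM1 hχ₁.symm
    have h4 : ∀ a : ZMod N₁, scaledChar 1 χ₁ a = χ₁ a := fun a ↦ by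
      simp [scaledChar, shiftCoeff]
    rw [← Finset.mul_sum, ← Finset.sum_mul, Finset.sum_congr rfl fun a _ ↦ h4 a,
      MulChar.sum_eq_zero_of_ne_one hχ]
    simp
  · have : Nontrivial (ZMod N₂) := ZMod.nontrivial_iff.2 hN₂
    have h0 : χ₂ 0 = 0 := MulChar.map_zero χ₂
    simp [h0]

/-- The multiple of `D2 γ` by which `E(χ₁, χ₂, k)`, of level `M`, fails to be modular. -/
def newQuasi (k M : ℕ) : ℂ :=
  if k = 2 ∧ M = 1 then
    (newFactor 2 1 1)⁻¹ * quasiFactor (N := 1) 2 (newWeight (M := 1)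
      (1 : DirichletCharacter ℂ 1) (1 : DirichletCharacter ℂ 1)) else 0

theorem eisensteinE_slash [NeZero N₂] (hM : N₁ * N₂ = M) {k : ℕ} (hk : 2 ≤ k)
    {χ₁ : DirichletCharacter ℂ N₁}
    {χ₂ : DirichletCharacter ℂ N₂} (hχ₁ : χ₁.IsPrimitive) (hpar : χ₁ (-1) * χ₂ (-1) = (-1) ^ k)
    {γ : SL(2, ℤ)} (hγ : γ ∈ CongruenceSubgroup.Gamma0 M) :
    eisensteinE χ₁ χ₂ k ∣[(k : ℤ)] γ =
      (χ₁ ((γ 1 1 : ℤ) : ZMod N₁) * χ₂ ((γ 1 1 : ℤ) : ZMod N₂)) • eisensteinE χ₁ χ₂ k -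
        newQuasi k M • D2 γ := by
  have hM0 := NeZero.ne M
  have h1 : N₁ ≠ 0 := by rintro rfl; exact hM0 (by simp [← hM])
  have hc := newFactor_ne_zero k hM0 h1
  have h2 := eisSum_newWeight hM hk hχ₁ hpar
  have h3 := eisSum_slash hk (newWeight (M := M) χ₁ χ₂) γ
  rw [slashWeight_newWeight hM χ₁ χ₂ hγ, eisSum_smul, h2, ModularForm.SL_smul_slash] at h3
  have h4 : quasiFactor k (newWeight (M := M) χ₁ χ₂) = newFactor k M N₁ * newQuasi k M := by
    rw [newQuasi]
    split_ifs with h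
    · obtain ⟨rfl, rfl⟩ := h
      obtain rfl : N₁ = 1 := Nat.eq_one_of_mul_eq_one_right hM
      obtain rfl : N₂ = 1 := Nat.eq_one_of_mul_eq_one_left hM
      obtain rfl : χ₁ = 1 := Subsingleton.elim _ _
      obtain rfl : χ₂ = 1 := Subsingleton.elim _ _
      rw [mul_inv_cancel_left₀ hc]
    · rw [mul_zero, quasiFactor]
      split_ifs with hk2
      · rw [sum_newWeight hM χ₁ χ₂ hχ₁ (fun h' ↦ h ⟨hk2, h'⟩), mul_zero]
      · rfl
  have h5 := congrArg ((newFactor k M N₁)⁻¹ • ·) h3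
  simp only [smul_sub, h4, smul_smul] at h5
  rw [inv_mul_cancel₀ hc, one_smul, inv_mul_cancel_left₀ hc, mul_comm (χ₁ _ * _),
    inv_mul_cancel_left₀ hc] at h5
  exact h5

end

end EisDecomp

/-! ### Newforms as modular forms, and the shift operators. -/

namespace EisDecomp

open Complex Filter Function
open UpperHalfPlane hiding I
open scoped Real Manifold

noncomputable section

open EisensteinSeries CongruenceSubgroup

/-- Boundedness at every cusp comes for free: each translate by SL(2, ℤ) is again the Eisenstein sum
of a weight, and so has an expansion without negative exponents. -/
theorem exists_modularForm {M k : ℕ} [NeZero M] (hk : 2 ≤ k) {φ : ZMod M → ZMod M → ℂ}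
    (h0 : quasiFactor k φ = 0) (hφ : ∀ γ ∈ Gamma1 M, slashWeight γ φ = φ) :
    ∃ F : ModularForm ((Gamma1 M).map (Matrix.SpecialLinearGroup.mapGL ℝ)) k,
      ⇑F = eisSum k φ := by
  have hslash : ∀ γ : SL(2, ℤ), eisSum k φ ∣[(k : ℤ)] γ = eisSum k (slashWeight γ φ) := fun γ ↦ by
    rw [eisSum_slash hk, h0, zero_smul, sub_zero]
  have hM : 0 < (M : ℝ) := Nat.cast_pos.2 (Nat.pos_of_ne_zero (NeZero.ne M))
  refine ⟨{ toFun := eisSum k φ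
            slash_action_eq' := ?_
            holo' := (hasQSeries_eisSum hk φ).mdifferentiable hM
            bdd_at_cusps' := ?_ }, rfl⟩
  · rintro A ⟨A, hA, rfl⟩
    have := hslash A
    rw [hφ A hA] at this
    simpa [Matrix.SpecialLinearGroup.mapGL, ← ModularForm.SL_slash] using this
  · intro c hc
    rw [Subgroup.IsArithmetic.isCusp_iff_isCusp_SL2Z] at hc
    rw [OnePoint.isBoundedAt_iff_forall_SL2Z hc]
    intro γ _
    have := (hasQSeries_eisSum hk (slashWeight γ φ)).isBoundedAtImInfty hM
    rw [← hslash γ] at this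
    exact this

theorem isCoprime_of_mem_Gamma0 {M : ℕ} {γ : SL(2, ℤ)} (hγ : γ ∈ Gamma0 M) :
    IsCoprime (γ 1 1) (M : ℤ) := by
  rw [Gamma0_mem] at hγ
  have := γ.det_coe
  rw [Matrix.det_fin_two] at this
  have h2 := congrArg (Int.cast : ℤ → ZMod M) this
  push_cast at h2
  rw [hγ, mul_zero, sub_zero] at h2
  exact ((ZMod.coe_int_isUnit_iff_isCoprime _ M).1 (IsUnit.of_mul_eq_one_right _ h2)).symm

theorem isEisensteinNewform {M N₁ N₂ k : ℕ} [NeZero M] [NeZero N₂] (hM : N₁ * N₂ = M)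
    (hk : 2 ≤ k) {χ₁ : DirichletCharacter ℂ N₁} {χ₂ : DirichletCharacter ℂ N₂}
    (hχ₁ : χ₁.IsPrimitive) (hχ₂ : χ₂.IsPrimitive) (hpar : χ₁ (-1) * χ₂ (-1) = (-1) ^ k)
    (h₁ : N₁ ∣ M) (h₂ : N₂ ∣ M) :
    IsEisensteinNewform k (DirichletCharacter.changeLevel h₁ χ₁ *
      DirichletCharacter.changeLevel h₂ χ₂) (eisensteinE χ₁ χ₂ k) := by
  refine ⟨⟨N₁, N₂, inferInstance, h₁, h₂, χ₁, χ₂, hM, hχ₁, hχ₂, rfl, rfl⟩, ?_⟩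
  by_cases h : k = 2 ∧ M = 1
  · exact Or.inr h
  refine Or.inl ?_
  have hM0 := NeZero.ne M
  have h1 : N₁ ≠ 0 := by rintro rfl; exact hM0 (by simp [← hM])
  have hc := newFactor_ne_zero k hM0 h1
  have h2 := eisSum_newWeight hM hk hχ₁ hpar
  have hq : quasiFactor k (newWeight (M := M) χ₁ χ₂) = 0 := by
    rw [quasiFactor]
    split_ifs with hk2
    · rw [sum_newWeight hM χ₁ χ₂ hχ₁ (fun h' ↦ h ⟨hk2, h'⟩), mul_zero]
    · rfl
  obtain ⟨F, hF⟩ := exists_modularForm hk hq fun γ hγ ↦ by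
    rw [slashWeight_newWeight hM χ₁ χ₂ (Gamma1_in_Gamma0 M hγ)]
    have h3 := ((Gamma1_mem M γ).1 hγ).2.1
    have h4 : ∀ n : ℕ, n ∣ M → ((γ 1 1 : ℤ) : ZMod n) = 1 := by
      intro n hn
      have := congrArg (ZMod.castHom hn (ZMod n)) h3
      simpa only [map_intCast, map_one] using this
    rw [h4 _ h₁, h4 _ h₂, map_one, map_one, one_mul, one_smul]
  rw [h2] at hF
  refine ⟨(newFactor k M N₁)⁻¹ • F, ⟨?_, ?_⟩, ?_⟩
  · intro γ hγ
    rw [FunLike.coe_smul, hF, inv_smul_smul₀ hc, eisensteinE_slash hM hk hχ₁ hpar hγ, newQuasi,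
      if_neg h, zero_smul, sub_zero]
    congr 1
    have hco := isCoprime_of_mem_Gamma0 hγ
    rw [MulChar.mul_apply, DirichletCharacter.changeLevel_eq_cast_of_dvd' _ _ hco,
      DirichletCharacter.changeLevel_eq_cast_of_dvd' _ _ hco]
  · rw [FunLike.coe_smul, hF, inv_smul_smul₀ hc, span_eisensteinG hk]
    refine ⟨(newFactor k M N₁)⁻¹ • newWeight χ₁ χ₂, ?_⟩
    rw [map_smul]
    change _ • eisSum k (newWeight χ₁ χ₂) = _
    rw [h2, inv_smul_smul₀ hc]
  · rw [FunLike.coe_smul, hF, inv_smul_smul₀ hc]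

/-- Here γ' is the conjugate of γ by diag(d, 1), and the two automorphy factors agree at z and dz.
-/
theorem shift_slash {d : ℕ} (hd : d ≠ 0) (k : ℕ) (f : ℍ → ℂ) {γ γ' : SL(2, ℤ)}
    (h00 : γ' 0 0 = γ 0 0) (h01 : γ' 0 1 = d * γ 0 1) (h10 : d * γ' 1 0 = γ 1 0)
    (h11 : γ' 1 1 = γ 1 1) :
    shift d f ∣[(k : ℤ)] γ = shift d (f ∣[(k : ℤ)] γ') := by
  ext z
  have hd' : (d : ℂ) ≠ 0 := Nat.cast_ne_zero.2 hd
  have him : ∀ z : ℍ, 0 < ((d : ℂ) * z).im := fun z ↦ by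
    rw [Complex.mul_im, Complex.natCast_im, Complex.natCast_re, zero_mul, add_zero]
    exact mul_pos (Nat.cast_pos.2 (Nat.pos_of_ne_zero hd)) z.im_pos
  have h10' : (γ 1 0 : ℂ) = d * (γ' 1 0 : ℂ) := by rw [← h10]; push_cast; rfl
  rw [ModularForm.SL_slash_apply, shift, shift, ModularForm.SL_slash_apply,
    ofComplex_apply_of_im_pos (him _), ofComplex_apply_of_im_pos (him z)]
  have hden : denom γ z = denom γ' (⟨(d : ℂ) * z, him z⟩ : ℍ) := by
    rw [ModularGroup.denom_apply, ModularGroup.denom_apply, h11, h10']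
    simp only
    ring
  have hden0 := denom_ne_zero γ z
  congr 1
  · congr 1
    ext1
    change (d : ℂ) * ((γ • z : ℍ) : ℂ) = ((γ' • (⟨(d : ℂ) * z, him z⟩ : ℍ) : ℍ) : ℂ)
    rw [coe_specialLinearGroup_apply, coe_specialLinearGroup_apply, h00, h01, h11, ← h10]
    simp only [eq_intCast, Int.cast_mul, Int.cast_natCast, ofReal_mul, ofReal_natCast,
      ofReal_intCast]
    rw [mul_div_assoc']
    congr 1 <;> ring
  · rw [hden]

theorem exists_conj_mem_Gamma0 {M d : ℕ} {γ : SL(2, ℤ)} (hγ : γ ∈ Gamma0 (M * d)) :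
    ∃ γ' ∈ Gamma0 M, γ' 0 0 = γ 0 0 ∧ γ' 0 1 = d * γ 0 1 ∧ d * γ' 1 0 = γ 1 0 ∧
      γ' 1 1 = γ 1 1 := by
  rw [Gamma0_mem, ZMod.intCast_zmod_eq_zero_iff_dvd] at hγ
  obtain ⟨c, hc⟩ := hγ
  have hdet := γ.det_coe
  rw [Matrix.det_fin_two] at hdet
  have hdet' : Matrix.det !![γ 0 0, d * γ 0 1; M * c, γ 1 1] = 1 := by
    rw [Matrix.det_fin_two_of]
    refine Eq.trans ?_ hdet
    rw [hc]
    push_cast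
    ring
  refine ⟨⟨_, hdet'⟩, Gamma0_mem.2 (?_ : ((M * c : ℤ) : ZMod M) = 0), rfl, rfl,
    (?_ : (d : ℤ) * (M * c) = _), rfl⟩
  · simp
  · refine Eq.trans ?_ hc.symm
    push_cast
    ring

theorem shift_D2 {d : ℕ} (hd : d ≠ 0) {γ γ' : SL(2, ℤ)} (h10 : d * γ' 1 0 = γ 1 0)
    (h11 : γ' 1 1 = γ 1 1) : shift d (D2 γ') = (d : ℂ)⁻¹ • D2 γ := by
  ext z
  have hd' : (d : ℂ) ≠ 0 := Nat.cast_ne_zero.2 hd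
  have him : 0 < ((d : ℂ) * z).im := by
    rw [Complex.mul_im, Complex.natCast_im, Complex.natCast_re, zero_mul, add_zero]
    exact mul_pos (Nat.cast_pos.2 (Nat.pos_of_ne_zero hd)) z.im_pos
  have h10' : (γ 1 0 : ℂ) = d * (γ' 1 0 : ℂ) := by rw [← h10]; push_cast; rfl
  rw [shift, ofComplex_apply_of_im_pos him, Pi.smul_apply, D2, D2, h10']
  have hden : denom γ' ((⟨(d : ℂ) * z, him⟩ : ℍ) : ℂ) = denom γ z := by
    rw [ModularGroup.denom_apply, ModularGroup.denom_apply, h11, h10']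
    simp only
    ring
  rw [hden, smul_eq_mul]
  field_simp

end

end EisDecomp

/-! ### Decomposition of an Eisenstein form into shifted newforms. -/

namespace EisDecomp

open Complex Filter Function
open UpperHalfPlane hiding I
open scoped Real Manifold

noncomputable section

open EisensteinSeries CongruenceSubgroup

variable {N : ℕ} [NeZero N]

instance neZero_conductor (ψ : DirichletCharacter ℂ N) : NeZero ψ.conductor :=
  ⟨ψ.conductor_ne_zero⟩

/-- The triples `(ψ₁, ψ₂, d)` that index shifted newforms. -/
abbrev CharIndex (N : ℕ) : Type := (DirichletCharacter ℂ N × DirichletCharacter ℂ N) × ℕ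

/-- `E(χ₁, χ₂, k)` for the primitive characters inducing `ψ`. -/
def primE (k : ℕ) (ψ : DirichletCharacter ℂ N × DirichletCharacter ℂ N) : ℍ → ℂ :=
  eisensteinE ψ.1.primitiveCharacter ψ.2.primitiveCharacter k

/-- The Fourier coefficients of `primE k ψ`. -/
def primCoeff (k : ℕ) (ψ : DirichletCharacter ℂ N × DirichletCharacter ℂ N) : ℕ → ℂ :=
  newCoeff ψ.1.primitiveCharacter ψ.2.primitiveCharacter k

/-- The shift of a newform that belongs to an index. -/
def shiftE (k : ℕ) (i : CharIndex N) : ℍ → ℂ := shift i.2 (primE k i.1)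

theorem hasQSeries_primE {k : ℕ} (hk : 1 ≤ k)
    (ψ : DirichletCharacter ℂ N × DirichletCharacter ℂ N) :
    HasQSeries 1 (primE k ψ) (primCoeff k ψ) := hasQSeries_eisensteinE _ _ hk

theorem hasQSeries_shiftE {k : ℕ} (hk : 1 ≤ k) {i : CharIndex N} (hi : i.2 ≠ 0) :
    HasQSeries 1 (shiftE k i) (shiftCoeff i.2 (primCoeff k i.1)) :=
  (hasQSeries_primE hk _).shift hi

theorem shiftCoeff_primCoeff (k d : ℕ) (ψ : DirichletCharacter ℂ N × DirichletCharacter ℂ N)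
    {n : ℕ} (hn : n ≠ 0) :
    shiftCoeff d (primCoeff k ψ) n = shiftCoeff d (sigmaPrim k ψ) n := by
  unfold shiftCoeff
  split_ifs with h
  · obtain ⟨m, rfl⟩ := h
    rw [Nat.mul_div_cancel_left _ (Nat.pos_of_ne_zero (left_ne_zero_of_mul hn)), primCoeff, newCoeff,
      if_neg (right_ne_zero_of_mul hn), sigmaPrim]
  · rfl

/-- The coefficients of positive index alone force independence, so the constant terms of the
newforms play no role. -/
theorem eq_zero_of_sum_shiftE_eq_const {k : ℕ} (hk : 2 ≤ k) {S : Finset (CharIndex N)}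
    (hS : ∀ i ∈ S, i.2 ≠ 0) {c : CharIndex N → ℂ} {D : ℂ}
    (h : ∑ i ∈ S, c i • shiftE k i = fun _ ↦ D) : ∀ i ∈ S, c i = 0 := by
  refine eq_zero_of_sum_shiftCoeff_eq_zero hk hS fun n hn ↦ ?_
  have h1 := HasQSeries.sum S fun i hi ↦ (hasQSeries_shiftE (by omega : 1 ≤ k) (hS i hi)).smul (c i)
  rw [h] at h1
  have h2 := congrFun (h1.unique (HasQSeries.const D)) n
  rw [Pi.single_eq_of_ne hn, Finset.sum_apply] at h2
  rw [← h2]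
  exact Finset.sum_congr rfl fun i _ ↦ by
    rw [Pi.smul_apply, smul_eq_mul, shiftCoeff_primCoeff k _ _ hn]

/-- The indices of right level and parity. -/
def IsAdmissible (k : ℕ) (i : CharIndex N) : Prop :=
  i.1.1.conductor * i.1.2.conductor * i.2 ∣ N ∧ HasParity k i.1

theorem IsAdmissible.ne_zero {k : ℕ} {i : CharIndex N} (hi : IsAdmissible k i) : i.2 ≠ 0 := by
  intro h
  have := hi.1
  rw [h, mul_zero, zero_dvd_iff] at this
  exact NeZero.ne N this

omit [NeZero N] in
theorem IsAdmissible.hasParity_primitive {k : ℕ} {i : CharIndex N} (hi : IsAdmissible k i) :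
    i.1.1.primitiveCharacter (-1) * i.1.2.primitiveCharacter (-1) = (-1) ^ k := by
  rw [← hi.2, ← changeLevel_neg_one i.1.1.conductor_dvd_level,
    ← changeLevel_neg_one i.1.2.conductor_dvd_level, i.1.1.changeLevel_primitiveCharacter,
    i.1.2.changeLevel_primitiveCharacter]

omit [NeZero N] in
theorem primitiveCharacter_apply_Gamma0 (ψ : DirichletCharacter ℂ N) {a : ℤ}
    (ha : IsCoprime a (N : ℤ)) :
    ψ.primitiveCharacter (a : ZMod ψ.conductor) = ψ (a : ZMod N) := by
  rw [← DirichletCharacter.changeLevel_eq_cast_of_dvd' _ ψ.conductor_dvd_level ha,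
    ψ.changeLevel_primitiveCharacter]

theorem shiftE_slash {k : ℕ} (hk : 2 ≤ k) {i : CharIndex N} (hi : IsAdmissible k i) :
    ∃ q : ℂ, ∀ γ ∈ Gamma0 N, shiftE k i ∣[(k : ℤ)] γ =
      (i.1.1 * i.1.2) ((γ 1 1 : ℤ) : ZMod N) • shiftE k i - q • D2 γ := by
  set M := i.1.1.conductor * i.1.2.conductor with hM
  have : NeZero M := ⟨mul_ne_zero i.1.1.conductor_ne_zero i.1.2.conductor_ne_zero⟩
  refine ⟨newQuasi k M * (i.2 : ℂ)⁻¹, fun γ hγ ↦ ?_⟩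
  have hco := isCoprime_of_mem_Gamma0 hγ
  have hγ' : γ ∈ Gamma0 (M * i.2) := by
    rw [Gamma0_mem, ZMod.intCast_zmod_eq_zero_iff_dvd] at hγ ⊢
    exact (Int.natCast_dvd_natCast.2 hi.1).trans hγ
  obtain ⟨γ', hmem, h00, h01, h10, h11⟩ := exists_conj_mem_Gamma0 hγ'
  rw [shiftE, shift_slash hi.ne_zero k _ h00 h01 h10 h11, primE,
    eisensteinE_slash hM.symm hk i.1.1.primitiveCharacter_isPrimitive hi.hasParity_primitive hmem,
    h11, primitiveCharacter_apply_Gamma0 _ hco, primitiveCharacter_apply_Gamma0 _ hco,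
    ← MulChar.mul_apply]
  change _ - newQuasi k M • shift i.2 (D2 γ') = _
  rw [shift_D2 hi.ne_zero h10 h11, smul_smul]
  rfl

/-- The coefficients of positive index lie in the span of shifted divisor sums; restoring the
constant terms of the newforms costs only the constant D. Periodicity is all the modularity needed
here. -/
theorem exists_eisSum_eq {k : ℕ} (hk : 2 ≤ k) {φ : ZMod N → ZMod N → ℂ}
    (hT : eisSum k φ ∣[(k : ℤ)] ModularGroup.T = eisSum k φ) :
    ∃ (c : CharIndex N →₀ ℂ) (D : ℂ), (∀ i ∈ c.support, IsAdmissible k i) ∧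
      eisSum k φ = (fun _ ↦ D) + ∑ i ∈ c.support, c i • shiftE k i := by
  have h1 := (hasQSeries_eisSum hk φ).of_width (NeZero.ne N) (vadd_one_of_slash_T hT)
  have h2 := convSum_mem_coeffSpan k (dftRight φ)
  have h3 : {a | ∃ (ψ : DirichletCharacter ℂ N × DirichletCharacter ℂ N) (d : ℕ),
      ψ.1.conductor * ψ.2.conductor * d ∣ N ∧ HasParity k ψ ∧ a = shiftCoeff d (sigmaPrim k ψ)} =
      (fun i : CharIndex N ↦ shiftCoeff i.2 (sigmaPrim k i.1)) '' {i | IsAdmissible k i} := by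
    ext a
    constructor
    · rintro ⟨ψ, d, h, h', rfl⟩
      exact ⟨(ψ, d), ⟨h, h'⟩, rfl⟩
    · rintro ⟨i, hi, rfl⟩
      exact ⟨i.1, i.2, hi.1, hi.2, rfl⟩
  rw [coeffSpan, h3, Finsupp.mem_span_image_iff_linearCombination] at h2
  obtain ⟨l, hl, hl2⟩ := h2
  set A := lipschitzFactor k / (N : ℂ) ^ k with hA
  have hA0 : A ≠ 0 := div_ne_zero (lipschitzFactor_ne_zero k)
    (pow_ne_zero _ (Nat.cast_ne_zero.2 (NeZero.ne N)))
  have hsupp : (A • l).support = l.support := Finsupp.support_smul_eq hA0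
  have hadm : ∀ i ∈ (A • l).support, IsAdmissible k i := fun i hi ↦
    (Finsupp.mem_supported _ _).1 hl (hsupp ▸ hi)
  have h4 := HasQSeries.sum (A • l).support fun i hi ↦
    (hasQSeries_shiftE (by omega : 1 ≤ k) (hadm i hi).ne_zero).smul ((A • l) i)
  set B : ℕ → ℂ := ∑ i ∈ (A • l).support, (A • l) i • shiftCoeff i.2 (primCoeff k i.1) with hB
  refine ⟨A • l, eisSumCoeff k φ 0 - B 0, hadm, h1.ext ?_⟩
  convert! (HasQSeries.const (h := 1) (eisSumCoeff k φ 0 - B 0)).add h4 using 1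
  ext n
  rw [Pi.add_apply]
  rcases eq_or_ne n 0 with rfl | hn
  · simp
  · rw [Pi.single_eq_of_ne hn, zero_add, eisSumCoeff, if_neg (mul_ne_zero (NeZero.ne N) hn),
      hB, Finset.sum_apply, hsupp]
    have h5 := congrFun hl2 n
    rw [← h5, Finsupp.linearCombination_apply, Finsupp.sum, Finset.sum_apply, Finset.mul_sum]
    refine Finset.sum_congr rfl fun i _ ↦ ?_
    rw [Pi.smul_apply, Pi.smul_apply, smul_eq_mul, smul_eq_mul, Finsupp.smul_apply, smul_eq_mul,
      shiftCoeff_primCoeff k _ _ hn, mul_assoc]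

omit [NeZero N] in
theorem exists_mem_Gamma0 {δ : ℤ} (hδ : IsCoprime δ (N : ℤ)) :
    ∃ γ ∈ Gamma0 N, γ 1 1 = δ ∧ γ 1 0 = N := by
  obtain ⟨u, v, h⟩ := hδ
  have hdet : Matrix.det !![u, -v; (N : ℤ), δ] = 1 := by
    rw [Matrix.det_fin_two_of]
    linarith
  exact ⟨⟨_, hdet⟩, Gamma0_mem.2 (show (((N : ℤ) : ℤ) : ZMod N) = 0 by simp), rfl, rfl⟩

/-- A polynomial identity on ℍ. It is applied with w = Nz + 1, where D is the stray constant and κ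
measures the quasi-modular part; the points i, 2i, 4i already suffice. -/
theorem eq_zero_of_const_eq {k : ℕ} (hk : 2 ≤ k) {D κ : ℂ}
    (h : ∀ w : ℂ, 0 < w.im → D - D * w ^ k = κ * w ^ (k - 1)) : D = 0 ∧ κ = 0 := by
  have h1 := h I (by simp)
  have h2 := h (2 * I) (by simp)
  have h4 := h (4 * I) (by simp)
  obtain ⟨m, rfl⟩ : ∃ m, k = m + 2 := ⟨k - 2, by omega⟩
  rw [show m + 2 - 1 = m + 1 by omega] at *
  rw [mul_pow, mul_pow] at h2 h4
  rw [show (4 : ℂ) = 2 * 2 by norm_num, mul_pow, mul_pow] at h4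
  set X : ℂ := 2 ^ (m + 1) with hX
  have hX2 : (2 : ℂ) ^ (m + 2) = 2 * X := by rw [hX]; ring
  rw [hX2] at h2 h4
  set b := D * I ^ (m + 2)
  set c := κ * I ^ (m + 1)
  have h1' : D = b + c := by linear_combination h1
  have h2' : D = 2 * X * b + X * c := by linear_combination h2
  have h4' : D = 4 * X ^ 2 * b + X ^ 2 * c := by linear_combination h4
  have hX0 : X ≠ 0 := pow_ne_zero _ two_ne_zero
  have hXn : X = ((2 ^ (m + 1) : ℕ) : ℂ) := by rw [hX]; push_cast; rfl
  have h2X : 2 * X - 1 ≠ 0 := by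
    rw [hXn, sub_ne_zero]
    have : 2 * 2 ^ (m + 1) ≠ 1 := by omega
    exact_mod_cast this
  have hX1 : X - 1 ≠ 0 := by
    rw [hXn, sub_ne_zero]
    have : 2 ^ (m + 1) ≠ 1 := by rw [pow_succ]; omega
    exact_mod_cast this
  have hb : b = 0 := by
    have : (2 * X - 1) * X * b = 0 := by
      linear_combination (-X) * h1' + (X + 1) * h2' - h4'
    simpa [h2X, hX0] using this
  have hc : c = 0 := by
    have : (X - 1) * c = 0 := by rw [hb] at h1' h2'; linear_combination h1' - h2'
    simpa [hX1] using this
  exact ⟨by rw [h1', hb, hc, add_zero], by simpa [c] using hc⟩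

/-- A modular form in `E_k(N, χ)` is a combination of shifts of newforms for `(N, χ)`. -/
theorem exists_eq_sum_shiftE {k : ℕ} (hk : 2 ≤ k) {χ : DirichletCharacter ℂ N}
    {E : ModularForm ((Gamma1 N).map (Matrix.SpecialLinearGroup.mapGL ℝ)) k}
    (hE : E ∈ eisensteinSubspace k χ) :
    ∃ c : CharIndex N →₀ ℂ, (∀ i ∈ c.support, IsAdmissible k i ∧ i.1.1 * i.1.2 = χ) ∧
      ⇑E = ∑ i ∈ c.support, c i • shiftE k i := by
  obtain ⟨hmod, hspan⟩ := hE
  rw [span_eisensteinG hk] at hspan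
  obtain ⟨φ, hφ⟩ := hspan
  change eisSum k φ = ⇑E at hφ
  have hT := hmod ModularGroup.T (T_mem_Gamma0 N)
  have hT1 : ((ModularGroup.T 1 1 : ℤ) : ZMod N) = 1 := by simp [ModularGroup.T]
  rw [hT1, map_one, one_smul, ← hφ] at hT
  obtain ⟨c, D, hadm, hc⟩ := exists_eisSum_eq hk hT
  rw [hφ] at hc
  have hslash := fun i (hi : i ∈ c.support) ↦ shiftE_slash hk (hadm i hi)
  choose! q hq using hslash
  have hsum : ∀ γ ∈ Gamma0 N, (∑ i ∈ c.support, c i • shiftE k i) ∣[(k : ℤ)] γ =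
      ∑ i ∈ c.support, (c i * (i.1.1 * i.1.2) ((γ 1 1 : ℤ) : ZMod N)) • shiftE k i -
        (∑ i ∈ c.support, c i * q i) • D2 γ := by
    intro γ hγ
    have : ∀ s ⊆ c.support, (∑ i ∈ s, c i • shiftE k i) ∣[(k : ℤ)] γ =
      ∑ i ∈ s, (c i * (i.1.1 * i.1.2) ((γ 1 1 : ℤ) : ZMod N)) • shiftE k i -
        (∑ i ∈ s, c i * q i) • D2 γ := by
      classical
      intro s
      induction s using Finset.induction_on with
      | empty => intro _; simp
      | insert i s hi ih =>
        intro hs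
        have hi' := hs (Finset.mem_insert_self _ _)
        rw [Finset.sum_insert hi, Finset.sum_insert hi, Finset.sum_insert hi,
          SlashAction.add_slash, ih (fun j hj ↦ hs (Finset.mem_insert_of_mem hj)),
          ModularForm.SL_smul_slash, hq i hi' γ hγ, smul_sub, smul_smul, smul_smul, add_smul]
        abel
    exact this _ subset_rfl
  -- the constant and the quasi-modular part vanish
  obtain ⟨γ, hγ, h11, h10⟩ := exists_mem_Gamma0 (N := N) (δ := 1) isCoprime_one_left
  have hγs := hmod γ hγ
  rw [h11, Int.cast_one, map_one, one_smul] at hγs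
  -- For γ with bottom row (N, 1) all characters take the value 1, so in comparing E with its
  -- transform the newforms cancel. What remains is D(w^(-k) - 1) against a multiple of 1/w, with w
  -- = Nz + 1 arbitrary in ℍ.
  have hDκ : D = 0 ∧ (∑ i ∈ c.support, c i * q i) * (2 * π * I * N) = 0 := by
    refine eq_zero_of_const_eq hk fun w hw ↦ ?_
    have hN : (0 : ℝ) < N := Nat.cast_pos.2 (Nat.pos_of_ne_zero (NeZero.ne N))
    have hNC : (N : ℂ) ≠ 0 := Nat.cast_ne_zero.2 (NeZero.ne N)
    have him : 0 < ((w - 1) / N).im := by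
      rw [Complex.div_natCast_im, sub_im, one_im, sub_zero]
      exact div_pos hw hN
    have hz := congrFun hγs ⟨_, him⟩
    have hden : denom γ ((⟨_, him⟩ : ℍ) : ℂ) = w := by
      rw [ModularGroup.denom_apply, h10, h11]
      simp only
      push_cast
      field_simp
      ring
    have hw0 : w ≠ 0 := by rintro rfl; simp at hw
    rw [hc, SlashAction.add_slash, hsum γ hγ, h11] at hz
    simp only [Int.cast_one, map_one, mul_one, Pi.add_apply, Pi.sub_apply, Pi.smul_apply,
      ModularForm.SL_slash_apply, D2, hden, h10, smul_eq_mul] at hz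
    have hz' : D * w ^ (-(k : ℤ)) - D =
        (∑ i ∈ c.support, c i * q i) * (2 * π * I * N / w) := by
      push_cast at hz
      linear_combination hz
    obtain ⟨m, rfl⟩ : ∃ m, k = m + 1 := ⟨k - 1, by omega⟩
    rw [zpow_neg, zpow_natCast] at hz'
    rw [Nat.add_sub_cancel]
    field_simp at hz'
    exact mul_left_cancel₀ hw0 (by linear_combination hz')
  have hπ : (2 * π * I * N : ℂ) ≠ 0 := by
    simp [Real.pi_ne_zero, NeZero.ne N]
  obtain ⟨rfl, hκ⟩ := hDκ
  replace hκ := (mul_eq_zero.1 hκ).resolve_right hπ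
  have hE' : ⇑E = ∑ i ∈ c.support, c i • shiftE k i := by
    rw [hc]
    ext z
    simp
  refine ⟨c, fun i hi ↦ ⟨hadm i hi, ?_⟩, hE'⟩
  -- For each unit u take γ in Γ₀(N) with lower right entry representing u; independence gives
  -- cᵢ(ψ₁ψ₂(u) - χ(u)) = 0 for every index.
  refine MulChar.ext fun u ↦ ?_
  obtain ⟨δ, hδ⟩ := ZMod.intCast_surjective (u : ZMod N)
  have hco : IsCoprime δ (N : ℤ) :=
    ((ZMod.coe_int_isUnit_iff_isCoprime δ N).1 (hδ ▸ u.isUnit)).symm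
  obtain ⟨γ, hγ, h11, -⟩ := exists_mem_Gamma0 hco
  have h1 := hmod γ hγ
  rw [hE', hsum γ hγ, hκ, zero_smul, sub_zero, h11, hδ, Finset.smul_sum, ← sub_eq_zero,
    ← Finset.sum_sub_distrib] at h1
  have h2 := eq_zero_of_sum_shiftE_eq_const hk (fun j hj ↦ (hadm j hj).ne_zero)
    (c := fun i ↦ c i * (i.1.1 * i.1.2) u - χ u * c i) (D := 0) (by
      rw [← h1.trans (by rfl : (0 : ℍ → ℂ) = fun _ ↦ 0)]
      refine Finset.sum_congr rfl fun j _ ↦ ?_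
      rw [sub_smul, smul_smul]) i hi
  have h3 : c i * ((i.1.1 * i.1.2) u - χ u) = 0 := by linear_combination h2
  exact sub_eq_zero.1 ((mul_eq_zero.1 h3).resolve_left (Finsupp.mem_support_iff.1 hi))

end

end EisDecomp

/-! ### Parametrization of newforms by pairs of characters modulo N. -/

namespace EisDecomp

open Complex Filter Function
open UpperHalfPlane hiding I
open scoped Real Manifold

noncomputable section

open EisensteinSeries CongruenceSubgroup

variable {N : ℕ} [NeZero N]

theorem primE_changeLevel (k : ℕ) {n₁ n₂ : ℕ} [NeZero n₂] (h₁ : n₁ ∣ N) (h₂ : n₂ ∣ N)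
    {χ₁ : DirichletCharacter ℂ n₁} {χ₂ : DirichletCharacter ℂ n₂} (hχ₁ : χ₁.IsPrimitive)
    (hχ₂ : χ₂.IsPrimitive) :
    primE k (DirichletCharacter.changeLevel h₁ χ₁, DirichletCharacter.changeLevel h₂ χ₂) =
      eisensteinE χ₁ χ₂ k := by
  -- The conductors equal n₁, n₂ only propositionally; with general levels the equalities can be
  -- substituted away.
  have key : ∀ (m₁ m₂ : ℕ) [NeZero m₂] (h₁' : m₁ ∣ N) (h₂' : m₂ ∣ N)
      (ψ₁ : DirichletCharacter ℂ m₁) (ψ₂ : DirichletCharacter ℂ m₂), m₁ = n₁ → m₂ = n₂ →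
      DirichletCharacter.changeLevel h₁' ψ₁ = DirichletCharacter.changeLevel h₁ χ₁ →
      DirichletCharacter.changeLevel h₂' ψ₂ = DirichletCharacter.changeLevel h₂ χ₂ →
      eisensteinE ψ₁ ψ₂ k = eisensteinE χ₁ χ₂ k := by
    rintro m₁ m₂ _ h₁' h₂' ψ₁ ψ₂ rfl rfl e₁ e₂
    rw [DirichletCharacter.changeLevel_injective _ e₁, DirichletCharacter.changeLevel_injective _ e₂]
  refine key _ _ (DirichletCharacter.conductor_dvd_level _)
    (DirichletCharacter.conductor_dvd_level _) _ _ ?_ ?_ ?_ ?_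
  · exact (DirichletCharacter.conductor_changeLevel _ h₁).trans hχ₁
  · exact (DirichletCharacter.conductor_changeLevel _ h₂).trans hχ₂
  · rw [DirichletCharacter.changeLevel_primitiveCharacter]
  · rw [DirichletCharacter.changeLevel_primitiveCharacter]

theorem primE_injective {k : ℕ} (hk : 2 ≤ k) : Injective (primE (N := N) k) := by
  classical
  intro ψ ψ' h
  by_contra hne
  have hne' : ((ψ, 1) : CharIndex N) ≠ (ψ', 1) := fun h ↦ hne (congrArg Prod.fst h)
  have hs : ∀ φ : DirichletCharacter ℂ N × DirichletCharacter ℂ N,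
      shiftE k (φ, 1) = shift 1 (primE k φ) := fun _ ↦ rfl
  have := eq_zero_of_sum_shiftE_eq_const hk (S := {(ψ, 1), (ψ', 1)}) (by simp)
    (c := fun i ↦ if i = (ψ, 1) then 1 else -1) (D := 0) (by
      rw [Finset.sum_pair hne', if_pos rfl, if_neg hne'.symm, hs, hs, h]
      ext z
      simp) (ψ, 1) (by simp)
  simp at this

theorem real_iff_sq_eq_one {n : ℕ} (χ : DirichletCharacter ℂ n) :
    (∀ a, (χ a).im = 0) ↔ χ ^ 2 = 1 := by
  constructor
  · intro h
    refine MulChar.ext fun u ↦ ?_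
    rw [MulChar.pow_apply_coe, MulChar.one_apply_coe]
    have h1 := χ.unit_norm_eq_one u
    have h2 : χ u = ((χ u).re : ℂ) := Complex.ext rfl (by simp [h])
    rw [h2, Complex.norm_real, Real.norm_eq_abs] at h1
    rw [h2]
    have := sq_abs (χ u).re
    rw [h1] at this
    norm_cast
    linarith
  · intro h a
    by_cases ha : IsUnit a
    · obtain ⟨u, rfl⟩ := ha
      have h1 : χ u ^ 2 = 1 := by rw [← MulChar.pow_apply_coe, h, MulChar.one_apply_coe]
      rcases mul_self_eq_one_iff.1 ((sq _).symm.trans h1) with h2 | h2 <;> simp [h2]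
    · simp [MulChar.map_nonunit χ ha]

theorem sq_changeLevel_eq_one_iff {n : ℕ} (h : n ∣ N) (χ : DirichletCharacter ℂ n) :
    DirichletCharacter.changeLevel h χ ^ 2 = 1 ↔ χ ^ 2 = 1 := by
  rw [← map_pow, DirichletCharacter.changeLevel_eq_one_iff]

theorem sq_primitiveCharacter_eq_one_iff (ψ : DirichletCharacter ℂ N) :
    ψ.primitiveCharacter ^ 2 = 1 ↔ ψ ^ 2 = 1 := by
  rw [← sq_changeLevel_eq_one_iff ψ.conductor_dvd_level, ψ.changeLevel_primitiveCharacter]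

/-- A realization by real characters may have foreign levels N₁, N₂. Lifting everything to level N
N₁N₂ and using `primE_injective` there identifies the characters. -/
theorem hasRealCharacters_primE_iff {k : ℕ} (hk : 2 ≤ k)
    (ψ : DirichletCharacter ℂ N × DirichletCharacter ℂ N) :
    HasRealCharacters k (primE k ψ) ↔ ψ.1 ^ 2 = 1 ∧ ψ.2 ^ 2 = 1 := by
  constructor
  · rintro ⟨N₁, N₂, _, _, χ₁, χ₂, hp₁, hp₂, hr₁, hr₂, h⟩
    rw [real_iff_sq_eq_one] at hr₁ hr₂
    have hL : NeZero (N * (N₁ * N₂)) := ⟨mul_ne_zero (NeZero.ne N) (mul_ne_zero (NeZero.ne _) (NeZero.ne _))⟩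
    have d₁ : N₁ ∣ N * (N₁ * N₂) := (dvd_mul_right _ _).trans (dvd_mul_left _ _)
    have d₂ : N₂ ∣ N * (N₁ * N₂) := (dvd_mul_left _ _).trans (dvd_mul_left _ _)
    have d : N ∣ N * (N₁ * N₂) := dvd_mul_right _ _
    have h1 := primE_changeLevel k d₁ d₂ hp₁ hp₂
    have h2 := primE_changeLevel k (ψ.1.conductor_dvd_level.trans d)
      (ψ.2.conductor_dvd_level.trans d) ψ.1.primitiveCharacter_isPrimitive
      ψ.2.primitiveCharacter_isPrimitive
    rw [← h] at h1
    have h3 := primE_injective hk (h2.trans h1.symm)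
    have e₁ := congrArg Prod.fst h3
    have e₂ := congrArg Prod.snd h3
    simp only at e₁ e₂
    rw [← sq_primitiveCharacter_eq_one_iff ψ.1, ← sq_primitiveCharacter_eq_one_iff ψ.2,
      ← sq_changeLevel_eq_one_iff (ψ.1.conductor_dvd_level.trans d), e₁,
      ← sq_changeLevel_eq_one_iff (ψ.2.conductor_dvd_level.trans d), e₂,
      sq_changeLevel_eq_one_iff, sq_changeLevel_eq_one_iff]
    exact ⟨hr₁, hr₂⟩
  · rintro ⟨h₁, h₂⟩
    refine ⟨_, _, inferInstance, inferInstance, ψ.1.primitiveCharacter, ψ.2.primitiveCharacter,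
      ψ.1.primitiveCharacter_isPrimitive, ψ.2.primitiveCharacter_isPrimitive, ?_, ?_, rfl⟩
    · rwa [real_iff_sq_eq_one, sq_primitiveCharacter_eq_one_iff]
    · rwa [real_iff_sq_eq_one, sq_primitiveCharacter_eq_one_iff]

theorem eisensteinE_ne_zero {N₁ N₂ : ℕ} [NeZero N₂] {k : ℕ} (hk : 1 ≤ k)
    (χ₁ : DirichletCharacter ℂ N₁) (χ₂ : DirichletCharacter ℂ N₂) : eisensteinE χ₁ χ₂ k ≠ 0 := by
  intro h
  have h1 := hasQSeries_eisensteinE χ₁ χ₂ hk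
  rw [h] at h1
  have := congrFun (h1.unique HasQSeries.zero) 1
  rw [newCoeff, if_neg one_ne_zero, sigmaChar_one] at this
  exact one_ne_zero this

/-- The matrix -1 acts trivially on ℍ and by (-1)^k through the automorphy factor; this is the
source of the parity condition. -/
theorem apply_neg_one_of_mem {M k : ℕ} {ψ : DirichletCharacter ℂ M}
    {F : ModularForm ((Gamma1 M).map (Matrix.SpecialLinearGroup.mapGL ℝ)) k}
    (hF : F ∈ modularFormsWithCharacter k ψ) (h0 : (⇑F : ℍ → ℂ) ≠ 0) : ψ (-1) = (-1) ^ k := by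
  have h1 := hF (-1) (by rw [Gamma0_mem]; simp)
  obtain ⟨z, hz⟩ := Function.ne_iff.1 h0
  have h2 := congrFun h1 z
  rw [ModularForm.SL_slash_apply, ModularGroup.denom_apply] at h2
  simp only [Pi.smul_apply, smul_eq_mul] at h2
  have h3 : ((-1 : SL(2, ℤ)) • z) = z := by simp
  rw [h3] at h2
  simp at h2
  have h4 : ((-1 : ℂ) ^ k)⁻¹ = (-1) ^ k := by rw [← inv_pow, inv_neg_one]
  rw [h4, mul_comm] at h2
  exact (mul_right_cancel₀ hz h2).symm

/-- Turns the analytic definition into a finite combinatorial index set. Parity follows from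
modularity of a nonzero form, and holds trivially for the exceptional E(1, 1, 2). -/
theorem isShiftedNewform_iff {k : ℕ} (hk : 2 ≤ k) (χ : DirichletCharacter ℂ N)
    (x : ℕ × (ℍ → ℂ)) : IsShiftedNewform k χ x ↔
      ∃ i : CharIndex N, IsAdmissible k i ∧ i.1.1 * i.1.2 = χ ∧ x = (i.2, primE k i.1) := by
  constructor
  · rintro ⟨M, ⟨hMN, ψ, hψ, ⟨N₁, N₂, _, h₁, h₂, χ₁, χ₂, hM, hp₁, hp₂, hχ, hf⟩, hmod⟩, hd⟩
    have hprim := primE_changeLevel k (h₁.trans hMN) (h₂.trans hMN) hp₁ hp₂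
    refine ⟨((DirichletCharacter.changeLevel (h₁.trans hMN) χ₁,
      DirichletCharacter.changeLevel (h₂.trans hMN) χ₂), x.1), ⟨?_, ?_⟩, ?_, ?_⟩
    · simp only
      rw [DirichletCharacter.conductor_changeLevel, DirichletCharacter.conductor_changeLevel,
        DirichletCharacter.isPrimitive_def _ |>.1 hp₁, DirichletCharacter.isPrimitive_def _ |>.1 hp₂,
        hM]
      exact hd
    · simp only [HasParity, changeLevel_neg_one]
      rcases hmod with ⟨F, hF, hFf⟩ | ⟨rfl, rfl⟩
      · have hne : (⇑F : ℍ → ℂ) ≠ 0 := by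
          rw [hFf, hf]; exact eisensteinE_ne_zero (by omega) _ _
        have := apply_neg_one_of_mem hF.1 hne
        rwa [← hχ, MulChar.mul_apply, changeLevel_neg_one, changeLevel_neg_one] at this
      · obtain rfl : N₁ = 1 := Nat.eq_one_of_mul_eq_one_right hM
        obtain rfl : N₂ = 1 := Nat.eq_one_of_mul_eq_one_left hM
        rw [Subsingleton.elim (-1 : ZMod 1) 1, map_one, map_one]
        norm_num
    · simp only
      rw [DirichletCharacter.changeLevel_trans _ h₁ hMN, DirichletCharacter.changeLevel_trans _ h₂ hMN,
        ← map_mul, hχ, hψ]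
    · rw [hprim, ← hf]
  · rintro ⟨i, hi, hχ, rfl⟩
    set M := i.1.1.conductor * i.1.2.conductor with hM
    have : NeZero M := ⟨mul_ne_zero i.1.1.conductor_ne_zero i.1.2.conductor_ne_zero⟩
    have hMN : M ∣ N := (dvd_mul_right _ _).trans hi.1
    have h₁ : i.1.1.conductor ∣ M := dvd_mul_right _ _
    have h₂ : i.1.2.conductor ∣ M := dvd_mul_left _ _
    refine ⟨M, ⟨hMN, _, ?_, isEisensteinNewform hM.symm hk i.1.1.primitiveCharacter_isPrimitive
      i.1.2.primitiveCharacter_isPrimitive hi.hasParity_primitive h₁ h₂⟩, hi.1⟩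
    rw [map_mul, ← DirichletCharacter.changeLevel_trans, ← DirichletCharacter.changeLevel_trans,
      DirichletCharacter.changeLevel_primitiveCharacter,
      DirichletCharacter.changeLevel_primitiveCharacter, hχ]

end

end EisDecomp

/-! ### Galois action on cyclotomic numbers, character values and newform coefficients. -/

namespace EisDecomp

open Complex Filter Function
open UpperHalfPlane hiding I
open scoped Real Manifold

noncomputable section

open EisensteinSeries CongruenceSubgroup

/-- The field generated over `ℚ` by the complex `n`-th roots of unity. -/
def cyclo (n : ℕ) : IntermediateField ℚ ℂ :=
  IntermediateField.adjoin ℚ ((Polynomial.X ^ n - 1 : Polynomial ℚ).rootSet ℂ)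

instance isSplittingField_cyclo (n : ℕ) :
    Polynomial.IsSplittingField ℚ (cyclo n) (Polynomial.X ^ n - 1 : Polynomial ℚ) :=
  IntermediateField.adjoin_rootSet_isSplittingField (IsAlgClosed.splits _)

instance finiteDimensional_cyclo (n : ℕ) : FiniteDimensional ℚ (cyclo n) :=
  Polynomial.IsSplittingField.finiteDimensional _ (Polynomial.X ^ n - 1 : Polynomial ℚ)

instance normal_cyclo (n : ℕ) : Normal ℚ (cyclo n) :=
  Normal.of_isSplittingField (Polynomial.X ^ n - 1 : Polynomial ℚ)

instance isGalois_cyclo (n : ℕ) : IsGalois ℚ (cyclo n) where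

variable {n : ℕ}

theorem mem_cyclo (hn : n ≠ 0) {x : ℂ} (hx : x ^ n = 1) : x ∈ cyclo n := by
  refine IntermediateField.subset_adjoin _ _ ?_
  rw [Polynomial.mem_rootSet]
  refine ⟨Polynomial.X_pow_sub_C_ne_zero (Nat.pos_of_ne_zero hn) 1, ?_⟩
  simp [hx]

theorem exists_eq_pow (hn : n ≠ 0) (τ : cyclo n ≃ₐ[ℚ] cyclo n) :
    ∃ j : ℕ, j.Coprime n ∧ ∀ x : cyclo n, x ^ n = 1 → τ x = x ^ j := by
  have : NeZero n := ⟨hn⟩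
  have hζ := Complex.isPrimitiveRoot_exp n hn
  set ζ : cyclo n := ⟨_, mem_cyclo hn hζ.pow_eq_one⟩
  have hζ' : IsPrimitiveRoot ζ n :=
    IsPrimitiveRoot.of_map_of_injective (f := (cyclo n).val) hζ (cyclo n).val.injective
  have h1 := hζ'.map_of_injective (f := τ) τ.injective
  obtain ⟨j, -, hj⟩ := hζ'.eq_pow_of_pow_eq_one h1.pow_eq_one
  refine ⟨j, (hζ'.pow_iff_coprime (Nat.pos_of_ne_zero hn) j).1 (hj ▸ h1), fun x hx ↦ ?_⟩
  obtain ⟨m, -, rfl⟩ := hζ'.eq_pow_of_pow_eq_one hx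
  rw [map_pow, ← hj, ← pow_mul, ← pow_mul, mul_comm]

/-- The exponent by which an automorphism acts on the `n`-th roots of unity. -/
def conjExp (hn : n ≠ 0) (τ : cyclo n ≃ₐ[ℚ] cyclo n) : ℕ := (exists_eq_pow hn τ).choose

theorem coprime_conjExp (hn : n ≠ 0) (τ : cyclo n ≃ₐ[ℚ] cyclo n) : (conjExp hn τ).Coprime n :=
  (exists_eq_pow hn τ).choose_spec.1

theorem apply_eq_pow_conjExp (hn : n ≠ 0) (τ : cyclo n ≃ₐ[ℚ] cyclo n) {x : cyclo n}
    (hx : x ^ n = 1) : τ x = x ^ conjExp hn τ :=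
  (exists_eq_pow hn τ).choose_spec.2 x hx

/-- The graph of an automorphism. -/
def graph (τ : cyclo n ≃ₐ[ℚ] cyclo n) : Subalgebra ℚ (ℂ × ℂ) :=
  ((cyclo n).val.prod ((cyclo n).val.comp τ.toAlgHom)).range

/-- Since the graph is a subalgebra of ℂ × ℂ, the relation "τ maps x to y" between complex numbers
passes through sums and products without membership proofs for each term. -/
theorem mem_graph {τ : cyclo n ≃ₐ[ℚ] cyclo n} {x : ℂ × ℂ} :
    x ∈ graph τ ↔ ∃ y : cyclo n, (y : ℂ) = x.1 ∧ (τ y : ℂ) = x.2 := by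
  constructor
  · rintro ⟨y, rfl⟩
    exact ⟨y, rfl, rfl⟩
  · rintro ⟨y, h1, h2⟩
    exact ⟨y, Prod.ext h1 h2⟩

theorem ratCast_mem_graph (τ : cyclo n ≃ₐ[ℚ] cyclo n) (q : ℚ) : ((q : ℂ), (q : ℂ)) ∈ graph τ :=
  mem_graph.2 ⟨(q : cyclo n), by simp, by simp⟩

theorem sum_mem_graph {ι : Type*} {τ : cyclo n ≃ₐ[ℚ] cyclo n} (s : Finset ι) {f g : ι → ℂ}
    (h : ∀ i ∈ s, (f i, g i) ∈ graph τ) : (∑ i ∈ s, f i, ∑ i ∈ s, g i) ∈ graph τ := by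
  have : (∑ i ∈ s, f i, ∑ i ∈ s, g i) = ∑ i ∈ s, (f i, g i) :=
    Prod.ext (by simp [Prod.fst_sum]) (by simp [Prod.snd_sum])
  rw [this]
  exact Subalgebra.sum_mem _ h

theorem mul_mem_graph {τ : cyclo n ≃ₐ[ℚ] cyclo n} {a b c d : ℂ} (h : (a, b) ∈ graph τ)
    (h' : (c, d) ∈ graph τ) : (a * c, b * d) ∈ graph τ :=
  Subalgebra.mul_mem _ h h'

theorem graph_unique {τ : cyclo n ≃ₐ[ℚ] cyclo n} {a b c : ℂ} (h : (a, b) ∈ graph τ)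
    (h' : (a, c) ∈ graph τ) : b = c := by
  obtain ⟨y, h1, h2⟩ := mem_graph.1 h
  obtain ⟨y', h1', h2'⟩ := mem_graph.1 h'
  obtain rfl : y = y' := Subtype.ext (h1.trans h1'.symm)
  exact h2.symm.trans h2'

theorem eq_ratCast_of_mem_graph {a : ℂ} (h : ∀ τ : cyclo n ≃ₐ[ℚ] cyclo n, (a, a) ∈ graph τ) :
    ∃ q : ℚ, a = q := by
  obtain ⟨y, hy, -⟩ := mem_graph.1 (h 1)
  simp only at hy
  have h1 : y ∈ (⊥ : IntermediateField ℚ (cyclo n)) := by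
    rw [IsGalois.mem_bot_iff_fixed]
    intro τ
    exact Subtype.ext (graph_unique (τ := τ) (mem_graph.2 ⟨y, hy, rfl⟩) (hy ▸ h τ))
  obtain ⟨q, hq⟩ := IntermediateField.mem_bot.1 h1
  exact ⟨q, by rw [← hy, ← hq]; simp⟩

section Characters

variable {m : ℕ}

theorem char_mem_graph (hn : 2 ≤ n) (τ : cyclo n ≃ₐ[ℚ] cyclo n) {χ : DirichletCharacter ℂ m}
    (hχ : χ ^ n = 1) (a : ZMod m) :
    (χ a, (χ ^ conjExp (by omega) τ) a) ∈ graph τ := by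
  by_cases ha : IsUnit a
  · obtain ⟨u, rfl⟩ := ha
    have h1 : χ u ^ n = 1 := by rw [← MulChar.pow_apply_coe, hχ, MulChar.one_apply_coe]
    refine mem_graph.2 ⟨⟨χ u, mem_cyclo (by omega) h1⟩, rfl, ?_⟩
    rw [apply_eq_pow_conjExp (by omega) τ (Subtype.ext h1), MulChar.pow_apply_coe]
    rfl
  · rw [MulChar.map_nonunit _ ha, MulChar.map_nonunit _ ha]
    exact Subalgebra.zero_mem _

theorem sigmaChar_mem_graph (hn : 2 ≤ n) (τ : cyclo n ≃ₐ[ℚ] cyclo n) {m₁ m₂ : ℕ}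
    {χ₁ : DirichletCharacter ℂ m₁} {χ₂ : DirichletCharacter ℂ m₂} (h₁ : χ₁ ^ n = 1)
    (h₂ : χ₂ ^ n = 1) (k l : ℕ) :
    (sigmaChar χ₁ χ₂ k l, sigmaChar (χ₁ ^ conjExp (by omega) τ) (χ₂ ^ conjExp (by omega) τ) k l) ∈
      graph τ := by
  refine sum_mem_graph _ fun d _ ↦ mul_mem_graph (mul_mem_graph (char_mem_graph hn τ h₁ _)
    (char_mem_graph hn τ h₂ _)) ?_
  exact_mod_cast ratCast_mem_graph τ ((d : ℚ) ^ (k - 1))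

/-- L(s, χ) is m^(-s) times a combination of Hurwitz zeta functions at a/m, whose values at 1 - k
are -B_k(a/m)/k. These rational weights do not depend on χ, which makes the L-value Galois
equivariant. -/
theorem exists_LFunction_eq [NeZero m] {k : ℕ} (hk : 2 ≤ k) :
    ∃ r : ZMod m → ℚ, ∀ χ : DirichletCharacter ℂ m,
      DirichletCharacter.LFunction χ (1 - k) = ∑ a, χ a * (r a : ℂ) := by
  refine ⟨fun a ↦ m ^ (k - 1) * (-1 / k * (Polynomial.bernoulli k).eval (a.val / m : ℚ)),
    fun χ ↦ ?_⟩
  obtain ⟨l, rfl⟩ : ∃ l, k = l + 1 := ⟨k - 1, by omega⟩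
  have hm : (m : ℂ) ≠ 0 := Nat.cast_ne_zero.2 (NeZero.ne m)
  rw [DirichletCharacter.LFunction, ZMod.LFunction, Finset.mul_sum]
  refine Finset.sum_congr rfl fun a _ ↦ ?_
  have hs : (1 : ℂ) - ((l + 1 : ℕ) : ℂ) = -l := by push_cast; ring
  have hx : (a.val : ℝ) / m ∈ Set.Icc (0 : ℝ) 1 := by
    have hm' : (0 : ℝ) < m := Nat.cast_pos.2 (Nat.pos_of_ne_zero (NeZero.ne m))
    refine ⟨by positivity, (div_le_one hm').2 ?_⟩
    exact_mod_cast (ZMod.val_lt a).le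
  rw [hs, ZMod.toAddCircle_apply, HurwitzZeta.hurwitzZeta_neg_nat (by omega) hx, neg_neg,
    cpow_natCast, Nat.add_sub_cancel]
  have : ((((a.val : ℝ) / m : ℝ)) : ℂ) = algebraMap ℚ ℂ (a.val / m : ℚ) := by
    simp [-ZMod.natCast_val]
  rw [this, Polynomial.eval_map_algebraMap, Polynomial.aeval_algebraMap_apply]
  push_cast
  simp
  ring

theorem constTerm_mem_graph (hn : 2 ≤ n) (τ : cyclo n ≃ₐ[ℚ] cyclo n) {m₁ m₂ : ℕ} [NeZero m₂]
    {χ₁ : DirichletCharacter ℂ m₁} {χ₂ : DirichletCharacter ℂ m₂} (h₁ : χ₁ ^ n = 1)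
    (h₂ : χ₂ ^ n = 1) {k : ℕ} (hk : 2 ≤ k) :
    (constTerm χ₁ χ₂ k, constTerm (χ₁ ^ conjExp (by omega) τ) (χ₂ ^ conjExp (by omega) τ) k) ∈
      graph τ := by
  obtain ⟨r, hr⟩ := exists_LFunction_eq (m := m₂) hk
  -- The factor δ(χ₁) is Galois invariant because the exponent is prime to n, a multiple of the
  -- order of χ₁.
  have h3 : χ₁ ^ conjExp (by omega) τ = 1 ↔ χ₁ = 1 := by
    constructor
    · intro h
      have h4 := orderOf_dvd_of_pow_eq_one h
      have h5 := orderOf_dvd_of_pow_eq_one h₁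
      exact orderOf_eq_one_iff.1 (Nat.eq_one_of_dvd_coprimes (coprime_conjExp (by omega) τ) h4 h5)
    · rintro rfl
      exact one_pow _
  rw [constTerm, constTerm, hr, hr]
  refine mul_mem_graph ?_ (sum_mem_graph _ fun a _ ↦
    mul_mem_graph (char_mem_graph hn τ h₂ a) (ratCast_mem_graph τ _))
  by_cases h : χ₁ = 1
  · rw [if_pos h, if_pos (h3.2 h)]
    simpa using ratCast_mem_graph τ (1 / 2)
  · rw [if_neg h, if_neg (mt h3.1 h)]
    simpa using ratCast_mem_graph τ 0

theorem newCoeff_mem_graph (hn : 2 ≤ n) (τ : cyclo n ≃ₐ[ℚ] cyclo n) {m₁ m₂ : ℕ} [NeZero m₂]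
    {χ₁ : DirichletCharacter ℂ m₁} {χ₂ : DirichletCharacter ℂ m₂} (h₁ : χ₁ ^ n = 1)
    (h₂ : χ₂ ^ n = 1) {k : ℕ} (hk : 2 ≤ k) (l : ℕ) :
    (newCoeff χ₁ χ₂ k l, newCoeff (χ₁ ^ conjExp (by omega) τ) (χ₂ ^ conjExp (by omega) τ) k l) ∈
      graph τ := by
  unfold newCoeff
  split_ifs
  · exact constTerm_mem_graph hn τ h₁ h₂ hk
  · exact sigmaChar_mem_graph hn τ h₁ h₂ k l

end Characters

end

end EisDecomp

/-! ### Galois conjugation of characters modulo N. -/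

namespace EisDecomp

open Complex Filter Function
open UpperHalfPlane hiding I
open scoped Real Manifold

noncomputable section

open EisensteinSeries CongruenceSubgroup

theorem eq_one_of_pow_eq_one_of_coprime {G : Type*} [Monoid G] {x : G} {j n : ℕ}
    (h : j.Coprime n) (hj : x ^ j = 1) (hn : x ^ n = 1) : x = 1 :=
  orderOf_eq_one_iff.1 (Nat.eq_one_of_dvd_coprimes h (orderOf_dvd_of_pow_eq_one hj)
    (orderOf_dvd_of_pow_eq_one hn))

theorem pow_injective_of_coprime {G : Type*} [CommGroup G] {x y : G} {j n : ℕ}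
    (h : j.Coprime n) (hx : x ^ n = 1) (hy : y ^ n = 1) (hxy : x ^ j = y ^ j) : x = y :=
  div_eq_one.1 (eq_one_of_pow_eq_one_of_coprime h (by rw [div_pow, hxy, div_self'])
    (by rw [div_pow, hx, hy, div_self']))

variable {N : ℕ}

/-- Each of ψ and ψ^j is a power of the other, so their conductors divide each other. -/
theorem conductor_pow_of_coprime {ψ : DirichletCharacter ℂ N} {j n : ℕ} (h : j.Coprime n)
    (hψ : ψ ^ n = 1) : (ψ ^ j).conductor = ψ.conductor := by
  refine Nat.dvd_antisymm (DirichletCharacter.conductor_pow_dvd _ _) ?_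
  obtain ⟨m, hm⟩ := exists_pow_eq_self_of_coprime
    (h.coprime_dvd_right (orderOf_dvd_of_pow_eq_one hψ))
  conv_lhs => rw [← hm]
  exact DirichletCharacter.conductor_pow_dvd _ _

/-- An even exponent that kills the Dirichlet characters modulo `N`. -/
def charExp (N : ℕ) : ℕ := 2 * N.totient

variable [NeZero N]

variable (N) in
theorem two_le_charExp : 2 ≤ charExp N :=
  Nat.le_mul_of_pos_right 2 (Nat.totient_pos.2 (Nat.pos_of_ne_zero (NeZero.ne N)))

variable (N) in
theorem charExp_ne_zero : charExp N ≠ 0 := by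
  have := two_le_charExp N
  omega

theorem pow_charExp (ψ : DirichletCharacter ℂ N) : ψ ^ charExp N = 1 := by
  rw [charExp, mul_comm, pow_mul, ← ZMod.card_units_eq_totient, MulChar.pow_card_eq_one, one_pow]

theorem primitiveCharacter_pow_charExp (ψ : DirichletCharacter ℂ N) :
    ψ.primitiveCharacter ^ charExp N = 1 := by
  rw [← DirichletCharacter.changeLevel_eq_one_iff ψ.conductor_dvd_level, map_pow,
    ψ.changeLevel_primitiveCharacter, pow_charExp]

variable (τ : cyclo (charExp N) ≃ₐ[ℚ] cyclo (charExp N))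

/-- The conjugate of a Dirichlet character under an automorphism of the cyclotomic field. -/
def conjChar (ψ : DirichletCharacter ℂ N) : DirichletCharacter ℂ N :=
  ψ ^ conjExp (charExp_ne_zero N) τ

/-- The conjugate of a pair of Dirichlet characters. -/
def conjPair (ψ : DirichletCharacter ℂ N × DirichletCharacter ℂ N) :
    DirichletCharacter ℂ N × DirichletCharacter ℂ N := (conjChar τ ψ.1, conjChar τ ψ.2)

/-- The conjugate of an index. -/
def conjIndex (i : CharIndex N) : CharIndex N := (conjPair τ i.1, i.2)

theorem conjChar_injective : Injective (conjChar (N := N) τ) := fun ψ ψ' h ↦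
  pow_injective_of_coprime (coprime_conjExp (charExp_ne_zero N) τ) (pow_charExp ψ) (pow_charExp ψ') h

theorem conjPair_injective : Injective (conjPair (N := N) τ) := fun _ _ h ↦
  Prod.ext (conjChar_injective τ (congrArg Prod.fst h)) (conjChar_injective τ (congrArg Prod.snd h))

theorem conjIndex_injective : Injective (conjIndex (N := N) τ) := fun _ _ h ↦
  Prod.ext (conjPair_injective τ (congrArg Prod.fst h)) (congrArg Prod.snd h :)

theorem conductor_conjChar (ψ : DirichletCharacter ℂ N) :
    (conjChar τ ψ).conductor = ψ.conductor :=
  conductor_pow_of_coprime (coprime_conjExp (charExp_ne_zero N) τ) (pow_charExp ψ)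

theorem conjChar_mul (ψ ψ' : DirichletCharacter ℂ N) :
    conjChar τ (ψ * ψ') = conjChar τ ψ * conjChar τ ψ' := mul_pow _ _ _

theorem sq_conjChar_eq_one_iff (ψ : DirichletCharacter ℂ N) :
    conjChar τ ψ ^ 2 = 1 ↔ ψ ^ 2 = 1 := by
  rw [conjChar, ← pow_mul, mul_comm, pow_mul]
  refine ⟨fun h ↦ eq_one_of_pow_eq_one_of_coprime (coprime_conjExp (charExp_ne_zero N) τ) h ?_,
    fun h ↦ by rw [h, one_pow]⟩
  rw [← pow_mul, mul_comm, pow_mul, pow_charExp, one_pow]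

theorem conjChar_eq_self_of_sq_eq_one {ψ : DirichletCharacter ℂ N} (h : ψ ^ 2 = 1) :
    conjChar τ ψ = ψ := by
  -- The exponent is prime to the even number `charExp N`.
  have h1 : Odd (conjExp (charExp_ne_zero N) τ) :=
    Nat.Coprime.odd_of_right ((coprime_conjExp _ τ).coprime_dvd_right (Dvd.intro _ rfl))
  obtain ⟨l, hl⟩ := h1
  rw [conjChar, hl, pow_succ, pow_mul, h, one_pow, one_mul]

theorem conjPair_eq_self_of_sq_eq_one {ψ : DirichletCharacter ℂ N × DirichletCharacter ℂ N}
    (h : ψ.1 ^ 2 = 1 ∧ ψ.2 ^ 2 = 1) : conjPair τ ψ = ψ :=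
  Prod.ext (conjChar_eq_self_of_sq_eq_one τ h.1) (conjChar_eq_self_of_sq_eq_one τ h.2)

theorem conjChar_apply_neg_one (ψ : DirichletCharacter ℂ N) : conjChar τ ψ (-1) = ψ (-1) := by
  have h1 : Odd (conjExp (charExp_ne_zero N) τ) :=
    Nat.Coprime.odd_of_right ((coprime_conjExp _ τ).coprime_dvd_right (Dvd.intro _ rfl))
  obtain ⟨l, hl⟩ := h1
  have h2 : ψ (-1) ^ 2 = 1 := by rw [← map_pow, neg_one_sq, map_one]
  have h3 : IsUnit (-1 : ZMod N) := isUnit_one.neg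
  obtain ⟨u, hu⟩ := h3
  rw [← hu] at h2 ⊢
  rw [conjChar, MulChar.pow_apply_coe, hl, pow_succ, pow_mul, h2, one_pow, one_mul]

theorem isPrimitive_primitiveCharacter_pow (ψ : DirichletCharacter ℂ N) :
    (ψ.primitiveCharacter ^ conjExp (charExp_ne_zero N) τ).IsPrimitive :=
  (conductor_pow_of_coprime (coprime_conjExp (charExp_ne_zero N) τ)
    (primitiveCharacter_pow_charExp ψ)).trans ψ.primitiveCharacter_isPrimitive

theorem primE_conjPair (k : ℕ) (ψ : DirichletCharacter ℂ N × DirichletCharacter ℂ N) :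
    primE k (conjPair τ ψ) =
      eisensteinE (ψ.1.primitiveCharacter ^ conjExp (charExp_ne_zero N) τ)
        (ψ.2.primitiveCharacter ^ conjExp (charExp_ne_zero N) τ) k := by
  rw [← primE_changeLevel k ψ.1.conductor_dvd_level ψ.2.conductor_dvd_level
    (isPrimitive_primitiveCharacter_pow τ ψ.1) (isPrimitive_primitiveCharacter_pow τ ψ.2), map_pow,
    map_pow, ψ.1.changeLevel_primitiveCharacter, ψ.2.changeLevel_primitiveCharacter]
  rfl

/-- Automorphisms carry newforms to newforms. The two descriptions of the conjugate newform have
levels that agree only propositionally, so their coefficients are matched through uniqueness of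
q-series. -/
theorem primCoeff_mem_graph {k : ℕ} (hk : 2 ≤ k)
    (ψ : DirichletCharacter ℂ N × DirichletCharacter ℂ N) (l : ℕ) :
    (primCoeff k ψ l, primCoeff k (conjPair τ ψ) l) ∈ graph τ := by
  have h1 := hasQSeries_primE (by omega : 1 ≤ k) (conjPair τ ψ)
  rw [primE_conjPair] at h1
  rw [h1.unique (hasQSeries_eisensteinE _ _ (by omega : 1 ≤ k))]
  exact newCoeff_mem_graph (two_le_charExp N) τ (primitiveCharacter_pow_charExp ψ.1)
    (primitiveCharacter_pow_charExp ψ.2) hk l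

theorem shiftCoeff_mem_graph {k : ℕ} (hk : 2 ≤ k) (i : CharIndex N) (l : ℕ) :
    (shiftCoeff i.2 (primCoeff k i.1) l, shiftCoeff i.2 (primCoeff k (conjPair τ i.1)) l) ∈
      graph τ := by
  unfold shiftCoeff
  split_ifs
  · exact primCoeff_mem_graph τ hk i.1 _
  · exact Subalgebra.zero_mem _

end

end EisDecomp

/-! ### Galois equivariance of the coefficients of a rational form. -/

namespace EisDecomp

open Complex Filter Function
open UpperHalfPlane hiding I
open scoped Real Manifold

noncomputable section

open EisensteinSeries CongruenceSubgroup

variable {N : ℕ} [NeZero N]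

/-- The Fourier coefficients of `shiftE k i`. -/
def shiftECoeff (k : ℕ) (i : CharIndex N) : ℕ → ℂ := shiftCoeff i.2 (primCoeff k i.1)

theorem linearIndepOn_shiftE {k : ℕ} (hk : 2 ≤ k) :
    LinearIndepOn ℂ (shiftE (N := N) k) {i | i.2 ≠ 0} := by
  rw [linearIndepOn_iff]
  intro c hc h
  rw [Finsupp.mem_supported] at hc
  ext i
  by_cases hi : i ∈ c.support
  · exact eq_zero_of_sum_shiftE_eq_const hk (D := 0) hc h i hi
  · simpa using hi

theorem hasQSeries_linearCombination {k : ℕ} (hk : 2 ≤ k) {c : CharIndex N →₀ ℂ}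
    (hc : ∀ i ∈ c.support, i.2 ≠ 0) :
    HasQSeries 1 (Finsupp.linearCombination ℂ (shiftE k) c)
      (Finsupp.linearCombination ℂ (shiftECoeff k) c) :=
  HasQSeries.sum _ fun i hi ↦ (hasQSeries_shiftE (by omega : 1 ≤ k) (hc i hi)).smul (c i)

theorem eq_of_linearCombination_shiftECoeff_eq {k : ℕ} (hk : 2 ≤ k) {c c' : CharIndex N →₀ ℂ}
    (hc : ∀ i ∈ c.support, i.2 ≠ 0) (hc' : ∀ i ∈ c'.support, i.2 ≠ 0)
    (h : Finsupp.linearCombination ℂ (shiftECoeff k) c =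
      Finsupp.linearCombination ℂ (shiftECoeff k) c') : c = c' := by
  have h1 := hasQSeries_linearCombination hk hc
  rw [h] at h1
  have h2 := h1.ext (hasQSeries_linearCombination hk hc')
  refine sub_eq_zero.1 (linearIndepOn_iff.1 (linearIndepOn_shiftE hk) _ ?_
    (by rw [map_sub, h2, sub_self]))
  exact Submodule.sub_mem _ ((Finsupp.mem_supported _ _).2 hc) ((Finsupp.mem_supported _ _).2 hc')

/-- The coefficients of a rational combination of shifted newforms are permuted by the Galois
group. -/
theorem coeff_mem_graph {k : ℕ} (hk : 2 ≤ k) {c : CharIndex N →₀ ℂ}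
    (hc : ∀ i ∈ c.support, i.2 ≠ 0)
    (hrat : ∀ l, ∃ q : ℚ, Finsupp.linearCombination ℂ (shiftECoeff k) c l = q)
    (τ : cyclo (charExp N) ≃ₐ[ℚ] cyclo (charExp N)) (i : CharIndex N) :
    (c i, c (conjIndex τ i)) ∈ graph τ := by
  -- A K-linear retraction p of ℂ onto the cyclotomic field K, used because the cᵢ are not yet known
  -- to lie in K.
  obtain ⟨p, hp⟩ := LinearMap.exists_leftInverse_of_injective
    (Algebra.linearMap (cyclo (charExp N)) ℂ)
    (LinearMap.ker_eq_bot.2 (algebraMap (cyclo (charExp N)) ℂ).injective)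
  have hp' (y : cyclo (charExp N)) : p (y : ℂ) = y := LinearMap.congr_fun hp y
  have hlc (c' : CharIndex N →₀ ℂ) (l : ℕ) :
      Finsupp.linearCombination ℂ (shiftECoeff k) c' l =
        ∑ i ∈ c'.support, c' i * shiftECoeff k i l := by
    simp [Finsupp.linearCombination_apply, Finsupp.sum, Finset.sum_apply]
  have hmr {T : ℂ → ℂ} (hT : T 0 = 0) (v : CharIndex N → ℕ → ℂ) (l : ℕ) :
      Finsupp.linearCombination ℂ v (c.mapRange T hT) l =
        ∑ i ∈ c.support, T (c i) * v i l := by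
    rw [Finsupp.linearCombination_apply, Finsupp.sum_mapRange_index (h := fun i a ↦ a • v i)
      fun i ↦ zero_smul ℂ (v i)]
    simp [Finsupp.sum, Finset.sum_apply]
  -- The newform coefficients lie in K and the total is rational, so replacing cᵢ by p(cᵢ) gives the
  -- same q-series. By uniqueness cᵢ = p(cᵢ) lies in K.
  have h1 : c.mapRange (fun x ↦ (p x : ℂ)) (by simp) = c := by
    refine eq_of_linearCombination_shiftECoeff_eq hk
      (fun i hi ↦ hc i (Finsupp.support_mapRange hi)) hc (funext fun l ↦ ?_)
    obtain ⟨q, hq⟩ := hrat l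
    rw [hmr, hq]
    rw [hlc] at hq
    have h2 := congrArg (fun x ↦ (p x : ℂ)) hq
    simp only [map_sum] at h2
    have h3 : p (q : ℂ) = (q : cyclo (charExp N)) := by
      rw [← hp' q]
      simp
    rw [h3] at h2
    push_cast at h2
    rw [← h2]
    refine Finset.sum_congr rfl fun i _ ↦ ?_
    obtain ⟨y, hy, -⟩ := mem_graph.1 (shiftCoeff_mem_graph 1 hk i l)
    simp only at hy
    rw [shiftECoeff, ← hy, mul_comm (c i), show (y : ℂ) * c i = y • c i from rfl, map_smul,
      smul_eq_mul, mul_comm]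
    rfl
  set T : ℂ → ℂ := fun x ↦ (τ (p x) : ℂ)
  have hT : T 0 = 0 := by simp [T]
  have hcT (i : CharIndex N) : (c i, T (c i)) ∈ graph τ :=
    mem_graph.2 ⟨p (c i), DFunLike.congr_fun h1 i, rfl⟩
  -- Applying τ to the relation moves τ(cᵢ) to the conjugate index and leaves the rational total
  -- unchanged; uniqueness concludes.
  have h2 : (c.mapRange T hT).mapDomain (conjIndex τ) = c := by
    classical
    refine eq_of_linearCombination_shiftECoeff_eq hk (fun i hi ↦ ?_) hc (funext fun l ↦ ?_)
    · obtain ⟨j, hj, rfl⟩ := Finset.mem_image.1 (Finsupp.mapDomain_support hi)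
      exact hc j (Finsupp.support_mapRange hj)
    · obtain ⟨q, hq⟩ := hrat l
      rw [Finsupp.linearCombination_mapDomain, hmr, hq]
      refine graph_unique (τ := τ) (a := q) ?_ (ratCast_mem_graph τ q)
      rw [← hq, hlc]
      exact sum_mem_graph _ fun i _ ↦ mul_mem_graph (hcT i) (shiftCoeff_mem_graph τ hk i l)
  conv => enter [2, 2]; rw [← h2, Finsupp.mapDomain_apply (conjIndex_injective τ)]
  exact hcT i

theorem eq_one_or_orderOf_eq_two {χ : DirichletCharacter ℂ N}
    (h : ∀ τ, conjChar τ χ = χ) : χ = 1 ∨ orderOf χ = 2 := by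
  have h1 : χ ^ 2 = 1 := by
    refine (real_iff_sq_eq_one χ).1 fun a ↦ ?_
    obtain ⟨q, hq⟩ := eq_ratCast_of_mem_graph (n := charExp N) (a := χ a) fun τ ↦ by
      have := char_mem_graph (two_le_charExp N) τ (pow_charExp χ) a
      rwa [show χ ^ conjExp _ τ = χ from h τ] at this
    rw [hq, Complex.ratCast_im]
  by_cases h2 : χ = 1
  · exact Or.inl h2
  · exact Or.inr (orderOf_eq_prime h1 h2)

end

end EisDecomp

/-! ### The fields ℚ(f) and the conjugates of a newform. -/

namespace EisDecomp

open Complex Filter Function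
open UpperHalfPlane hiding I
open scoped Real Manifold

noncomputable section

open EisensteinSeries CongruenceSubgroup

theorem mem_of_forall_fixed {F E : Type*} [Field F] [Field E] [Algebra F E]
    {K M : IntermediateField F E} [hM : FiniteDimensional F M] [hG : IsGalois F M] (h : K ≤ M)
    {y : M} (hy : ∀ τ : M ≃ₐ[F] M, (∀ z : M, (z : E) ∈ K → τ z = z) → τ y = y) :
    (y : E) ∈ K := by
  rw [← IntermediateField.mem_restrict h, ← IsGalois.fixedField_fixingSubgroup
    (IntermediateField.restrict h)]
  rintro ⟨τ, hτ⟩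
  rw [IntermediateField.mem_fixingSubgroup_iff] at hτ
  exact hy τ fun z hz ↦ hτ z ((IntermediateField.mem_restrict h z).2 hz)

variable {N : ℕ} [NeZero N]

theorem exists_lift {n : ℕ} {F : IntermediateField ℚ ℂ} (h : F ≤ cyclo n) (σ : F ≃ₐ[ℚ] F) :
    ∃ τ : cyclo n ≃ₐ[ℚ] cyclo n, ∀ x : F, ((x : ℂ), (σ x : ℂ)) ∈ graph τ := by
  let : Algebra F (cyclo n) := (IntermediateField.inclusion h).toRingHom.toAlgebra
  have : IsScalarTower ℚ F (cyclo n) := IsScalarTower.of_algebraMap_eq fun x ↦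
    ((IntermediateField.inclusion h).commutes x).symm
  refine ⟨σ.liftNormal (cyclo n), fun x ↦ mem_graph.2 ⟨algebraMap F (cyclo n) x, rfl, ?_⟩⟩
  rw [AlgEquiv.liftNormal_commutes]
  rfl

theorem fourierCoeff_primE {k : ℕ} (hk : 2 ≤ k)
    (ψ : DirichletCharacter ℂ N × DirichletCharacter ℂ N) (l : ℕ) :
    fourierCoeff (primE k ψ) l = primCoeff k ψ l :=
  (hasQSeries_primE (by omega : 1 ≤ k) ψ).fourierCoeff_eq l

theorem fourierField_primE_le {k : ℕ} (hk : 2 ≤ k)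
    (ψ : DirichletCharacter ℂ N × DirichletCharacter ℂ N) :
    fourierField (primE k ψ) ≤ cyclo (charExp N) := by
  refine IntermediateField.adjoin_le_iff.2 ?_
  rintro _ ⟨l, rfl⟩
  obtain ⟨y, hy, -⟩ := mem_graph.1 (primCoeff_mem_graph 1 hk ψ l)
  rw [fourierCoeff_primE hk]
  simp only at hy
  exact hy ▸ y.2

theorem finiteDimensional_fourierField_primE {k : ℕ} (hk : 2 ≤ k)
    (ψ : DirichletCharacter ℂ N × DirichletCharacter ℂ N) :
    FiniteDimensional ℚ (fourierField (primE k ψ)) :=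
  FiniteDimensional.of_injective
    (IntermediateField.inclusion (fourierField_primE_le hk ψ)).toLinearMap
    (IntermediateField.inclusion (fourierField_primE_le hk ψ)).injective

theorem conjPair_eq_self {k : ℕ} (hk : 2 ≤ k)
    {ψ ψ' : DirichletCharacter ℂ N × DirichletCharacter ℂ N}
    (h : ∀ l, primCoeff k ψ' l = primCoeff k ψ l) : ψ' = ψ := by
  have h1 := hasQSeries_primE (by omega : 1 ≤ k) ψ'
  rw [funext h] at h1
  exact primE_injective hk (h1.ext (hasQSeries_primE (by omega : 1 ≤ k) ψ))

/-- An automorphism trivial on ℚ(f) fixes every coefficient of f, hence its pair of characters,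
hence a; the Galois correspondence then puts a in ℚ(f). -/
theorem mem_fourierField_primE {k : ℕ} (hk : 2 ≤ k)
    {ψ : DirichletCharacter ℂ N × DirichletCharacter ℂ N} {a : ℂ}
    (h : ∀ τ : cyclo (charExp N) ≃ₐ[ℚ] cyclo (charExp N),
      ∃ b, (a, b) ∈ graph τ ∧ (conjPair τ ψ = ψ → b = a)) : a ∈ fourierField (primE k ψ) := by
  obtain ⟨b, hb, -⟩ := h 1
  obtain ⟨y, rfl, -⟩ := mem_graph.1 hb
  have hle := fourierField_primE_le hk ψ
  refine mem_of_forall_fixed (hM := finiteDimensional_cyclo _) (hG := isGalois_cyclo _) hle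
    fun τ hτ ↦ ?_
  have h1 : conjPair τ ψ = ψ := conjPair_eq_self hk fun l ↦ by
    obtain ⟨z, hz, hz'⟩ := mem_graph.1 (primCoeff_mem_graph τ hk ψ l)
    have h2 : (z : ℂ) ∈ fourierField (primE k ψ) := by
      rw [hz, ← fourierCoeff_primE hk]
      exact IntermediateField.subset_adjoin _ _ ⟨l, rfl⟩
    exact hz'.symm.trans ((congrArg Subtype.val (hτ z h2)).trans hz)
  obtain ⟨b, hb, hb'⟩ := h τ
  rw [hb' h1] at hb
  exact Subtype.ext (graph_unique (mem_graph.2 ⟨y, rfl, rfl⟩) hb)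

/-- The cyclotomic field is normal, so σ extends to some τ, and f^σ is the newform of the pair
conjugated by τ. -/
theorem exists_galoisConj_eq {k : ℕ} (hk : 2 ≤ k) {f : ℍ → ℂ}
    {ψ : DirichletCharacter ℂ N × DirichletCharacter ℂ N} (hf : f = primE k ψ)
    (σ : fourierField f ≃ₐ[ℚ] fourierField f) :
    ∃ τ : cyclo (charExp N) ≃ₐ[ℚ] cyclo (charExp N),
      (∀ x : fourierField f, ((x : ℂ), (σ x : ℂ)) ∈ graph τ) ∧
      galoisConj f σ = primE k (conjPair τ ψ) := by
  subst hf
  obtain ⟨τ, hτ⟩ := exists_lift (fourierField_primE_le hk ψ) σ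
  refine ⟨τ, hτ, funext fun z ↦ ?_⟩
  rw [← (hasQSeries_primE (by omega : 1 ≤ k) (conjPair τ ψ) z).tsum_eq]
  refine tsum_congr fun l ↦ ?_
  have h1 : (σ (fourierCoeff' (primE k ψ) l) : ℂ) = primCoeff k (conjPair τ ψ) l := by
    refine graph_unique (hτ _) ?_
    have h2 : (fourierCoeff' (primE k ψ) l : ℂ) = primCoeff k ψ l := fourierCoeff_primE hk ψ l
    rw [h2]
    exact primCoeff_mem_graph τ hk ψ l
  rw [h1]
  exact congrArg _ (by exact_mod_cast (qParam_one_pow z l).symm)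

/-- The coefficients generate ℚ(f), so f^σ determines σ. -/
theorem galoisConj_injective {k : ℕ} (hk : 2 ≤ k) {f : ℍ → ℂ}
    {ψ : DirichletCharacter ℂ N × DirichletCharacter ℂ N} (hf : f = primE k ψ) :
    Injective (galoisConj f) := by
  subst hf
  intro σ σ' h
  obtain ⟨τ, hτ, h1⟩ := exists_galoisConj_eq hk rfl σ
  obtain ⟨τ', hτ', h1'⟩ := exists_galoisConj_eq hk rfl σ'
  rw [h1, h1'] at h
  have h2 := primE_injective hk h
  have h3 : (σ : fourierField (primE k ψ) →ₐ[ℚ] fourierField (primE k ψ)) = σ' := by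
    refine IntermediateField.algHom_ext_of_eq_adjoin _ rfl ?_
    rintro _ ⟨l, rfl⟩
    have h4 := primCoeff_mem_graph τ hk ψ l
    have h4' := primCoeff_mem_graph τ' hk ψ l
    rw [← fourierCoeff_primE hk] at h4 h4'
    rw [h2] at h4
    exact Subtype.ext ((graph_unique (hτ _) h4).trans (graph_unique (hτ' _) h4').symm)
  exact AlgEquiv.coe_toAlgHom_injective h3

end

end EisDecomp

/-! ### Matching the terms of the decomposition with character indices. -/

namespace EisDecomp

open Complex Filter Function
open UpperHalfPlane hiding I
open scoped Real Manifold

noncomputable section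

open EisensteinSeries CongruenceSubgroup

variable {N : ℕ} [NeZero N]

theorem isAdmissible_conjIndex_iff {k : ℕ} (τ : cyclo (charExp N) ≃ₐ[ℚ] cyclo (charExp N))
    {i : CharIndex N} : IsAdmissible k (conjIndex τ i) ↔ IsAdmissible k i :=
  and_congr (by rw [← conductor_conjChar τ i.1.1, ← conductor_conjChar τ i.1.2]; rfl)
    (by rw [HasParity, HasParity, ← conjChar_apply_neg_one τ i.1.1,
      ← conjChar_apply_neg_one τ i.1.2]; rfl)

/-- The terms in the decomposition: the Galois conjugates of shifted newforms with indices in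
`TraceIndex`, and the shifted newforms with indices in `RealIndex`. -/
abbrev TermIndex (k : ℕ) (χ : DirichletCharacter ℂ N) (R : Set (ℍ → ℂ)) : Type :=
  (Σ x : TraceIndex k χ R, (fourierField x.1.2 ≃ₐ[ℚ] fourierField x.1.2)) ⊕ RealIndex k χ

theorem exists_primE_eq {k : ℕ} (hk : 2 ≤ k) {χ : DirichletCharacter ℂ N} {x : ℕ × (ℍ → ℂ)}
    (hx : IsShiftedNewform k χ x) : ∃ ψ : DirichletCharacter ℂ N × DirichletCharacter ℂ N,
      IsAdmissible k (ψ, x.1) ∧ ψ.1 * ψ.2 = χ ∧ x.2 = primE k ψ := by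
  obtain ⟨⟨ψ, d⟩, h1, h2, rfl⟩ := (isShiftedNewform_iff hk χ x).1 hx
  exact ⟨ψ, h1, h2, rfl⟩

/-- The pair of characters of a shifted newform. -/
def shiftedNewformChars {k : ℕ} (hk : 2 ≤ k) {χ : DirichletCharacter ℂ N} {x : ℕ × (ℍ → ℂ)}
    (hx : IsShiftedNewform k χ x) : DirichletCharacter ℂ N × DirichletCharacter ℂ N :=
  (exists_primE_eq hk hx).choose

theorem shiftedNewformChars_spec {k : ℕ} (hk : 2 ≤ k) {χ : DirichletCharacter ℂ N}
    {x : ℕ × (ℍ → ℂ)} (hx : IsShiftedNewform k χ x) :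
    IsAdmissible k (shiftedNewformChars hk hx, x.1) ∧
      (shiftedNewformChars hk hx).1 * (shiftedNewformChars hk hx).2 = χ ∧
      x.2 = primE k (shiftedNewformChars hk hx) :=
  (exists_primE_eq hk hx).choose_spec

variable {k : ℕ} (hk : 2 ≤ k) {χ : DirichletCharacter ℂ N} {R : Set (ℍ → ℂ)}

/-- An extension to the cyclotomic field of an automorphism of the field of a newform. -/
def liftAut (x : TraceIndex k χ R) (σ : fourierField x.1.2 ≃ₐ[ℚ] fourierField x.1.2) :
    cyclo (charExp N) ≃ₐ[ℚ] cyclo (charExp N) :=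
  (exists_galoisConj_eq hk (shiftedNewformChars_spec hk x.2.1).2.2 σ).choose

theorem liftAut_spec (x : TraceIndex k χ R)
    (σ : fourierField x.1.2 ≃ₐ[ℚ] fourierField x.1.2) :
    (∀ y : fourierField x.1.2, ((y : ℂ), (σ y : ℂ)) ∈ graph (liftAut hk x σ)) ∧
      galoisConj x.1.2 σ =
        primE k (conjPair (liftAut hk x σ) (shiftedNewformChars hk x.2.1)) :=
  (exists_galoisConj_eq hk (shiftedNewformChars_spec hk x.2.1).2.2 σ).choose_spec

/-- The characters and the shift that belong to a term of the decomposition. -/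
def termChars : TermIndex k χ R → CharIndex N
  | .inl ⟨x, σ⟩ => conjIndex (liftAut hk x σ) (shiftedNewformChars hk x.2.1, x.1.1)
  | .inr x => (shiftedNewformChars hk x.2.1, x.1.1)

theorem isAdmissible_termChars (j : TermIndex k χ R) : IsAdmissible k (termChars hk j) := by
  rcases j with ⟨x, σ⟩ | x
  · exact (isAdmissible_conjIndex_iff _).2 (shiftedNewformChars_spec hk x.2.1).1
  · exact (shiftedNewformChars_spec hk x.2.1).1

theorem primE_termChars_inl (x : TraceIndex k χ R)
    (σ : fourierField x.1.2 ≃ₐ[ℚ] fourierField x.1.2) :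
    primE k (termChars hk (.inl ⟨x, σ⟩)).1 = galoisConj x.1.2 σ :=
  (liftAut_spec hk x σ).2.symm

theorem primE_termChars_inr (x : RealIndex k χ) :
    primE k (termChars (R := R) hk (.inr x)).1 = x.1.2 :=
  (shiftedNewformChars_spec hk x.2.1).2.2.symm

theorem shiftE_termChars_inl (x : TraceIndex k χ R)
    (σ : fourierField x.1.2 ≃ₐ[ℚ] fourierField x.1.2) :
    shiftE k (termChars hk (.inl ⟨x, σ⟩)) = shift x.1.1 (galoisConj x.1.2 σ) :=
  congrArg (shift x.1.1) (primE_termChars_inl hk x σ)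

theorem shiftE_termChars_inr (x : RealIndex k χ) :
    shiftE k (termChars (R := R) hk (.inr x)) = shift x.1.1 x.1.2 :=
  congrArg (shift x.1.1) (primE_termChars_inr (R := R) hk x)

theorem not_sq_eq_one_of_traceIndex (x : TraceIndex k χ R) :
    ¬((shiftedNewformChars hk x.2.1).1 ^ 2 = 1 ∧ (shiftedNewformChars hk x.2.1).2 ^ 2 = 1) := by
  rw [← hasRealCharacters_primE_iff hk, ← (shiftedNewformChars_spec hk x.2.1).2.2]
  exact x.2.2.2

theorem sq_eq_one_of_realIndex (x : RealIndex k χ) :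
    (shiftedNewformChars hk x.2.1).1 ^ 2 = 1 ∧ (shiftedNewformChars hk x.2.1).2 ^ 2 = 1 := by
  rw [← hasRealCharacters_primE_iff hk, ← (shiftedNewformChars_spec hk x.2.1).2.2]
  exact x.2.2

theorem isShiftedNewform_conj (hχ : ∀ τ, conjChar τ χ = χ) {x : ℕ × (ℍ → ℂ)}
    (hx : IsShiftedNewform k χ x) (τ : cyclo (charExp N) ≃ₐ[ℚ] cyclo (charExp N)) :
    IsShiftedNewform k χ (x.1, primE k (conjPair τ (shiftedNewformChars hk hx))) := by
  obtain ⟨h1, h2, -⟩ := shiftedNewformChars_spec hk hx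
  refine (isShiftedNewform_iff hk χ _).2
    ⟨conjIndex τ (_, x.1), (isAdmissible_conjIndex_iff τ).2 h1, ?_, rfl⟩
  exact (conjChar_mul τ _ _).symm.trans (by rw [h2, hχ])

/-- Conjugation preserves non-real pairs, so the two kinds of terms never meet. If f^σ = g^σ' with
f, g in R, then f = g since R meets each class once, and σ = σ' since coefficients generate the
field. -/
theorem termChars_injective (hχ : ∀ τ, conjChar τ χ = χ)
    (hR : IsSystemOfRepresentatives k χ R) : Injective (termChars (χ := χ) (R := R) hk) := by
  have key (x : TraceIndex k χ R) (σ : fourierField x.1.2 ≃ₐ[ℚ] fourierField x.1.2)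
      (y : RealIndex k χ) : termChars hk (.inl ⟨x, σ⟩) ≠
      termChars (R := R) hk (.inr y) := by
    intro h
    have h1 := sq_eq_one_of_realIndex hk y
    rw [show shiftedNewformChars hk y.2.1 = _ from (congrArg Prod.fst h).symm] at h1
    exact not_sq_eq_one_of_traceIndex hk x
      ⟨(sq_conjChar_eq_one_iff _ _).1 h1.1, (sq_conjChar_eq_one_iff _ _).1 h1.2⟩
  rintro (⟨x, σ⟩ | x) (⟨y, σ'⟩ | y) h
  · have h1 : x.1.1 = y.1.1 := (congrArg Prod.snd h :)
    have h2 : galoisConj x.1.2 σ = galoisConj y.1.2 σ' := by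
      rw [← primE_termChars_inl hk x σ, ← primE_termChars_inl hk y σ', h]
    have h3 := isShiftedNewform_conj hk hχ x.2.1 (liftAut hk x σ)
    rw [← (liftAut_spec hk x σ).2] at h3
    obtain ⟨M, hM, -⟩ := h3
    have h4 : x.1.2 = y.1.2 := (hR.existsUnique M _ hM).unique ⟨x.2.2.1, σ, rfl⟩
      ⟨y.2.2.1, σ', h2.symm⟩
    obtain rfl : x = y := Subtype.ext (Prod.ext h1 h4)
    rw [galoisConj_injective hk (shiftedNewformChars_spec hk x.2.1).2.2 h2]
  · exact (key x σ y h).elim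
  · exact (key y σ' x h.symm).elim
  · have h1 : x.1.1 = y.1.1 := (congrArg Prod.snd h :)
    have h2 : x.1.2 = y.1.2 := by
      rw [← primE_termChars_inr (R := R) hk x, ← primE_termChars_inr (R := R) hk y, h]
    rw [Subtype.ext (Prod.ext h1 h2)]

/-- A newform without real characters is conjugate to some g in R. Conjugation preserves conductors,
so g admits the same shifts. -/
theorem mem_range_termChars (hR : IsSystemOfRepresentatives k χ R)
    {i : CharIndex N} (hi : IsAdmissible k i) (hi' : i.1.1 * i.1.2 = χ) :
    i ∈ Set.range (termChars (χ := χ) (R := R) hk) := by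
  have h1 : IsShiftedNewform k χ (i.2, primE k i.1) :=
    (isShiftedNewform_iff hk χ _).2 ⟨i, hi, hi', rfl⟩
  by_cases hreal : HasRealCharacters k (primE k i.1)
  · refine ⟨.inr ⟨_, h1, hreal⟩, ?_⟩
    exact Prod.ext (primE_injective hk (shiftedNewformChars_spec hk h1).2.2.symm) rfl
  · obtain ⟨M, hM, -⟩ := id h1
    obtain ⟨g, ⟨hg, σ, hσ⟩, -⟩ := hR.existsUnique M _ hM
    obtain ⟨M', hM'⟩ := hR.isNewform g hg
    -- The trivial shift 1 serves only to extract the characters of g.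
    obtain ⟨ψ, -, h3, h4⟩ := exists_primE_eq hk (x := (1, g)) ⟨M', hM', by
      obtain ⟨h, -⟩ := hM'
      simpa using h⟩
    obtain ⟨τ, -, hτ⟩ := exists_galoisConj_eq hk h4 σ
    have h5 : conjPair τ ψ = i.1 := primE_injective hk (hτ.symm.trans hσ)
    have h6 : IsShiftedNewform k χ (i.2, g) := by
      refine (isShiftedNewform_iff hk χ _).2 ⟨(ψ, i.2), ?_, h3, Prod.ext rfl h4⟩
      rw [← isAdmissible_conjIndex_iff τ, conjIndex, h5]
      exact hi
    have h7 : ¬HasRealCharacters k g := fun h ↦ by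
      rw [show g = primE k ψ from h4, hasRealCharacters_primE_iff hk] at h
      rw [← h5, hasRealCharacters_primE_iff hk] at hreal
      exact hreal ⟨(sq_conjChar_eq_one_iff _ _).2 h.1, (sq_conjChar_eq_one_iff _ _).2 h.2⟩
    refine ⟨.inl ⟨⟨(i.2, g), h6, hg, h7⟩, σ⟩, Prod.ext (primE_injective hk ?_) rfl⟩
    exact ((liftAut_spec hk ⟨(i.2, g), h6, hg, h7⟩ σ).2.symm).trans hσ

/-- Take for α the coefficient at the representative f itself; it lies in ℚ(f) because any
automorphism fixing the pair of characters fixes it. -/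
theorem exists_aut_apply_eq {c : CharIndex N → ℂ}
    (hc : ∀ τ i, (c i, c (conjIndex τ i)) ∈ graph τ) (x : TraceIndex k χ R) :
    ∃ α : fourierField x.1.2, ∀ σ : fourierField x.1.2 ≃ₐ[ℚ] fourierField x.1.2,
      (σ α : ℂ) = c (termChars hk (.inl ⟨x, σ⟩)) := by
  set i : CharIndex N := (shiftedNewformChars hk x.2.1, x.1.1)
  have h1 : c i ∈ fourierField x.1.2 := by
    rw [(shiftedNewformChars_spec hk x.2.1).2.2]
    exact mem_fourierField_primE hk fun τ ↦
      ⟨_, hc τ i, fun h ↦ congrArg c (show conjIndex τ i = i from Prod.ext h rfl)⟩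
  exact ⟨⟨c i, h1⟩, fun σ ↦ graph_unique ((liftAut_spec hk x σ).1 ⟨c i, h1⟩) (hc _ i)⟩

/-- An index with real characters is fixed by every automorphism, so its coefficient is fixed too.
-/
theorem exists_ratCast_eq {c : CharIndex N → ℂ}
    (hc : ∀ τ i, (c i, c (conjIndex τ i)) ∈ graph τ) (x : RealIndex k χ) :
    ∃ r : ℚ, (r : ℂ) = c (termChars (R := R) hk (.inr x)) := by
  set i : CharIndex N := (shiftedNewformChars hk x.2.1, x.1.1)
  obtain ⟨r, hr⟩ := eq_ratCast_of_mem_graph (a := c i) fun τ ↦ by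
    have h1 : conjIndex τ i = i :=
      Prod.ext (conjPair_eq_self_of_sq_eq_one τ (sq_eq_one_of_realIndex hk x)) rfl
    have h2 := hc τ i
    rwa [h1] at h2
  exact ⟨r, hr.symm⟩

end

end EisDecomp

/-! ### Existence and uniqueness of the decomposition. -/

namespace EisDecomp

open Complex Filter Function
open UpperHalfPlane hiding I
open scoped Real Manifold

noncomputable section

open EisensteinSeries CongruenceSubgroup

variable {N : ℕ} [NeZero N] {k : ℕ} {χ : DirichletCharacter ℂ N} {R : Set (ℍ → ℂ)}

/-- The coefficients of the terms of a decomposition. -/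
def termCoeff (p : ((x : TraceIndex k χ R) → fourierField x.1.2) × (RealIndex k χ → ℚ)) :
    TermIndex k χ R → ℂ
  | .inl ⟨x, σ⟩ => (σ (p.1 x) : ℂ)
  | .inr x => (p.2 x : ℂ)

theorem finite_aut (hk : 2 ≤ k) (x : TraceIndex k χ R) :
    Finite (fourierField x.1.2 ≃ₐ[ℚ] fourierField x.1.2) := by
  have := finiteDimensional_fourierField_primE hk (shiftedNewformChars hk x.2.1)
  rw [← (shiftedNewformChars_spec hk x.2.1).2.2] at this
  infer_instance

theorem finite_traceIndex (k : ℕ) (χ : DirichletCharacter ℂ N) (R : Set (ℍ → ℂ)) :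
    Finite (TraceIndex k χ R) :=
  ((finite_isShiftedNewform k χ).subset fun _ h ↦ h.1).to_subtype

theorem finite_realIndex (k : ℕ) (χ : DirichletCharacter ℂ N) : Finite (RealIndex k χ) :=
  ((finite_isShiftedNewform k χ).subset fun _ h ↦ h.1).to_subtype

theorem finite_termIndex (hk : 2 ≤ k) : Finite (TermIndex k χ R) := by
  have := finite_traceIndex k χ R
  have := finite_realIndex k χ
  have := fun x : TraceIndex k χ R ↦ finite_aut hk x
  infer_instance

theorem shift_galoisTrace (hk : 2 ≤ k) (x : TraceIndex k χ R) (α : fourierField x.1.2) :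
    shift x.1.1 (galoisTrace x.1.2 α) =
      ∑ᶠ σ : fourierField x.1.2 ≃ₐ[ℚ] fourierField x.1.2,
        (σ α : ℂ) • shift x.1.1 (galoisConj x.1.2 σ) := by
  have := finite_aut hk x
  have := Fintype.ofFinite (fourierField x.1.2 ≃ₐ[ℚ] fourierField x.1.2)
  rw [galoisTrace, finsum_eq_sum_of_fintype, finsum_eq_sum_of_fintype]
  funext z
  simp [shift, Finset.sum_apply]

theorem finsum_shift_eq (hk : 2 ≤ k)
    (p : ((x : TraceIndex k χ R) → fourierField x.1.2) × (RealIndex k χ → ℚ)) :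
    (∑ᶠ x : TraceIndex k χ R, shift x.1.1 (galoisTrace x.1.2 (p.1 x))) +
      ∑ᶠ x : RealIndex k χ, shift x.1.1 ((p.2 x : ℂ) • x.1.2) =
    ∑ᶠ j : TermIndex k χ R, termCoeff p j • shiftE k (termChars hk j) := by
  have := finite_traceIndex k χ R
  have := finite_realIndex k χ
  have := fun x : TraceIndex k χ R ↦ finite_aut hk x
  have := Fintype.ofFinite (TraceIndex k χ R)
  have := Fintype.ofFinite (RealIndex k χ)
  have := fun x : TraceIndex k χ R ↦
    Fintype.ofFinite (fourierField x.1.2 ≃ₐ[ℚ] fourierField x.1.2)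
  rw [finsum_eq_sum_of_fintype, finsum_eq_sum_of_fintype, finsum_eq_sum_of_fintype,
    Fintype.sum_sum_type, Fintype.sum_sigma]
  congr 1
  · refine Finset.sum_congr rfl fun x _ ↦ ?_
    rw [shift_galoisTrace hk, finsum_eq_sum_of_fintype]
    refine Finset.sum_congr rfl fun σ _ ↦ ?_
    rw [shiftE_termChars_inl]
    rfl
  · refine Finset.sum_congr rfl fun x _ ↦ ?_
    rw [shiftE_termChars_inr]
    rfl

/-- The terms are distinct basis vectors covering the support of c, so equality of the two sums is
equality coefficient by coefficient. -/
theorem eq_finsum_iff (hk : 2 ≤ k) (hχ : ∀ τ, conjChar τ χ = χ) (hR : IsSystemOfRepresentatives k χ R)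
    {c : CharIndex N →₀ ℂ} (hc : ∀ i ∈ c.support, IsAdmissible k i ∧ i.1.1 * i.1.2 = χ)
    (a : TermIndex k χ R → ℂ) :
    Finsupp.linearCombination ℂ (shiftE k) c = ∑ᶠ j, a j • shiftE k (termChars hk j) ↔
      ∀ j, a j = c (termChars hk j) := by
  have := finite_termIndex (χ := χ) (R := R) hk
  have := Fintype.ofFinite (TermIndex k χ R)
  have hinj := termChars_injective hk hχ hR
  set c' : CharIndex N →₀ ℂ :=
    (Finsupp.equivFunOnFinite.symm a).mapDomain (termChars hk) with hc'
  have h1 (j : TermIndex k χ R) : c' (termChars hk j) = a j := Finsupp.mapDomain_apply hinj _ _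
  have h2 : ∑ᶠ j, a j • shiftE k (termChars hk j) =
      Finsupp.linearCombination ℂ (shiftE k) c' := by
    rw [finsum_eq_sum_of_fintype, hc', Finsupp.linearCombination_mapDomain,
      Finsupp.linearCombination_apply]
    exact (Finsupp.sum_fintype (Finsupp.equivFunOnFinite.symm a)
      (fun (j : TermIndex k χ R) (b : ℂ) ↦ b • (shiftE k ∘ termChars hk) j)
      fun _ ↦ zero_smul ℂ _).symm
  rw [h2]
  have h3 (i : CharIndex N) (hi : i ∈ c'.support) :
      i ∈ Set.range (termChars (χ := χ) (R := R) hk) := by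
    classical
    obtain ⟨j, -, rfl⟩ := Finset.mem_image.1 (Finsupp.mapDomain_support hi)
    exact ⟨j, rfl⟩
  constructor
  · intro h j
    have h4 : c - c' = 0 := by
      refine linearIndepOn_iff.1 (linearIndepOn_shiftE hk) _ (Submodule.sub_mem _ ?_ ?_)
        (by rw [map_sub, h, sub_self])
      · exact (Finsupp.mem_supported _ _).2 fun i hi ↦ (hc i hi).1.ne_zero
      · refine (Finsupp.mem_supported _ _).2 fun i hi ↦ ?_
        obtain ⟨j, rfl⟩ := h3 i hi
        exact (isAdmissible_termChars hk j).ne_zero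
    rw [← h1, sub_eq_zero.1 h4]
  · intro h
    congr 1
    ext i
    by_cases hi : i ∈ Set.range (termChars (χ := χ) (R := R) hk)
    · obtain ⟨j, rfl⟩ := hi
      rw [h1, h]
    · rw [Finsupp.notMem_support_iff.1 (mt (h3 i) hi)]
      exact Finsupp.notMem_support_iff.1 fun h ↦
        hi (mem_range_termChars hk hR (hc i h).1 (hc i h).2)

theorem existsUnique_decomposition (hk : 2 ≤ k) (hχ : ∀ τ, conjChar τ χ = χ)
    (hR : IsSystemOfRepresentatives k χ R) {c : CharIndex N →₀ ℂ}
    (hc : ∀ i ∈ c.support, IsAdmissible k i ∧ i.1.1 * i.1.2 = χ)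
    (hgal : ∀ τ i, (c i, c (conjIndex τ i)) ∈ graph τ) :
    ∃! p : ((x : TraceIndex k χ R) → fourierField x.1.2) × (RealIndex k χ → ℚ),
      Finsupp.linearCombination ℂ (shiftE k) c =
        (∑ᶠ x : TraceIndex k χ R, shift x.1.1 (galoisTrace x.1.2 (p.1 x))) +
          ∑ᶠ x : RealIndex k χ, shift x.1.1 ((p.2 x : ℂ) • x.1.2) := by
  simp only [finsum_shift_eq hk, eq_finsum_iff hk hχ hR hc]
  choose α hα using fun x : TraceIndex k χ R ↦ exists_aut_apply_eq hk hgal x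
  choose r hr using fun x : RealIndex k χ ↦ exists_ratCast_eq (R := R) hk hgal x
  refine ⟨(α, r), ?_, fun p hp ↦ Prod.ext (funext fun x ↦ ?_) (funext fun x ↦ ?_)⟩
  · rintro (⟨x, σ⟩ | x)
    · exact hα x σ
    · exact hr x
  -- The term with σ = 1 alone determines α.
  · exact Subtype.ext ((hp (.inl ⟨x, 1⟩)).trans (hα x 1).symm)
  · have := (hp (.inr x)).trans (hr x).symm
    exact Rat.cast_injective (α := ℂ) this

/-- An automorphism sends nonzero coefficients to nonzero ones, so it permutes the support.
Conjugating the product of characters χ at one index gives the product at another, which is again χ.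
-/
theorem conjChar_eq_self {c : CharIndex N →₀ ℂ} (hc0 : c ≠ 0)
    (hc : ∀ i ∈ c.support, i.1.1 * i.1.2 = χ)
    (hgal : ∀ τ i, (c i, c (conjIndex τ i)) ∈ graph τ)
    (τ : cyclo (charExp N) ≃ₐ[ℚ] cyclo (charExp N)) : conjChar τ χ = χ := by
  obtain ⟨i, hi⟩ := Finsupp.support_nonempty_iff.2 hc0
  have h1 : conjIndex τ i ∈ c.support := by
    rw [Finsupp.mem_support_iff] at hi ⊢
    intro h
    obtain ⟨y, hy, hy'⟩ := mem_graph.1 (hgal τ i)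
    simp only at hy hy'
    rw [h, ZeroMemClass.coe_eq_zero, map_eq_zero] at hy'
    rw [← hy, hy'] at hi
    exact hi rfl
  rw [← hc i hi, conjChar_mul]
  exact (hc _ h1).trans (hc i hi).symm

end

end EisDecomp

theorem mainTheorem8 (k N : ℕ) [NeZero N] (hk : 2 ≤ k) (χ : DirichletCharacter ℂ N)
    (E : ModularForm ((CongruenceSubgroup.Gamma1 N).map (Matrix.SpecialLinearGroup.mapGL ℝ)) k)
    (hE : E ∈ EisDecomp.eisensteinSubspace k χ) (hE₀ : E ≠ 0)
    (hrat : ∀ n : ℕ, ∃ q : ℚ, EisDecomp.fourierCoeff E n = (q : ℂ)) :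
    (χ = 1 ∨ orderOf χ = 2) ∧
    ∀ R : Set (UpperHalfPlane → ℂ), EisDecomp.IsSystemOfRepresentatives k χ R →
      ∃! p : ((x : EisDecomp.TraceIndex k χ R) → EisDecomp.fourierField x.1.2) ×
          (EisDecomp.RealIndex k χ → ℚ),
        (⇑E : UpperHalfPlane → ℂ) =
          (∑ᶠ x : EisDecomp.TraceIndex k χ R,
            EisDecomp.shift x.1.1 (EisDecomp.galoisTrace x.1.2 (p.1 x))) +
          ∑ᶠ x : EisDecomp.RealIndex k χ,
            EisDecomp.shift x.1.1 ((p.2 x : ℂ) • x.1.2) := by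
  obtain ⟨c, hc, hEc⟩ := EisDecomp.exists_eq_sum_shiftE hk hE
  have hEc' : ⇑E = Finsupp.linearCombination ℂ (EisDecomp.shiftE k) c := hEc
  have hc' : ∀ i ∈ c.support, i.2 ≠ 0 := fun i hi ↦ (hc i hi).1.ne_zero
  -- Rationality of E enters only here.
  have hgal := EisDecomp.coeff_mem_graph hk hc' fun l ↦ by
    rw [← (EisDecomp.hasQSeries_linearCombination hk hc').fourierCoeff_eq, ← hEc']
    exact hrat l
  have hc0 : c ≠ 0 := by
    rintro rfl
    exact hE₀ (DFunLike.coe_injective (by rw [hEc', map_zero]; rfl))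
  have hχ := EisDecomp.conjChar_eq_self hc0 (fun i hi ↦ (hc i hi).2) hgal
  refine ⟨EisDecomp.eq_one_or_orderOf_eq_two hχ, fun R hR ↦ ?_⟩
  rw [hEc']
  exact EisDecomp.existsUnique_decomposition hk hχ hR hc hgal
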